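/- Let $t=(t_1,t_2,t_3,t_4)\in\mathbb C^4$ and let \[P(t_2,t_3,t_4,Z)=Z^8+\tfrac{32}{5}t_4Z^5+64t_3Z^3-\tfrac{64}{5}t_4^2Z^2+128t_3t_4-t_2 .\] Let $U\subseteq\mathbb C^4$ be open and let $Z:U\to\mathbb C$ be a holomorphic function with $P(t_2,t_3,t_4,Z(t))=0$ on $U$. The algebraic Frobenius manifold $H_4(7)$ is given on $U$ by the prepotential \begin{align*} F(t)=& \, t_1t_2t_3+\frac{1}{2}t_1^2t_4-\frac{4096}{135}t_3t_4\left(315t_3^3+32t_4^5\right)+\frac{32768}{1125}t_4^2\left(75t_3^3+2t_4^5\right)Z^2 \\ &-\frac{32768}{225}t_3\left(75t_3^3+2t_4^5\right)Z^3-\frac{16384}{5625}t_4\left(375t_3^3+14t_4^5\right)Z^5+\frac{34816}{225}t_3t_4^4Z^6 \\ &-\frac{116736}{175}t_3^2t_4^2Z^7+\frac{256}{75}\left(220t_3^3+3t_4^5\right)Z^8-\frac{118784}{945}t_3t_4^3Z^9+\frac{44544}{175}t_3^2t_4Z^{10} \\ &-\frac{5632}{1575}t_4^4Z^{11}+\frac{832}{225}t_3t_4^2Z^{12}+\frac{17664}{455}t_3^2Z^{13}-\frac{352}{315}t_4^3Z^{14}+\frac{1568}{225}t_3t_4Z^{15}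 \\ &+\frac{496}{2975}t_4^2Z^{17}+\frac{496}{945}t_3Z^{18}+\frac{71}{1575}t_4Z^{20}+\frac{16}{7245}Z^{23}. \end{align*} (with $Z=Z(t)$), the Euler vector field $E=t_1\partial_{t_1}+\frac45t_2\partial_{t_2}+\frac12t_3\partial_{t_3}+\frac3{10}t_4\partial_{t_4}$, the unity field $e=\partial_{t_1}$ and the charge $d=\frac7{10}$. Put $c_{ijk}=\partial_{t_i}\partial_{t_j}\partial_{t_k}F$, $\eta_{ij}=c_{ij1}$, $(\eta^{ij})=(\eta_{ij})^{-1}$, $c^{ij}_k=\eta^{ia}\eta^{jb}c_{abk}$, and let $g^{ij}=E^kc^{ij}_k$ be the intersection form (summation over repeated indices). Normalised flat coordinates of $g$ on an open set $W\subseteq U$ are holomorphic functions $x=(x_1,\dots,x_4):W\to\mathbb C^4$ with $g^{ab}\,\partial_{t_a}x_i\,\partial_{t_b}x_j=\delta_{ij}$ and $E(x_i)=\frac{1-d}2x_i$. Let $y_1,\dots,y_4$ be the following basic invariants, of degrees $30,20,12,2$, of the Coxeter group $H_4$: \begin{align*} y_1=& \, \frac{32}{3}x_1^{24}h_2^3-40x_1^{22}\left(2h_2^4+3h_2h_6\right)+x_1^{20}\left(360h_{10}+\frac{1344}{5}h_2^5+672h_2^2h_6\right)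 \\ &+x_1^{18}\left(1080h_6^2-1608h_2^3h_6-\frac{1328}{3}h_2^6-2880h_{10}h_2\right) \\ &+x_1^{16}\left(10024h_{10}h_2^2+272h_2^7+1248h_2^4h_6-5628h_2h_6^2\right) \\ &+x_1^{14}\left(18588h_2^2h_6^2+272h_2^8-7620h_{10}h_6-16856h_{10}h_2^3\right) \\ &+x_1^{12}\left(14216h_{10}h_2^4+23508h_{10}h_6h_2-\frac{1328}{3}h_2^9-1248h_6h_2^6-27396h_6^2h_2^3 \right. \\ &\biggl. -5796h_6^3\biggr)+x_1^{10}\left(3240h_{10}^2-7160h_{10}h_2^5-25332h_{10}h_6h_2^2+\frac{1344}{5}h_2^{10} \right. \\ &\biggl. +1608h_2^7h_6+19968h_2^4h_6^2+7350h_2h_6^3\biggr)+x_1^8\left(2144h_{10}h_2^6-3232h_{10}^2h_2 \right. \\ &\left. +10908h_{10}h_2^3h_6-906h_{10}h_6^2-80h_2^{11}-672h_2^8h_6-6924h_2^5h_6^2-1956h_2^2h_6^3\right) \\ &+x_1^6\left(1168h_{10}^2h_2^2-344h_{10}h_2^7-2172h_{10}h_2^4h_6-1908h_{10}h_2h_6^2+\frac{32}{3}h_2^{12}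 \right. \\ &\biggl. +120h_2^9h_6+1332h_2^6h_6^2+288h_2^3h_6^3+2394h_6^4\biggr)+x_1^4\left(348h_{10}^2h_6-152h_{10}^2h_2^3 \right. \\ &\left. +16h_{10}h_2^8+60h_{10}h_6h_2^5+408h_{10}h_6^2h_2^2-84h_2^7h_6^2+84h_2^4h_6^3-909h_2h_6^4\right) \\ &+x_1^2\left(8h_{10}^2h_2^4-42h_{10}h_6^2h_2^3-87h_{10}h_6^3-6h_2^5h_6^3+135h_2^2h_6^4\right) \\ &+\frac{4}{3}h_{10}^3-3h_{10}h_2h_6^3+\frac{9}{5}h_6^5, \\ y_2=& \, 4x_1^{16}h_2^2-10x_1^{14}\left(2h_2^3+3h_6\right)+x_1^{12}\left(44h_2^4+138h_2h_6\right) \\ &+x_1^{10}\left(180h_{10}-44h_2^5-402h_2^2h_6\right)+x_1^8\left(44h_2^6-464h_{10}h_2+402h_2^3h_6+294h_6^2\right) \\ &+x_1^6\left(296h_{10}h_2^2-20h_2^7-138h_2^4h_6-306h_2h_6^2\right)+x_1^4\left(4h_2^8-76h_{10}h_2^3-114h_{10}h_6 \right. \\ &\left. +30h_2^5h_6+168h_2^2h_6^2\right)+x_1^2\left(4h_{10}h_2^4-21h_2^3h_6^2+\frac{57}{2}h_6^3\right)+h_{10}^2-\frac{3}{2}h_2h_6^3,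 \\ y_3=& \, -2x_1^{10}h_2+6x_1^8h_2^2+x_1^6\left(33h_6-14h_2^3\right)-x_1^4\left(33h_2h_6-6h_2^4\right) \\ &+x_1^2\left(11h_{10}-2h_2^5\right)-h_{10}h_2+\frac{3}{2}h_6^2, \\ y_4=& \, x_1^2+h_2, \end{align*} where $h_2=\epsilon_1$, $h_6=\sqrt5\,\delta+\epsilon_1\epsilon_2-11\epsilon_3$, $h_{10}=95\epsilon_2\epsilon_3-32\epsilon_1^2\epsilon_3-5\epsilon_1\epsilon_2^2+2\epsilon_1^3\epsilon_2+3\sqrt5\,\delta\epsilon_2$, $\epsilon_1=x_2^2+x_3^2+x_4^2$, $\epsilon_2=x_2^2x_3^2+x_2^2x_4^2+x_3^2x_4^2$, $\epsilon_3=x_2^2x_3^2x_4^2$ and $\delta=(x_2^2-x_3^2)(x_2^2-x_4^2)(x_3^2-x_4^2)$. Consider the relations \[y_1=-\frac{5^4}{3^{28}\cdot7}\,q_1(t,Z),\qquad y_2=\frac{5^3}{2^3\cdot3^{18}}\,q_2(t,Z),\qquad y_3=-\frac{5^3}{2^2\cdot3^{11}}\,q_3(t,Z),\qquad y_4=\frac{40}3t_4,\tag{$*$}\]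 where \begin{align*} q_1=\;&2^{3}\cdot 3^{4}\cdot 5^{18}\cdot 7\,Z^{7}t_1^{3}t_2-2^{3}\cdot 3^{7}\cdot 5^{15}\cdot 7\,Zt_1^{2}t_2^{3}+3^{3}\cdot 5^{14}\cdot 7\cdot 11\cdot 31\,Z^{3}t_1t_2^{4}-5^{13}\cdot 7\cdot 1831\,Z^{5}t_2^{5}\\ &-2^{4}\cdot 3^{6}\cdot 5^{20}\cdot 7\,t_1^{4}t_3+2^{4}\cdot 3^{4}\cdot 5^{18}\cdot 7^{3}\,Z^{2}t_1^{3}t_2t_3+3^{5}\cdot 5^{15}\cdot 2\cdot 7\cdot 967\,Z^{4}t_1^{2}t_2^{2}t_3-3^{4}\cdot 5^{14}\cdot 2\cdot 7\cdot 2383\,Z^{6}t_1t_2^{3}t_3\\ &+2^{2}\cdot 5^{13}\cdot 7\cdot 19121\,t_2^{5}t_3-2^{8}\cdot 3^{4}\cdot 5^{18}\cdot 7^{2}\,Z^{5}t_1^{3}t_3^{2}-2^{6}\cdot 3^{6}\cdot 5^{15}\cdot 7\cdot 283\,Z^{7}t_1^{2}t_2t_3^{2}+2^{5}\cdot 3^{4}\cdot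 5^{16}\cdot 7\cdot 11\cdot 17\,Zt_1t_2^{3}t_3^{2}\\ &-2^{6}\cdot 5^{13}\cdot 3\cdot 7\cdot 31547\,Z^{3}t_2^{4}t_3^{2}-2^{12}\cdot 3^{5}\cdot 5^{18}\cdot 7\cdot 61\,t_1^{3}t_3^{3}-2^{12}\cdot 3^{5}\cdot 5^{15}\cdot 7\cdot 257\,Z^{2}t_1^{2}t_2t_3^{3}-2^{8}\cdot 3^{3}\cdot 5^{14}\cdot 7\cdot 47\cdot 421\,Z^{4}t_1t_2^{2}t_3^{3}\\ &-2^{7}\cdot 5^{13}\cdot 7\cdot 131\cdot 2647\,Z^{6}t_2^{3}t_3^{3}-2^{14}\cdot 3^{5}\cdot 5^{15}\cdot 7\cdot 1153\,Z^{5}t_1^{2}t_3^{4}-2^{21}\cdot 3^{3}\cdot 5^{14}\cdot 7\cdot 239\,Z^{7}t_1t_2t_3^{4}+2^{11}\cdot 5^{13}\cdot 3\cdot 7\cdot 181\cdot 6269\,Zt_2^{3}t_3^{4}\\ &-2^{17}\cdot 3^{6}\cdot 5^{15}\cdot 7\cdot 13\cdot 1291\,t_1^{2}t_3^{5}+2^{16}\cdot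 3^{5}\cdot 5^{14}\cdot 7\cdot 16447\,Z^{2}t_1t_2t_3^{5}-2^{13}\cdot 5^{14}\cdot 3\cdot 7\cdot 3183137\,Z^{4}t_2^{2}t_3^{5}-2^{20}\cdot 3^{5}\cdot 5^{15}\cdot 7\cdot 17\cdot 643\,Z^{5}t_1t_3^{6}\\ &+2^{18}\cdot 5^{14}\cdot 7\cdot 1747\cdot 1789\,Z^{7}t_2t_3^{6}-2^{24}\cdot 3^{5}\cdot 5^{15}\cdot 7\cdot 34649\,t_1t_3^{7}+2^{23}\cdot 5^{14}\cdot 7\cdot 2511151\,Z^{2}t_2t_3^{7}-2^{26}\cdot 5^{15}\cdot 7^{2}\cdot 112687\,Z^{5}t_3^{8}\\ &-2^{28}\cdot 3^{3}\cdot 5^{15}\cdot 7\cdot 530807\,t_3^{9}+3^{5}\cdot 5^{17}\cdot 7^{3}\cdot 2\,Z^{4}t_1^{3}t_2t_4+2^{2}\cdot 3^{7}\cdot 5^{14}\cdot 7\cdot 67\,Z^{6}t_1^{2}t_2^{2}t_4-3^{4}\cdot 5^{13}\cdot 7\cdot 41\,t_1t_2^{4}t_4\\ &-5^{13}\cdot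 2\cdot 7\cdot 4871\,Z^{2}t_2^{5}t_4-2^{6}\cdot 3^{4}\cdot 5^{17}\cdot 7^{2}\cdot 13\,Z^{7}t_1^{3}t_3t_4+2^{5}\cdot 3^{5}\cdot 5^{14}\cdot 7\cdot 23\cdot 199\,Zt_1^{2}t_2^{2}t_3t_4-2^{4}\cdot 3^{3}\cdot 5^{14}\cdot 7\cdot 1091\,Z^{3}t_1t_2^{3}t_3t_4\\ &-2^{5}\cdot 5^{13}\cdot 7\cdot 11\cdot 3119\,Z^{5}t_2^{4}t_3t_4-2^{11}\cdot 3^{4}\cdot 5^{18}\cdot 7^{3}\,Z^{2}t_1^{3}t_3^{2}t_4+2^{7}\cdot 3^{6}\cdot 5^{14}\cdot 7\cdot 10169\,Z^{4}t_1^{2}t_2t_3^{2}t_4-2^{7}\cdot 3^{4}\cdot 5^{13}\cdot 7\cdot 53\cdot 401\,Z^{6}t_1t_2^{2}t_3^{2}t_4\\ &+2^{6}\cdot 5^{12}\cdot 7\cdot 4272533\,t_2^{4}t_3^{2}t_4-2^{12}\cdot 3^{5}\cdot 5^{14}\cdot 7\cdot 37\cdot 367\,Z^{7}t_1^{2}t_3^{3}t_4-2^{12}\cdot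 3^{3}\cdot 5^{13}\cdot 7\cdot 127\cdot 251\,Zt_1t_2^{2}t_3^{3}t_4-2^{10}\cdot 5^{12}\cdot 7^{2}\cdot 3\cdot 19\cdot 48157\,Z^{3}t_2^{3}t_3^{3}t_4\\ &+2^{19}\cdot 3^{5}\cdot 5^{15}\cdot 7\cdot 257\,Z^{2}t_1^{2}t_3^{4}t_4-2^{13}\cdot 3^{3}\cdot 5^{13}\cdot 7\cdot 1883993\,Z^{4}t_1t_2t_3^{4}t_4+2^{13}\cdot 5^{13}\cdot 7^{2}\cdot 3\cdot 397\cdot 557\,Z^{6}t_2^{2}t_3^{4}t_4-2^{18}\cdot 3^{3}\cdot 5^{14}\cdot 7\cdot 67\cdot 293\,Z^{7}t_1t_3^{5}t_4\\ &-2^{17}\cdot 5^{13}\cdot 13^{2}\cdot 3\cdot 7\cdot 22063\,Zt_2^{2}t_3^{5}t_4-2^{23}\cdot 3^{5}\cdot 5^{14}\cdot 7\cdot 16447\,Z^{2}t_1t_3^{6}t_4+2^{19}\cdot 5^{13}\cdot 73^{2}\cdot 7\cdot 12347\,Z^{4}t_2t_3^{6}t_4-2^{24}\cdot 5^{14}\cdot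 7^{2}\cdot 3\cdot 31\cdot 6673\,Z^{7}t_3^{7}t_4\\ &-2^{30}\cdot 5^{14}\cdot 7\cdot 2511151\,Z^{2}t_3^{8}t_4-2^{5}\cdot 3^{7}\cdot 5^{16}\cdot 7^{2}\,Zt_1^{3}t_2t_4^{2}+2^{5}\cdot 3^{7}\cdot 5^{13}\cdot 7\cdot 367\,Z^{3}t_1^{2}t_2^{2}t_4^{2}+2^{5}\cdot 3^{4}\cdot 5^{13}\cdot 7\cdot 2099\,Z^{5}t_1t_2^{3}t_4^{2}\\ &-2^{4}\cdot 5^{12}\cdot 7\cdot 11\cdot 3517\,Z^{7}t_2^{4}t_4^{2}-2^{7}\cdot 3^{4}\cdot 5^{16}\cdot 7^{2}\cdot 173\,Z^{4}t_1^{3}t_3t_4^{2}-2^{6}\cdot 3^{5}\cdot 5^{13}\cdot 7\cdot 19\cdot 29\cdot 59\,Z^{6}t_1^{2}t_2t_3t_4^{2}+2^{5}\cdot 3^{4}\cdot 5^{12}\cdot 7\cdot 407717\,t_1t_2^{3}t_3t_4^{2}\\ &-2^{5}\cdot 3^{3}\cdot 5^{13}\cdot 7\cdot 149\cdot 271\,Z^{2}t_2^{4}t_3t_4^{2}-2^{11}\cdot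 3^{5}\cdot 5^{13}\cdot 7\cdot 19\cdot 3119\,Zt_1^{2}t_2t_3^{2}t_4^{2}+2^{9}\cdot 3^{4}\cdot 5^{12}\cdot 7\cdot 61\cdot 48311\,Z^{3}t_1t_2^{2}t_3^{2}t_4^{2}+2^{9}\cdot 5^{13}\cdot 7\cdot 11\cdot 19\cdot 479\,Z^{5}t_2^{3}t_3^{2}t_4^{2}\\ &-2^{13}\cdot 3^{5}\cdot 5^{13}\cdot 7\cdot 311\cdot 439\,Z^{4}t_1^{2}t_3^{3}t_4^{2}-2^{14}\cdot 3^{4}\cdot 5^{13}\cdot 7\cdot 61\cdot 4663\,Z^{6}t_1t_2t_3^{3}t_4^{2}+2^{11}\cdot 5^{12}\cdot 7\cdot 13\cdot 3501503\,t_2^{3}t_3^{3}t_4^{2}+2^{17}\cdot 3^{4}\cdot 5^{13}\cdot 7\cdot 14029\,Zt_1t_2t_3^{4}t_4^{2}\\ &-2^{15}\cdot 5^{12}\cdot 3\cdot 7\cdot 11\cdot 13\cdot 104297\,Z^{3}t_2^{2}t_3^{4}t_4^{2}-2^{19}\cdot 3^{3}\cdot 5^{13}\cdot 7\cdot 4814471\,Z^{4}t_1t_3^{5}t_4^{2}-2^{18}\cdot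 3^{2}\cdot 5^{13}\cdot 7\cdot 3231829\,Z^{6}t_2t_3^{5}t_4^{2}+2^{23}\cdot 5^{13}\cdot 3\cdot 7\cdot 47\cdot 263303\,Zt_2t_3^{6}t_4^{2}\\ &-2^{25}\cdot 3^{2}\cdot 5^{13}\cdot 7\cdot 1951\cdot 29207\,Z^{4}t_3^{7}t_4^{2}+2^{6}\cdot 3^{4}\cdot 5^{15}\cdot 7^{2}\cdot 17\,Z^{6}t_1^{3}t_4^{3}-2^{4}\cdot 3^{7}\cdot 5^{12}\cdot 7\cdot 11\cdot 79\,t_1^{2}t_2^{2}t_4^{3}+2^{4}\cdot 3^{3}\cdot 5^{12}\cdot 7\cdot 89\cdot 6449\,Z^{2}t_1t_2^{3}t_4^{3}\\ &+2^{4}\cdot 5^{11}\cdot 3\cdot 7\cdot 211\cdot 6449\,Z^{4}t_2^{4}t_4^{3}+2^{12}\cdot 3^{7}\cdot 5^{16}\cdot 7^{2}\,Zt_1^{3}t_3t_4^{3}-2^{10}\cdot 3^{5}\cdot 5^{12}\cdot 7\cdot 208253\,Z^{3}t_1^{2}t_2t_3t_4^{3}-2^{15}\cdot 3^{3}\cdot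 5^{12}\cdot 7\cdot 1429\,Z^{5}t_1t_2^{2}t_3t_4^{3}\\ &-2^{8}\cdot 5^{11}\cdot 7\cdot 31\cdot 181\cdot 3659\,Z^{7}t_2^{3}t_3t_4^{3}+2^{12}\cdot 3^{5}\cdot 5^{14}\cdot 7\cdot 13\cdot 37\cdot 59\,Z^{6}t_1^{2}t_3^{2}t_4^{3}+2^{16}\cdot 3^{2}\cdot 5^{13}\cdot 23^{2}\,Z^{10}t_2^{2}t_3^{2}t_4^{3}+2^{12}\cdot 3^{3}\cdot 5^{12}\cdot 7^{2}\cdot 1178167\,t_1t_2^{2}t_3^{2}t_4^{3}\\ &-2^{10}\cdot 5^{11}\cdot 2107634939\,Z^{2}t_2^{3}t_3^{2}t_4^{3}+2^{18}\cdot 3^{8}\cdot 5^{13}\cdot 7\cdot 1033\,Zt_1^{2}t_3^{3}t_4^{3}-2^{17}\cdot 3^{3}\cdot 5^{12}\cdot 7\cdot 13\cdot 23\cdot 4099\,Z^{3}t_1t_2t_3^{3}t_4^{3}+2^{18}\cdot 5^{11}\cdot 107\cdot 330509\,Z^{5}t_2^{2}t_3^{3}t_4^{3}\\ &-2^{18}\cdot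 3^{4}\cdot 5^{13}\cdot 7\cdot 377563\,Z^{6}t_1t_3^{4}t_4^{3}+2^{24}\cdot 3^{2}\cdot 5^{16}\cdot 23\,Z^{8}t_2t_3^{4}t_4^{3}+2^{16}\cdot 5^{13}\cdot 491035057\,t_2^{2}t_3^{4}t_4^{3}-2^{24}\cdot 3^{3}\cdot 5^{13}\cdot 7\cdot 373\cdot 523\,Zt_1t_3^{5}t_4^{3}\\ &-2^{22}\cdot 5^{12}\cdot 3\cdot 658847099\,Z^{3}t_2t_3^{5}t_4^{3}+2^{24}\cdot 5^{12}\cdot 7\cdot 25229\cdot 55439\,Z^{6}t_3^{6}t_4^{3}-2^{30}\cdot 5^{13}\cdot 3\cdot 7\cdot 23\cdot 71\cdot 5791\,Zt_3^{7}t_4^{3}-2^{12}\cdot 3^{4}\cdot 5^{15}\cdot 7^{2}\,Z^{3}t_1^{3}t_4^{4}\\ &+2^{9}\cdot 3^{12}\cdot 5^{12}\cdot 7\,Z^{5}t_1^{2}t_2t_4^{4}+2^{7}\cdot 3^{3}\cdot 5^{11}\cdot 7\cdot 13\cdot 17\cdot 5981\,Z^{7}t_1t_2^{2}t_4^{4}+2^{12}\cdot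 3^{2}\cdot 5^{12}\cdot 13\,Z^{9}t_2^{3}t_4^{4}+2^{8}\cdot 5^{10}\cdot 1553\cdot 74317\,Zt_2^{4}t_4^{4}\\ &-2^{10}\cdot 3^{5}\cdot 5^{12}\cdot 7\cdot 23\cdot 97849\,t_1^{2}t_2t_3t_4^{4}-2^{16}\cdot 3^{2}\cdot 5^{12}\cdot 23\,Z^{12}t_2^{2}t_3t_4^{4}+2^{9}\cdot 3^{4}\cdot 5^{11}\cdot 7^{2}\cdot 644789\,Z^{2}t_1t_2^{2}t_3t_4^{4}-2^{10}\cdot 5^{10}\cdot 684923563\,Z^{4}t_2^{3}t_3t_4^{4}\\ &+2^{16}\cdot 3^{5}\cdot 5^{13}\cdot 7\cdot 11\cdot 23\cdot 157\,Z^{3}t_1^{2}t_3^{2}t_4^{4}+2^{14}\cdot 3^{5}\cdot 5^{11}\cdot 7\cdot 239\cdot 1361\,Z^{5}t_1t_2t_3^{2}t_4^{4}-2^{15}\cdot 5^{10}\cdot 3\cdot 7\cdot 105745993\,Z^{7}t_2^{2}t_3^{2}t_4^{4}+2^{24}\cdot 3^{4}\cdot 5^{14}\,Z^{10}t_2t_3^{3}t_4^{4}\\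 &+2^{17}\cdot 3^{5}\cdot 5^{13}\cdot 7^{2}\cdot 144073\,t_1t_2t_3^{3}t_4^{4}-2^{15}\cdot 5^{10}\cdot 31\cdot 2275515659\,Z^{2}t_2^{2}t_3^{3}t_4^{4}-2^{25}\cdot 3^{3}\cdot 5^{12}\cdot 7^{2}\cdot 19\cdot 1987\,Z^{3}t_1t_3^{4}t_4^{4}-2^{20}\cdot 5^{10}\cdot 7\cdot 17\cdot 683\cdot 247601\,Z^{5}t_2t_3^{4}t_4^{4}\\ &+2^{30}\cdot 3^{2}\cdot 5^{17}\,Z^{8}t_3^{5}t_4^{4}-2^{22}\cdot 5^{11}\cdot 56634970591\,t_2t_3^{5}t_4^{4}+2^{28}\cdot 3^{2}\cdot 5^{11}\cdot 59\cdot 56802241\,Z^{3}t_3^{6}t_4^{4}-2^{16}\cdot 3^{4}\cdot 5^{15}\cdot 7\cdot 97\,t_1^{3}t_4^{5}\\ &+2^{10}\cdot 3^{12}\cdot 5^{10}\cdot 7\cdot 103\,Z^{2}t_1^{2}t_2t_4^{5}+2^{14}\cdot 3^{2}\cdot 5^{11}\,Z^{14}t_2^{2}t_4^{5}+2^{8}\cdot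 3^{3}\cdot 5^{9}\cdot 7\cdot 17\cdot 6436589\,Z^{4}t_1t_2^{2}t_4^{5}+2^{8}\cdot 5^{8}\cdot 3\cdot 83\cdot 113\cdot 283487\,Z^{6}t_2^{3}t_4^{5}\\ &-2^{15}\cdot 3^{10}\cdot 5^{10}\cdot 7^{2}\cdot 367\,Z^{5}t_1^{2}t_3t_4^{5}+2^{12}\cdot 3^{3}\cdot 5^{10}\cdot 7\cdot 47\cdot 409\cdot 1801\,Z^{7}t_1t_2t_3t_4^{5}-2^{15}\cdot 3^{3}\cdot 5^{11}\cdot 89\cdot 241\,Z^{9}t_2^{2}t_3t_4^{5}+2^{15}\cdot 5^{8}\cdot 19^{2}\cdot 379\cdot 72043\,Zt_2^{3}t_3t_4^{5}\\ &-2^{17}\cdot 3^{5}\cdot 5^{12}\cdot 7\cdot 67\cdot 151\cdot 443\,t_1^{2}t_3^{2}t_4^{5}+2^{20}\cdot 3^{2}\cdot 5^{12}\cdot 29\cdot 173\,Z^{12}t_2t_3^{2}t_4^{5}+2^{17}\cdot 3^{3}\cdot 5^{9}\cdot 7\cdot 242346031\,Z^{2}t_1t_2t_3^{2}t_4^{5}-2^{14}\cdot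 5^{8}\cdot 3\cdot 17\cdot 29\cdot 307\cdot 2364179\,Z^{4}t_2^{2}t_3^{2}t_4^{5}\\ &+2^{21}\cdot 3^{3}\cdot 5^{9}\cdot 7\cdot 151247651\,Z^{5}t_1t_3^{3}t_4^{5}+2^{18}\cdot 5^{9}\cdot 21157\cdot 4697569\,Z^{7}t_2t_3^{3}t_4^{5}+2^{27}\cdot 3^{2}\cdot 5^{15}\cdot 13\cdot 17\,Z^{10}t_3^{4}t_4^{5}+2^{24}\cdot 3^{3}\cdot 5^{13}\cdot 7\cdot 2004073\,t_1t_3^{4}t_4^{5}\\ &-2^{22}\cdot 5^{8}\cdot 3\cdot 883\cdot 159406111\,Z^{2}t_2t_3^{4}t_4^{5}-2^{29}\cdot 5^{8}\cdot 3343\cdot 11789651\,Z^{5}t_3^{5}t_4^{5}-2^{29}\cdot 5^{11}\cdot 85909378939\,t_3^{6}t_4^{5}+2^{14}\cdot 3^{14}\cdot 5^{9}\cdot 7\,Z^{7}t_1^{2}t_4^{6}\\ &+2^{14}\cdot 3^{2}\cdot 5^{10}\cdot 1523\,Z^{11}t_2^{2}t_4^{6}-2^{11}\cdot 3^{3}\cdot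 5^{8}\cdot 7\cdot 13\cdot 73\cdot 627131\,Zt_1t_2^{2}t_4^{6}+2^{11}\cdot 5^{7}\cdot 6691\cdot 10945717\,Z^{3}t_2^{3}t_4^{6}-2^{16}\cdot 3^{10}\cdot 5^{10}\cdot 7\cdot 739\,Z^{2}t_1^{2}t_3t_4^{6}\\ &-2^{19}\cdot 3^{3}\cdot 5^{11}\cdot 73\,Z^{14}t_2t_3t_4^{6}+2^{13}\cdot 3^{3}\cdot 5^{8}\cdot 7\cdot 6560672719\,Z^{4}t_1t_2t_3t_4^{6}-2^{13}\cdot 5^{8}\cdot 3\cdot 19\cdot 107\cdot 271\cdot 4603\,Z^{6}t_2^{2}t_3t_4^{6}-2^{21}\cdot 3^{4}\cdot 5^{8}\cdot 7\cdot 195868609\,Z^{7}t_1t_3^{2}t_4^{6}\\ &+2^{21}\cdot 3^{2}\cdot 5^{10}\cdot 173\cdot 2039\,Z^{9}t_2t_3^{2}t_4^{6}-2^{17}\cdot 5^{7}\cdot 3\cdot 175949\cdot 534167\,Zt_2^{2}t_3^{2}t_4^{6}+2^{26}\cdot 3^{3}\cdot 5^{13}\cdot 73\,Z^{12}t_3^{3}t_4^{6}-2^{25}\cdot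 3^{3}\cdot 5^{9}\cdot 7\cdot 307854203\,Z^{2}t_1t_3^{3}t_4^{6}\\ &+2^{19}\cdot 5^{7}\cdot 17\cdot 1171\cdot 755025827\,Z^{4}t_2t_3^{3}t_4^{6}+2^{26}\cdot 5^{7}\cdot 3\cdot 11\cdot 29\cdot 1522702439\,Z^{7}t_3^{4}t_4^{6}+2^{28}\cdot 5^{8}\cdot 17\cdot 23\cdot 99971\cdot 187073\,Z^{2}t_3^{5}t_4^{6}+2^{17}\cdot 3^{14}\cdot 5^{9}\cdot 7\,Z^{4}t_1^{2}t_4^{7}\\ &+2^{12}\cdot 3^{3}\cdot 5^{7}\cdot 7\cdot 17\cdot 61\cdot 545533\,Z^{6}t_1t_2t_4^{7}+2^{12}\cdot 3^{2}\cdot 5^{9}\cdot 1747\cdot 2179\,Z^{8}t_2^{2}t_4^{7}+2^{12}\cdot 5^{6}\cdot 3\cdot 7\cdot 25411781761\,t_2^{3}t_4^{7}-2^{18}\cdot 3^{2}\cdot 5^{9}\cdot 7\cdot 31\cdot 101\cdot 109\,Z^{11}t_2t_3t_4^{7}\\ &+2^{18}\cdot 3^{4}\cdot 5^{7}\cdot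 7\cdot 3491\cdot 87421\,Zt_1t_2t_3t_4^{7}+2^{16}\cdot 5^{6}\cdot 3\cdot 11\cdot 41\cdot 625672687\,Z^{3}t_2^{2}t_3t_4^{7}+2^{22}\cdot 3^{4}\cdot 5^{11}\cdot 73^{2}\,Z^{14}t_3^{2}t_4^{7}-2^{20}\cdot 3^{3}\cdot 5^{7}\cdot 7^{2}\cdot 13^{2}\cdot 607\cdot 45503\,Z^{4}t_1t_3^{2}t_4^{7}\\ &-2^{18}\cdot 3^{3}\cdot 5^{6}\cdot 128237\cdot 6437531\,Z^{6}t_2t_3^{2}t_4^{7}-2^{28}\cdot 3^{3}\cdot 5^{11}\cdot 6197\,Z^{9}t_3^{3}t_4^{7}-2^{24}\cdot 5^{6}\cdot 3\cdot 443\cdot 8098119613\,Zt_2t_3^{3}t_4^{7}+2^{26}\cdot 5^{6}\cdot 3\cdot 7\cdot 715783571707\,Z^{4}t_3^{4}t_4^{7}\\ &+2^{19}\cdot 3^{2}\cdot 5^{8}\cdot 7541\,Z^{13}t_2t_4^{8}-2^{19}\cdot 3^{3}\cdot 5^{6}\cdot 7^{2}\cdot 17^{2}\cdot 19\cdot 31\cdot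 199\,Z^{3}t_1t_2t_4^{8}+2^{15}\cdot 5^{6}\cdot 3\cdot 23\cdot 29\cdot 219793529\,Z^{5}t_2^{2}t_4^{8}+2^{20}\cdot 3^{3}\cdot 5^{6}\cdot 7\cdot 23\cdot 67\cdot 1297\cdot 3301\,Z^{6}t_1t_3t_4^{8}\\ &-2^{20}\cdot 3^{4}\cdot 5^{9}\cdot 28807\,Z^{8}t_2t_3t_4^{8}+2^{17}\cdot 5^{5}\cdot 3\cdot 7\cdot 2544911109121\,t_2^{2}t_3t_4^{8}+2^{25}\cdot 3^{2}\cdot 5^{9}\cdot 19\cdot 43\cdot 829\,Z^{11}t_3^{2}t_4^{8}+2^{26}\cdot 3^{3}\cdot 5^{7}\cdot 7\cdot 53\cdot 167\cdot 116381\,Zt_1t_3^{2}t_4^{8}\\ &-2^{26}\cdot 3^{2}\cdot 5^{5}\cdot 167\cdot 5651\cdot 157637\,Z^{3}t_2t_3^{2}t_4^{8}+2^{26}\cdot 3^{2}\cdot 5^{5}\cdot 19\cdot 47\cdot 359\cdot 6805069\,Z^{6}t_3^{3}t_4^{8}+2^{32}\cdot 5^{6}\cdot 3\cdot 31\cdot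 1249\cdot 8516173\,Zt_3^{4}t_4^{8}+2^{18}\cdot 3^{3}\cdot 5^{7}\cdot 11\cdot 151\cdot 2281\,Z^{10}t_2t_4^{9}\\ &-2^{18}\cdot 3^{3}\cdot 5^{5}\cdot 7^{2}\cdot 1453\cdot 9140533\,t_1t_2t_4^{9}+2^{16}\cdot 5^{5}\cdot 8861954242873\,Z^{2}t_2^{2}t_4^{9}-2^{23}\cdot 3^{3}\cdot 5^{8}\cdot 73\cdot 7541\,Z^{13}t_3t_4^{9}-2^{25}\cdot 3^{3}\cdot 5^{5}\cdot 7\cdot 4139\cdot 129119\,Z^{3}t_1t_3t_4^{9}\\ &-2^{23}\cdot 5^{5}\cdot 151\cdot 5680110559\,Z^{5}t_2t_3t_4^{9}-2^{26}\cdot 3^{2}\cdot 5^{7}\cdot 40185941\,Z^{8}t_3^{2}t_4^{9}+2^{24}\cdot 5^{4}\cdot 17\cdot 23621998776373\,t_2t_3^{2}t_4^{9}+2^{30}\cdot 5^{4}\cdot 11\cdot 764381\cdot 5742169\,Z^{3}t_3^{3}t_4^{9}\\ &-2^{24}\cdot 3^{14}\cdot 5^{4}\cdot 7\cdot 11\cdot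 863\,Z^{5}t_1t_4^{10}+2^{20}\cdot 5^{3}\cdot 17\cdot 233941\cdot 6976421\,Z^{7}t_2t_4^{10}-2^{25}\cdot 3^{2}\cdot 5^{6}\cdot 7\cdot 1381231\,Z^{10}t_3t_4^{10}-2^{25}\cdot 3^{3}\cdot 5^{5}\cdot 7\cdot 7457\cdot 33020201\,t_1t_3t_4^{10}\\ &-2^{25}\cdot 5^{3}\cdot 58812201936403\,Z^{2}t_2t_3t_4^{10}+2^{29}\cdot 5^{3}\cdot 39878573708081\,Z^{5}t_3^{2}t_4^{10}+2^{32}\cdot 5^{4}\cdot 3909211\cdot 4328957\,t_3^{3}t_4^{10}+2^{22}\cdot 3^{2}\cdot 5^{5}\cdot 7541^{2}\,Z^{12}t_4^{11}\\ &+2^{24}\cdot 3^{13}\cdot 5^{4}\cdot 7^{2}\cdot 5399\,Z^{2}t_1t_4^{11}-2^{28}\cdot 3^{2}\cdot 5^{5}\cdot 7\cdot 53\cdot 7541\,Z^{9}t_4^{12}+2^{22}\cdot 5^{2}\cdot 225349\cdot 1564621501\,Z^{4}t_2t_4^{11}-2^{27}\cdot 5^{2}\cdot 3\cdot 107\cdot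 127\cdot 4920163967\,Z^{7}t_3t_4^{11}\\ &-2^{31}\cdot 5^{3}\cdot 13\cdot 1583\cdot 4421\cdot 158759\,Z^{2}t_3^{2}t_4^{11}-2^{26}\cdot 5\cdot 296367312358063\,Zt_2t_4^{12}-2^{32}\cdot 5\cdot 1383659\cdot 123837583\,Z^{4}t_3t_4^{12}+2^{30}\cdot 7\cdot 249677\cdot 73045429\,Z^{6}t_4^{13}\\ &+2^{33}\cdot 5\cdot 296367312358063\,Zt_3t_4^{13}-2^{32}\cdot 11\cdot 43\cdot 104455205831\,Z^{3}t_4^{14}-2^{50}\cdot 5^{10}\cdot 7\cdot 349\,t_4^{15}. \end{align*} \begin{align*} q_2=\;&2^{2}\cdot 3^{3}\cdot 5^{13}\,t_1^{3}-3^{2}\cdot 5^{10}\cdot 17\,Z^{4}t_1t_2^{2}-5^{8}\cdot 2\cdot 3\cdot 7\,Z^{6}t_2^{3}-2^{5}\cdot 3^{3}\cdot 5^{10}\cdot 11\,Z^{7}t_1t_2t_3\\ &+2^{5}\cdot 3^{3}\cdot 5^{8}\cdot 31\,Zt_2^{3}t_3+2^{8}\cdot 3^{4}\cdot 5^{12}\cdot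 19\,t_1^{2}t_3^{2}-2^{9}\cdot 3^{2}\cdot 5^{10}\cdot 353\,Z^{2}t_1t_2t_3^{2}-2^{6}\cdot 3^{2}\cdot 5^{8}\cdot 367\,Z^{4}t_2^{2}t_3^{2}\\ &+2^{15}\cdot 3^{2}\cdot 5^{10}\cdot 29\,Z^{5}t_1t_3^{3}-2^{11}\cdot 5^{8}\cdot 3\cdot 4327\,Z^{7}t_2t_3^{3}+2^{14}\cdot 3^{3}\cdot 5^{10}\cdot 1319\,t_1t_3^{4}-2^{15}\cdot 5^{8}\cdot 3\cdot 109\cdot 137\,Z^{2}t_2t_3^{4}\\ &-2^{21}\cdot 5^{11}\cdot 3\cdot 11\,Z^{5}t_3^{5}+2^{20}\cdot 3^{2}\cdot 5^{10}\cdot 97\,t_3^{6}-2^{4}\cdot 5^{7}\cdot 5023\,Z^{3}t_2^{3}t_4+2^{4}\cdot 3^{2}\cdot 5^{9}\cdot 11\cdot 13\,Zt_1t_2^{2}t_4\\ &-2^{7}\cdot 3^{3}\cdot 5^{10}\cdot 7^{2}\,Z^{4}t_1t_2t_3t_4+2^{7}\cdot 5^{7}\cdot 3\cdot 4817\,Z^{6}t_2^{2}t_3t_4+2^{15}\cdot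 3^{2}\cdot 5^{9}\cdot 53\,Z^{7}t_1t_3^{2}t_4-2^{10}\cdot 5^{7}\cdot 3\cdot 13\cdot 397\,Zt_2^{2}t_3^{2}t_4\\ &+2^{16}\cdot 3^{2}\cdot 5^{10}\cdot 353\,Z^{2}t_1t_3^{3}t_4-2^{13}\cdot 5^{7}\cdot 19\cdot 41\cdot 317\,Z^{4}t_2t_3^{3}t_4+2^{19}\cdot 5^{8}\cdot 11\cdot 1723\,Z^{7}t_3^{4}t_4+2^{22}\cdot 5^{8}\cdot 3\cdot 109\cdot 137\,Z^{2}t_3^{5}t_4\\ &-2^{5}\cdot 3^{2}\cdot 5^{8}\cdot 547\,Z^{6}t_1t_2t_4^{2}-2^{4}\cdot 3^{2}\cdot 5^{6}\cdot 7\cdot 13\cdot 167\,t_2^{3}t_4^{2}-2^{10}\cdot 3^{2}\cdot 5^{8}\cdot 11\cdot 103\,Zt_1t_2t_3t_4^{2}-2^{9}\cdot 5^{6}\cdot 3\cdot 7\cdot 3907\,Z^{3}t_2^{2}t_3t_4^{2}\\ &+2^{15}\cdot 3^{2}\cdot 5^{8}\cdot 881\,Z^{4}t_1t_3^{2}t_4^{2}+2^{11}\cdot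 3^{2}\cdot 5^{7}\cdot 31883\,Z^{6}t_2t_3^{2}t_4^{2}-2^{16}\cdot 5^{8}\cdot 43\cdot 461\,Zt_2t_3^{3}t_4^{2}+2^{22}\cdot 5^{7}\cdot 127\cdot 1301\,Z^{4}t_3^{4}t_4^{2}\\ &+2^{9}\cdot 3^{2}\cdot 5^{7}\cdot 823\,Z^{3}t_1t_2t_4^{3}-2^{8}\cdot 5^{6}\cdot 3\cdot 7\cdot 37\cdot 53\,Z^{5}t_2^{2}t_4^{3}-2^{13}\cdot 3^{2}\cdot 5^{8}\cdot 7\cdot 53\,Z^{6}t_1t_3t_4^{3}-2^{12}\cdot 5^{6}\cdot 3\cdot 73\cdot 1877\,t_2^{2}t_3t_4^{3}\\ &-2^{17}\cdot 3^{5}\cdot 5^{8}\cdot 11\,Zt_1t_3^{2}t_4^{3}+2^{17}\cdot 3^{2}\cdot 5^{6}\cdot 13\cdot 137\,Z^{3}t_2t_3^{2}t_4^{3}-2^{19}\cdot 3^{4}\cdot 5^{7}\cdot 641\,Z^{6}t_3^{3}t_4^{3}+2^{23}\cdot 5^{7}\cdot 96601\,Zt_3^{4}t_4^{3}\\ &+2^{8}\cdot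 3^{2}\cdot 5^{6}\cdot 7\cdot 13\cdot 67\cdot 79\,t_1t_2t_4^{4}-2^{10}\cdot 5^{5}\cdot 7^{2}\cdot 10343\,Z^{2}t_2^{2}t_4^{4}+2^{14}\cdot 3^{2}\cdot 5^{6}\cdot 19\cdot 443\,Z^{3}t_1t_3t_4^{4}+2^{13}\cdot 5^{5}\cdot 7^{2}\cdot 29\cdot 409\,Z^{5}t_2t_3t_4^{4}\\ &-2^{14}\cdot 5^{5}\cdot 17\cdot 379\cdot 17209\,t_2t_3^{2}t_4^{4}-2^{20}\cdot 5^{5}\cdot 17\cdot 19\cdot 13931\,Z^{3}t_3^{3}t_4^{4}+2^{13}\cdot 3^{7}\cdot 5^{5}\cdot 79\,Z^{5}t_1t_4^{5}-2^{12}\cdot 5^{3}\cdot 13\cdot 59\cdot 5623\,Z^{7}t_2t_4^{5}\\ &+2^{15}\cdot 3^{2}\cdot 5^{6}\cdot 13\cdot 103\cdot 883\,t_1t_3t_4^{5}+2^{15}\cdot 5^{3}\cdot 11\cdot 5478043\,Z^{2}t_2t_3t_4^{5}-2^{19}\cdot 5^{3}\cdot 11\cdot 83\cdot 32839\,Z^{5}t_3^{2}t_4^{5}+2^{21}\cdot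 5^{5}\cdot 5189507\,t_3^{3}t_4^{5}\\ &-2^{14}\cdot 3^{7}\cdot 5^{5}\cdot 59\,Z^{2}t_1t_4^{6}-2^{12}\cdot 5^{2}\cdot 327966773\,Z^{4}t_2t_4^{6}+2^{18}\cdot 5^{2}\cdot 3\cdot 83\cdot 593\cdot 613\,Z^{7}t_3t_4^{6}+2^{20}\cdot 5^{3}\cdot 1249\cdot 3677\,Z^{2}t_3^{2}t_4^{6}\\ &+2^{17}\cdot 5\cdot 139571863\,Zt_2t_4^{7}+2^{19}\cdot 5\cdot 1099915517\,Z^{4}t_3t_4^{7}-2^{18}\cdot 13\cdot 49685821\,Z^{6}t_4^{8}-2^{24}\cdot 5\cdot 139571863\,Zt_3t_4^{8}\\ &+2^{23}\cdot 19\cdot 1661677\,Z^{3}t_4^{9}+2^{35}\cdot 5^{7}\cdot 17\,t_4^{10}. \end{align*} \begin{align*} q_3=\;&3^{3}\cdot 5^{6}\,t_1t_2-2^{2}\cdot 5^{4}\cdot 13\,Z^{2}t_2^{2}+2^{6}\cdot 5^{4}\cdot 23\,Z^{5}t_2t_3+2^{6}\cdot 5^{4}\cdot 587\,t_2t_3^{2}\\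 &+2^{13}\cdot 5^{7}\,Z^{3}t_3^{3}-2^{5}\cdot 5^{3}\,Z^{7}t_2t_4+2^{7}\cdot 3^{3}\cdot 5^{5}\cdot 11\,t_1t_3t_4+2^{9}\cdot 5^{3}\cdot 53\,Z^{2}t_2t_3t_4\\ &+2^{12}\cdot 5^{5}\,Z^{5}t_3^{2}t_4+2^{13}\cdot 5^{4}\cdot 23\cdot 131\,t_3^{3}t_4-2^{4}\cdot 5^{2}\cdot 1523\,Z^{4}t_2t_4^{2}+2^{9}\cdot 5^{3}\cdot 3\cdot 73\,Z^{7}t_3t_4^{2}\\ &-2^{13}\cdot 5^{3}\cdot 29\,Z^{2}t_3^{2}t_4^{2}+2^{8}\cdot 5\cdot 31\cdot 41\,Zt_2t_4^{3}+2^{11}\cdot 5\cdot 7\cdot 491\,Z^{4}t_3t_4^{3}-2^{9}\cdot 7541\,Z^{6}t_4^{4}\\ &-2^{15}\cdot 5\cdot 31\cdot 41\,Zt_3t_4^{4}+2^{14}\cdot 7\cdot 53\,Z^{3}t_4^{5}+2^{21}\cdot 5^{3}\cdot 11\,t_4^{6}. \end{align*} Then, for every such $U$ and $Z$: 1. There is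 a dense open subset $V$ of $U$ such that every point of $V$ has an open neighbourhood $W\subseteq V$ with an injective system $x$ of normalised flat coordinates of $g$ on $W$ for which the relations $(*)$ hold, that is, $y_k(x(t))$ equals the right-hand side at $(t,Z(t))$ for all $t\in W$ and $k=1,\dots,4$. 2. For every connected open $W\subseteq U$ and every system $x$ of normalised flat coordinates of $g$ on $W$ there is a complex orthogonal $4\times4$ matrix $A$ ($A^{T}A=1$) such that the relations $(*)$ hold on $W$ for the flat coordinates $Ax$. -/

import Mathlib

namespace H47

section Frobenius

/-! A (local) Frobenius manifold in flat coordinates `t 0, …, t 3` (usually written `t_1, …, t_4`)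
is given by its prepotential `F` and its Euler vector field `E`; the unity field is the
derivative in the direction of `t 0`. -/

/-- The partial derivative of `f` with respect to the `i`-th coordinate. -/
noncomputable def pd (i : Fin 4) (f : (Fin 4 → ℂ) → ℂ) (t : Fin 4 → ℂ) : ℂ :=
  fderiv ℂ f t (Pi.single i 1)

/-- The tensor `c_{ijk}` of third derivatives of the prepotential. -/
noncomputable def cLower (F : (Fin 4 → ℂ) → ℂ) (i j k : Fin 4) (t : Fin 4 → ℂ) : ℂ :=
  pd i (pd j (pd k F)) t

/-- The metric `η_{ij} = ∂³F / ∂t_i ∂t_j ∂t_1`. -/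
noncomputable def eta (F : (Fin 4 → ℂ) → ℂ) (t : Fin 4 → ℂ) : Matrix (Fin 4) (Fin 4) ℂ :=
  Matrix.of fun i j => cLower F i j 0 t

/-- The tensor `c^{ij}_k = η^{ia} η^{jb} c_{abk}`. -/
noncomputable def cUpper (F : (Fin 4 → ℂ) → ℂ) (i j k : Fin 4) (t : Fin 4 → ℂ) : ℂ :=
  ∑ a, ∑ b, (eta F t)⁻¹ i a * (eta F t)⁻¹ j b * cLower F a b k t

/-- The intersection form `g^{ij} = E^l c^{ij}_l`. -/
noncomputable def intersectionForm (F : (Fin 4 → ℂ) → ℂ) (E : (Fin 4 → ℂ) → Fin 4 → ℂ)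
    (t : Fin 4 → ℂ) : Matrix (Fin 4) (Fin 4) ℂ :=
  Matrix.of fun i j => ∑ l, E t l * cUpper F i j l t

/-- `x = (x_1, …, x_4)` are normalised flat coordinates of the intersection form on `W`: they are
holomorphic, the components of the intersection form in them are `g^{ij}(x) = δ^{ij}`, and
`E(x) = (1 - d)/2 ∑ x_i ∂_{x_i}`. (The Jacobian of `x` is then automatically invertible.) -/
def IsFlatCoords (F : (Fin 4 → ℂ) → ℂ) (E : (Fin 4 → ℂ) → Fin 4 → ℂ) (d : ℂ)
    (W : Set (Fin 4 → ℂ)) (x : (Fin 4 → ℂ) → Fin 4 → ℂ) : Prop :=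
  AnalyticOnNhd ℂ x W ∧
  (∀ t ∈ W, ∀ i j : Fin 4,
    ∑ a, ∑ b, intersectionForm F E t a b * pd a (fun s => x s i) t * pd b (fun s => x s j) t
      = if i = j then 1 else 0) ∧
  (∀ t ∈ W, ∀ i : Fin 4, ∑ l, E t l * pd l (fun s => x s i) t = (1 - d) / 2 * x t i)

end Frobenius

section Example

/-! The Frobenius manifold `H_4(7)`. -/

/-- The polynomial `P(t_2, t_3, t_4, Z)`, of degree `8` in `Z`. -/
noncomputable def P (t2 t3 t4 Z : ℂ) : ℂ :=
  Z^8 + 32 / 5 * t4 * Z^5 + 64 * t3 * Z^3 - 64 / 5 * t4^2 * Z^2 + 128 * t3 * t4 - t2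

/-- The prepotential as a polynomial in `t_1, …, t_4, Z`. -/
noncomputable def prepotential (t1 t2 t3 t4 Z : ℂ) : ℂ :=
  t1 * t2 * t3 + 1 / 2 * t1^2 * t4 - 4096 / 135 * t3 * t4 * (315 * t3^3 + 32 * t4^5)
    + 32768 / 1125 * t4^2 * (75 * t3^3 + 2 * t4^5) * Z^2
    - 32768 / 225 * t3 * (75 * t3^3 + 2 * t4^5) * Z^3
    - 16384 / 5625 * t4 * (375 * t3^3 + 14 * t4^5) * Z^5 + 34816 / 225 * t3 * t4^4 * Z^6
    - 116736 / 175 * t3^2 * t4^2 * Z^7 + 256 / 75 * (220 * t3^3 + 3 * t4^5) * Z^8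
    - 118784 / 945 * t3 * t4^3 * Z^9 + 44544 / 175 * t3^2 * t4 * Z^10
    - 5632 / 1575 * t4^4 * Z^11 + 832 / 225 * t3 * t4^2 * Z^12 + 17664 / 455 * t3^2 * Z^13
    - 352 / 315 * t4^3 * Z^14 + 1568 / 225 * t3 * t4 * Z^15 + 496 / 2975 * t4^2 * Z^17
    + 496 / 945 * t3 * Z^18 + 71 / 1575 * t4 * Z^20 + 16 / 7245 * Z^23

/-- The prepotential as a function of `t` on a domain where the branch `Z` is chosen. -/
noncomputable def F (Z : (Fin 4 → ℂ) → ℂ) (t : Fin 4 → ℂ) : ℂ :=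
  prepotential (t 0) (t 1) (t 2) (t 3) (Z t)

/-- The Euler vector field. -/
noncomputable def E (t : Fin 4 → ℂ) : Fin 4 → ℂ :=
  ![t 0, 4 / 5 * t 1, 1 / 2 * t 2, 3 / 10 * t 3]

/-- The charge. -/
noncomputable def charge : ℂ := 7 / 10

/-- `Z` is a holomorphic branch, on the open set `U`, of the algebraic function given by
`P(t, Z) = 0`. -/
def IsBranch (U : Set (Fin 4 → ℂ)) (Z : (Fin 4 → ℂ) → ℂ) : Prop :=
  IsOpen U ∧ AnalyticOnNhd ℂ Z U ∧ ∀ t ∈ U, P (t 1) (t 2) (t 3) (Z t) = 0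

end Example

section Invariants

/-! The basic invariants of the Coxeter group `H_4`, of degrees `30, 20, 12, 2`. -/

noncomputable def eps1 (x2 x3 x4 : ℂ) : ℂ := x2^2 + x3^2 + x4^2

noncomputable def eps2 (x2 x3 x4 : ℂ) : ℂ := x2^2 * x3^2 + x2^2 * x4^2 + x3^2 * x4^2

noncomputable def eps3 (x2 x3 x4 : ℂ) : ℂ := x2^2 * x3^2 * x4^2

noncomputable def delta (x2 x3 x4 : ℂ) : ℂ :=
  (x2^2 - x3^2) * (x2^2 - x4^2) * (x3^2 - x4^2)

noncomputable def sqrtFive : ℂ := ((Real.sqrt 5 : ℝ) : ℂ)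

noncomputable def h2 (x2 x3 x4 : ℂ) : ℂ := eps1 x2 x3 x4

noncomputable def h6 (x2 x3 x4 : ℂ) : ℂ :=
  sqrtFive * delta x2 x3 x4 + eps1 x2 x3 x4 * eps2 x2 x3 x4 - 11 * eps3 x2 x3 x4

noncomputable def h10 (x2 x3 x4 : ℂ) : ℂ :=
  95 * eps2 x2 x3 x4 * eps3 x2 x3 x4 - 32 * eps1 x2 x3 x4 ^ 2 * eps3 x2 x3 x4
    - 5 * eps1 x2 x3 x4 * eps2 x2 x3 x4 ^ 2 + 2 * eps1 x2 x3 x4 ^ 3 * eps2 x2 x3 x4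
    + 3 * sqrtFive * delta x2 x3 x4 * eps2 x2 x3 x4

/-- `y_1` in terms of `x_1` and `h_2, h_6, h_10`. -/
noncomputable def invPoly1 (x1 h2 h6 h10 : ℂ) : ℂ :=
  32 / 3 * x1^24 * h2^3 - 40 * x1^22 * (2 * h2^4 + 3 * h2 * h6)
    + x1^20 * (360 * h10 + 1344 / 5 * h2^5 + 672 * h2^2 * h6)
    + x1^18 * (1080 * h6^2 - 1608 * h2^3 * h6 - 1328 / 3 * h2^6 - 2880 * h10 * h2)
    + x1^16 * (10024 * h10 * h2^2 + 272 * h2^7 + 1248 * h2^4 * h6 - 5628 * h2 * h6^2)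
    + x1^14 * (18588 * h2^2 * h6^2 + 272 * h2^8 - 7620 * h10 * h6 - 16856 * h10 * h2^3)
    + x1^12 * (14216 * h10 * h2^4 + 23508 * h10 * h6 * h2 - 1328 / 3 * h2^9
        - 1248 * h6 * h2^6 - 27396 * h6^2 * h2^3 - 5796 * h6^3)
    + x1^10 * (3240 * h10^2 - 7160 * h10 * h2^5 - 25332 * h10 * h6 * h2^2 + 1344 / 5 * h2^10
        + 1608 * h2^7 * h6 + 19968 * h2^4 * h6^2 + 7350 * h2 * h6^3)
    + x1^8 * (2144 * h10 * h2^6 - 3232 * h10^2 * h2 + 10908 * h10 * h2^3 * h6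
        - 906 * h10 * h6^2 - 80 * h2^11 - 672 * h2^8 * h6 - 6924 * h2^5 * h6^2
        - 1956 * h2^2 * h6^3)
    + x1^6 * (1168 * h10^2 * h2^2 - 344 * h10 * h2^7 - 2172 * h10 * h2^4 * h6
        - 1908 * h10 * h2 * h6^2 + 32 / 3 * h2^12 + 120 * h2^9 * h6 + 1332 * h2^6 * h6^2
        + 288 * h2^3 * h6^3 + 2394 * h6^4)
    + x1^4 * (348 * h10^2 * h6 - 152 * h10^2 * h2^3 + 16 * h10 * h2^8 + 60 * h10 * h6 * h2^5
        + 408 * h10 * h6^2 * h2^2 - 84 * h2^7 * h6^2 + 84 * h2^4 * h6^3 - 909 * h2 * h6^4)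
    + x1^2 * (8 * h10^2 * h2^4 - 42 * h10 * h6^2 * h2^3 - 87 * h10 * h6^3 - 6 * h2^5 * h6^3
        + 135 * h2^2 * h6^4)
    + 4 / 3 * h10^3 - 3 * h10 * h2 * h6^3 + 9 / 5 * h6^5

/-- `y_2` in terms of `x_1` and `h_2, h_6, h_10`. -/
noncomputable def invPoly2 (x1 h2 h6 h10 : ℂ) : ℂ :=
  4 * x1^16 * h2^2 - 10 * x1^14 * (2 * h2^3 + 3 * h6) + x1^12 * (44 * h2^4 + 138 * h2 * h6)
    + x1^10 * (180 * h10 - 44 * h2^5 - 402 * h2^2 * h6)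
    + x1^8 * (44 * h2^6 - 464 * h10 * h2 + 402 * h2^3 * h6 + 294 * h6^2)
    + x1^6 * (296 * h10 * h2^2 - 20 * h2^7 - 138 * h2^4 * h6 - 306 * h2 * h6^2)
    + x1^4 * (4 * h2^8 - 76 * h10 * h2^3 - 114 * h10 * h6 + 30 * h2^5 * h6 + 168 * h2^2 * h6^2)
    + x1^2 * (4 * h10 * h2^4 - 21 * h2^3 * h6^2 + 57 / 2 * h6^3)
    + h10^2 - 3 / 2 * h2 * h6^3

/-- `y_3` in terms of `x_1` and `h_2, h_6, h_10`. -/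
noncomputable def invPoly3 (x1 h2 h6 h10 : ℂ) : ℂ :=
  -2 * x1^10 * h2 + 6 * x1^8 * h2^2 + x1^6 * (33 * h6 - 14 * h2^3)
    - x1^4 * (33 * h2 * h6 - 6 * h2^4) + x1^2 * (11 * h10 - 2 * h2^5) - h10 * h2 + 3 / 2 * h6^2

/-- The basic invariants `y_1, y_2, y_3, y_4` of `H_4` (`x i` is `x_{i+1}`). -/
noncomputable def basicInvariant (x : Fin 4 → ℂ) : Fin 4 → ℂ :=
  ![invPoly1 (x 0) (h2 (x 1) (x 2) (x 3)) (h6 (x 1) (x 2) (x 3)) (h10 (x 1) (x 2) (x 3)),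
    invPoly2 (x 0) (h2 (x 1) (x 2) (x 3)) (h6 (x 1) (x 2) (x 3)) (h10 (x 1) (x 2) (x 3)),
    invPoly3 (x 0) (h2 (x 1) (x 2) (x 3)) (h6 (x 1) (x 2) (x 3)) (h10 (x 1) (x 2) (x 3)),
    x 0 ^ 2 + h2 (x 1) (x 2) (x 3)]

end Invariants

section Relations

/-! The right-hand sides of the relations for `y_1, y_2, y_3` are a rational constant times a
polynomial with integer coefficients, which is written as a sum of parts of a few terms each. -/

noncomputable def relY1p1 (t1 t2 t3 Z : ℂ) : ℂ :=
  2^3 * 3^4 * 5^18 * 7 * Z^7 * t1^3 * t2 - 2^3 * 3^7 * 5^15 * 7 * Z * t1^2 * t2^3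
    + 3^3 * 5^14 * 7 * 11 * 31 * Z^3 * t1 * t2^4 - 5^13 * 7 * 1831 * Z^5 * t2^5
    - 2^4 * 3^6 * 5^20 * 7 * t1^4 * t3 + 2^4 * 3^4 * 5^18 * 7^3 * Z^2 * t1^3 * t2 * t3
    + 3^5 * 5^15 * 2 * 7 * 967 * Z^4 * t1^2 * t2^2 * t3
    - 3^4 * 5^14 * 2 * 7 * 2383 * Z^6 * t1 * t2^3 * t3

noncomputable def relY1p2 (t1 t2 t3 Z : ℂ) : ℂ :=
  2^2 * 5^13 * 7 * 19121 * t2^5 * t3 - 2^8 * 3^4 * 5^18 * 7^2 * Z^5 * t1^3 * t3^2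
    - 2^6 * 3^6 * 5^15 * 7 * 283 * Z^7 * t1^2 * t2 * t3^2
    + 2^5 * 3^4 * 5^16 * 7 * 11 * 17 * Z * t1 * t2^3 * t3^2
    - 2^6 * 5^13 * 3 * 7 * 31547 * Z^3 * t2^4 * t3^2 - 2^12 * 3^5 * 5^18 * 7 * 61 * t1^3 * t3^3
    - 2^12 * 3^5 * 5^15 * 7 * 257 * Z^2 * t1^2 * t2 * t3^3
    - 2^8 * 3^3 * 5^14 * 7 * 47 * 421 * Z^4 * t1 * t2^2 * t3^3

noncomputable def relY1p3 (t1 t2 t3 Z : ℂ) : ℂ :=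
  -2^7 * 5^13 * 7 * 131 * 2647 * Z^6 * t2^3 * t3^3
    - 2^14 * 3^5 * 5^15 * 7 * 1153 * Z^5 * t1^2 * t3^4
    - 2^21 * 3^3 * 5^14 * 7 * 239 * Z^7 * t1 * t2 * t3^4
    + 2^11 * 5^13 * 3 * 7 * 181 * 6269 * Z * t2^3 * t3^4
    - 2^17 * 3^6 * 5^15 * 7 * 13 * 1291 * t1^2 * t3^5
    + 2^16 * 3^5 * 5^14 * 7 * 16447 * Z^2 * t1 * t2 * t3^5
    - 2^13 * 5^14 * 3 * 7 * 3183137 * Z^4 * t2^2 * t3^5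
    - 2^20 * 3^5 * 5^15 * 7 * 17 * 643 * Z^5 * t1 * t3^6

noncomputable def relY1p4 (t1 t2 t3 t4 Z : ℂ) : ℂ :=
  2^18 * 5^14 * 7 * 1747 * 1789 * Z^7 * t2 * t3^6 - 2^24 * 3^5 * 5^15 * 7 * 34649 * t1 * t3^7
    + 2^23 * 5^14 * 7 * 2511151 * Z^2 * t2 * t3^7 - 2^26 * 5^15 * 7^2 * 112687 * Z^5 * t3^8
    - 2^28 * 3^3 * 5^15 * 7 * 530807 * t3^9 + 3^5 * 5^17 * 7^3 * 2 * Z^4 * t1^3 * t2 * t4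
    + 2^2 * 3^7 * 5^14 * 7 * 67 * Z^6 * t1^2 * t2^2 * t4 - 3^4 * 5^13 * 7 * 41 * t1 * t2^4 * t4

noncomputable def relY1p5 (t1 t2 t3 t4 Z : ℂ) : ℂ :=
  -5^13 * 2 * 7 * 4871 * Z^2 * t2^5 * t4 - 2^6 * 3^4 * 5^17 * 7^2 * 13 * Z^7 * t1^3 * t3 * t4
    + 2^5 * 3^5 * 5^14 * 7 * 23 * 199 * Z * t1^2 * t2^2 * t3 * t4
    - 2^4 * 3^3 * 5^14 * 7 * 1091 * Z^3 * t1 * t2^3 * t3 * t4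
    - 2^5 * 5^13 * 7 * 11 * 3119 * Z^5 * t2^4 * t3 * t4
    - 2^11 * 3^4 * 5^18 * 7^3 * Z^2 * t1^3 * t3^2 * t4
    + 2^7 * 3^6 * 5^14 * 7 * 10169 * Z^4 * t1^2 * t2 * t3^2 * t4
    - 2^7 * 3^4 * 5^13 * 7 * 53 * 401 * Z^6 * t1 * t2^2 * t3^2 * t4

noncomputable def relY1p6 (t1 t2 t3 t4 Z : ℂ) : ℂ :=
  2^6 * 5^12 * 7 * 4272533 * t2^4 * t3^2 * t4
    - 2^12 * 3^5 * 5^14 * 7 * 37 * 367 * Z^7 * t1^2 * t3^3 * t4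
    - 2^12 * 3^3 * 5^13 * 7 * 127 * 251 * Z * t1 * t2^2 * t3^3 * t4
    - 2^10 * 5^12 * 7^2 * 3 * 19 * 48157 * Z^3 * t2^3 * t3^3 * t4
    + 2^19 * 3^5 * 5^15 * 7 * 257 * Z^2 * t1^2 * t3^4 * t4
    - 2^13 * 3^3 * 5^13 * 7 * 1883993 * Z^4 * t1 * t2 * t3^4 * t4
    + 2^13 * 5^13 * 7^2 * 3 * 397 * 557 * Z^6 * t2^2 * t3^4 * t4
    - 2^18 * 3^3 * 5^14 * 7 * 67 * 293 * Z^7 * t1 * t3^5 * t4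

noncomputable def relY1p7 (t1 t2 t3 t4 Z : ℂ) : ℂ :=
  -2^17 * 5^13 * 13^2 * 3 * 7 * 22063 * Z * t2^2 * t3^5 * t4
    - 2^23 * 3^5 * 5^14 * 7 * 16447 * Z^2 * t1 * t3^6 * t4
    + 2^19 * 5^13 * 73^2 * 7 * 12347 * Z^4 * t2 * t3^6 * t4
    - 2^24 * 5^14 * 7^2 * 3 * 31 * 6673 * Z^7 * t3^7 * t4
    - 2^30 * 5^14 * 7 * 2511151 * Z^2 * t3^8 * t4 - 2^5 * 3^7 * 5^16 * 7^2 * Z * t1^3 * t2 * t4^2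
    + 2^5 * 3^7 * 5^13 * 7 * 367 * Z^3 * t1^2 * t2^2 * t4^2
    + 2^5 * 3^4 * 5^13 * 7 * 2099 * Z^5 * t1 * t2^3 * t4^2

noncomputable def relY1p8 (t1 t2 t3 t4 Z : ℂ) : ℂ :=
  -2^4 * 5^12 * 7 * 11 * 3517 * Z^7 * t2^4 * t4^2
    - 2^7 * 3^4 * 5^16 * 7^2 * 173 * Z^4 * t1^3 * t3 * t4^2
    - 2^6 * 3^5 * 5^13 * 7 * 19 * 29 * 59 * Z^6 * t1^2 * t2 * t3 * t4^2
    + 2^5 * 3^4 * 5^12 * 7 * 407717 * t1 * t2^3 * t3 * t4^2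
    - 2^5 * 3^3 * 5^13 * 7 * 149 * 271 * Z^2 * t2^4 * t3 * t4^2
    - 2^11 * 3^5 * 5^13 * 7 * 19 * 3119 * Z * t1^2 * t2 * t3^2 * t4^2
    + 2^9 * 3^4 * 5^12 * 7 * 61 * 48311 * Z^3 * t1 * t2^2 * t3^2 * t4^2
    + 2^9 * 5^13 * 7 * 11 * 19 * 479 * Z^5 * t2^3 * t3^2 * t4^2

noncomputable def relY1p9 (t1 t2 t3 t4 Z : ℂ) : ℂ :=
  -2^13 * 3^5 * 5^13 * 7 * 311 * 439 * Z^4 * t1^2 * t3^3 * t4^2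
    - 2^14 * 3^4 * 5^13 * 7 * 61 * 4663 * Z^6 * t1 * t2 * t3^3 * t4^2
    + 2^11 * 5^12 * 7 * 13 * 3501503 * t2^3 * t3^3 * t4^2
    + 2^17 * 3^4 * 5^13 * 7 * 14029 * Z * t1 * t2 * t3^4 * t4^2
    - 2^15 * 5^12 * 3 * 7 * 11 * 13 * 104297 * Z^3 * t2^2 * t3^4 * t4^2
    - 2^19 * 3^3 * 5^13 * 7 * 4814471 * Z^4 * t1 * t3^5 * t4^2
    - 2^18 * 3^2 * 5^13 * 7 * 3231829 * Z^6 * t2 * t3^5 * t4^2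
    + 2^23 * 5^13 * 3 * 7 * 47 * 263303 * Z * t2 * t3^6 * t4^2

noncomputable def relY1p10 (t1 t2 t3 t4 Z : ℂ) : ℂ :=
  -2^25 * 3^2 * 5^13 * 7 * 1951 * 29207 * Z^4 * t3^7 * t4^2
    + 2^6 * 3^4 * 5^15 * 7^2 * 17 * Z^6 * t1^3 * t4^3
    - 2^4 * 3^7 * 5^12 * 7 * 11 * 79 * t1^2 * t2^2 * t4^3
    + 2^4 * 3^3 * 5^12 * 7 * 89 * 6449 * Z^2 * t1 * t2^3 * t4^3
    + 2^4 * 5^11 * 3 * 7 * 211 * 6449 * Z^4 * t2^4 * t4^3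
    + 2^12 * 3^7 * 5^16 * 7^2 * Z * t1^3 * t3 * t4^3
    - 2^10 * 3^5 * 5^12 * 7 * 208253 * Z^3 * t1^2 * t2 * t3 * t4^3
    - 2^15 * 3^3 * 5^12 * 7 * 1429 * Z^5 * t1 * t2^2 * t3 * t4^3

noncomputable def relY1p11 (t1 t2 t3 t4 Z : ℂ) : ℂ :=
  -2^8 * 5^11 * 7 * 31 * 181 * 3659 * Z^7 * t2^3 * t3 * t4^3
    + 2^12 * 3^5 * 5^14 * 7 * 13 * 37 * 59 * Z^6 * t1^2 * t3^2 * t4^3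
    + 2^16 * 3^2 * 5^13 * 23^2 * Z^10 * t2^2 * t3^2 * t4^3
    + 2^12 * 3^3 * 5^12 * 7^2 * 1178167 * t1 * t2^2 * t3^2 * t4^3
    - 2^10 * 5^11 * 2107634939 * Z^2 * t2^3 * t3^2 * t4^3
    + 2^18 * 3^8 * 5^13 * 7 * 1033 * Z * t1^2 * t3^3 * t4^3
    - 2^17 * 3^3 * 5^12 * 7 * 13 * 23 * 4099 * Z^3 * t1 * t2 * t3^3 * t4^3
    + 2^18 * 5^11 * 107 * 330509 * Z^5 * t2^2 * t3^3 * t4^3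

noncomputable def relY1p12 (t1 t2 t3 t4 Z : ℂ) : ℂ :=
  -2^18 * 3^4 * 5^13 * 7 * 377563 * Z^6 * t1 * t3^4 * t4^3
    + 2^24 * 3^2 * 5^16 * 23 * Z^8 * t2 * t3^4 * t4^3
    + 2^16 * 5^13 * 491035057 * t2^2 * t3^4 * t4^3
    - 2^24 * 3^3 * 5^13 * 7 * 373 * 523 * Z * t1 * t3^5 * t4^3
    - 2^22 * 5^12 * 3 * 658847099 * Z^3 * t2 * t3^5 * t4^3
    + 2^24 * 5^12 * 7 * 25229 * 55439 * Z^6 * t3^6 * t4^3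
    - 2^30 * 5^13 * 3 * 7 * 23 * 71 * 5791 * Z * t3^7 * t4^3
    - 2^12 * 3^4 * 5^15 * 7^2 * Z^3 * t1^3 * t4^4

noncomputable def relY1p13 (t1 t2 t3 t4 Z : ℂ) : ℂ :=
  2^9 * 3^12 * 5^12 * 7 * Z^5 * t1^2 * t2 * t4^4
    + 2^7 * 3^3 * 5^11 * 7 * 13 * 17 * 5981 * Z^7 * t1 * t2^2 * t4^4
    + 2^12 * 3^2 * 5^12 * 13 * Z^9 * t2^3 * t4^4 + 2^8 * 5^10 * 1553 * 74317 * Z * t2^4 * t4^4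
    - 2^10 * 3^5 * 5^12 * 7 * 23 * 97849 * t1^2 * t2 * t3 * t4^4
    - 2^16 * 3^2 * 5^12 * 23 * Z^12 * t2^2 * t3 * t4^4
    + 2^9 * 3^4 * 5^11 * 7^2 * 644789 * Z^2 * t1 * t2^2 * t3 * t4^4
    - 2^10 * 5^10 * 684923563 * Z^4 * t2^3 * t3 * t4^4

noncomputable def relY1p14 (t1 t2 t3 t4 Z : ℂ) : ℂ :=
  2^16 * 3^5 * 5^13 * 7 * 11 * 23 * 157 * Z^3 * t1^2 * t3^2 * t4^4
    + 2^14 * 3^5 * 5^11 * 7 * 239 * 1361 * Z^5 * t1 * t2 * t3^2 * t4^4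
    - 2^15 * 5^10 * 3 * 7 * 105745993 * Z^7 * t2^2 * t3^2 * t4^4
    + 2^24 * 3^4 * 5^14 * Z^10 * t2 * t3^3 * t4^4
    + 2^17 * 3^5 * 5^13 * 7^2 * 144073 * t1 * t2 * t3^3 * t4^4
    - 2^15 * 5^10 * 31 * 2275515659 * Z^2 * t2^2 * t3^3 * t4^4
    - 2^25 * 3^3 * 5^12 * 7^2 * 19 * 1987 * Z^3 * t1 * t3^4 * t4^4
    - 2^20 * 5^10 * 7 * 17 * 683 * 247601 * Z^5 * t2 * t3^4 * t4^4

noncomputable def relY1p15 (t1 t2 t3 t4 Z : ℂ) : ℂ :=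
  2^30 * 3^2 * 5^17 * Z^8 * t3^5 * t4^4 - 2^22 * 5^11 * 56634970591 * t2 * t3^5 * t4^4
    + 2^28 * 3^2 * 5^11 * 59 * 56802241 * Z^3 * t3^6 * t4^4
    - 2^16 * 3^4 * 5^15 * 7 * 97 * t1^3 * t4^5
    + 2^10 * 3^12 * 5^10 * 7 * 103 * Z^2 * t1^2 * t2 * t4^5
    + 2^14 * 3^2 * 5^11 * Z^14 * t2^2 * t4^5
    + 2^8 * 3^3 * 5^9 * 7 * 17 * 6436589 * Z^4 * t1 * t2^2 * t4^5
    + 2^8 * 5^8 * 3 * 83 * 113 * 283487 * Z^6 * t2^3 * t4^5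

noncomputable def relY1p16 (t1 t2 t3 t4 Z : ℂ) : ℂ :=
  -2^15 * 3^10 * 5^10 * 7^2 * 367 * Z^5 * t1^2 * t3 * t4^5
    + 2^12 * 3^3 * 5^10 * 7 * 47 * 409 * 1801 * Z^7 * t1 * t2 * t3 * t4^5
    - 2^15 * 3^3 * 5^11 * 89 * 241 * Z^9 * t2^2 * t3 * t4^5
    + 2^15 * 5^8 * 19^2 * 379 * 72043 * Z * t2^3 * t3 * t4^5
    - 2^17 * 3^5 * 5^12 * 7 * 67 * 151 * 443 * t1^2 * t3^2 * t4^5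
    + 2^20 * 3^2 * 5^12 * 29 * 173 * Z^12 * t2 * t3^2 * t4^5
    + 2^17 * 3^3 * 5^9 * 7 * 242346031 * Z^2 * t1 * t2 * t3^2 * t4^5
    - 2^14 * 5^8 * 3 * 17 * 29 * 307 * 2364179 * Z^4 * t2^2 * t3^2 * t4^5

noncomputable def relY1p17 (t1 t2 t3 t4 Z : ℂ) : ℂ :=
  2^21 * 3^3 * 5^9 * 7 * 151247651 * Z^5 * t1 * t3^3 * t4^5
    + 2^18 * 5^9 * 21157 * 4697569 * Z^7 * t2 * t3^3 * t4^5
    + 2^27 * 3^2 * 5^15 * 13 * 17 * Z^10 * t3^4 * t4^5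
    + 2^24 * 3^3 * 5^13 * 7 * 2004073 * t1 * t3^4 * t4^5
    - 2^22 * 5^8 * 3 * 883 * 159406111 * Z^2 * t2 * t3^4 * t4^5
    - 2^29 * 5^8 * 3343 * 11789651 * Z^5 * t3^5 * t4^5 - 2^29 * 5^11 * 85909378939 * t3^6 * t4^5
    + 2^14 * 3^14 * 5^9 * 7 * Z^7 * t1^2 * t4^6

noncomputable def relY1p18 (t1 t2 t3 t4 Z : ℂ) : ℂ :=
  2^14 * 3^2 * 5^10 * 1523 * Z^11 * t2^2 * t4^6
    - 2^11 * 3^3 * 5^8 * 7 * 13 * 73 * 627131 * Z * t1 * t2^2 * t4^6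
    + 2^11 * 5^7 * 6691 * 10945717 * Z^3 * t2^3 * t4^6
    - 2^16 * 3^10 * 5^10 * 7 * 739 * Z^2 * t1^2 * t3 * t4^6
    - 2^19 * 3^3 * 5^11 * 73 * Z^14 * t2 * t3 * t4^6
    + 2^13 * 3^3 * 5^8 * 7 * 6560672719 * Z^4 * t1 * t2 * t3 * t4^6
    - 2^13 * 5^8 * 3 * 19 * 107 * 271 * 4603 * Z^6 * t2^2 * t3 * t4^6
    - 2^21 * 3^4 * 5^8 * 7 * 195868609 * Z^7 * t1 * t3^2 * t4^6

noncomputable def relY1p19 (t1 t2 t3 t4 Z : ℂ) : ℂ :=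
  2^21 * 3^2 * 5^10 * 173 * 2039 * Z^9 * t2 * t3^2 * t4^6
    - 2^17 * 5^7 * 3 * 175949 * 534167 * Z * t2^2 * t3^2 * t4^6
    + 2^26 * 3^3 * 5^13 * 73 * Z^12 * t3^3 * t4^6
    - 2^25 * 3^3 * 5^9 * 7 * 307854203 * Z^2 * t1 * t3^3 * t4^6
    + 2^19 * 5^7 * 17 * 1171 * 755025827 * Z^4 * t2 * t3^3 * t4^6
    + 2^26 * 5^7 * 3 * 11 * 29 * 1522702439 * Z^7 * t3^4 * t4^6
    + 2^28 * 5^8 * 17 * 23 * 99971 * 187073 * Z^2 * t3^5 * t4^6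
    + 2^17 * 3^14 * 5^9 * 7 * Z^4 * t1^2 * t4^7

noncomputable def relY1p20 (t1 t2 t3 t4 Z : ℂ) : ℂ :=
  2^12 * 3^3 * 5^7 * 7 * 17 * 61 * 545533 * Z^6 * t1 * t2 * t4^7
    + 2^12 * 3^2 * 5^9 * 1747 * 2179 * Z^8 * t2^2 * t4^7
    + 2^12 * 5^6 * 3 * 7 * 25411781761 * t2^3 * t4^7
    - 2^18 * 3^2 * 5^9 * 7 * 31 * 101 * 109 * Z^11 * t2 * t3 * t4^7
    + 2^18 * 3^4 * 5^7 * 7 * 3491 * 87421 * Z * t1 * t2 * t3 * t4^7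
    + 2^16 * 5^6 * 3 * 11 * 41 * 625672687 * Z^3 * t2^2 * t3 * t4^7
    + 2^22 * 3^4 * 5^11 * 73^2 * Z^14 * t3^2 * t4^7
    - 2^20 * 3^3 * 5^7 * 7^2 * 13^2 * 607 * 45503 * Z^4 * t1 * t3^2 * t4^7

noncomputable def relY1p21 (t1 t2 t3 t4 Z : ℂ) : ℂ :=
  -2^18 * 3^3 * 5^6 * 128237 * 6437531 * Z^6 * t2 * t3^2 * t4^7
    - 2^28 * 3^3 * 5^11 * 6197 * Z^9 * t3^3 * t4^7
    - 2^24 * 5^6 * 3 * 443 * 8098119613 * Z * t2 * t3^3 * t4^7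
    + 2^26 * 5^6 * 3 * 7 * 715783571707 * Z^4 * t3^4 * t4^7
    + 2^19 * 3^2 * 5^8 * 7541 * Z^13 * t2 * t4^8
    - 2^19 * 3^3 * 5^6 * 7^2 * 17^2 * 19 * 31 * 199 * Z^3 * t1 * t2 * t4^8
    + 2^15 * 5^6 * 3 * 23 * 29 * 219793529 * Z^5 * t2^2 * t4^8
    + 2^20 * 3^3 * 5^6 * 7 * 23 * 67 * 1297 * 3301 * Z^6 * t1 * t3 * t4^8

noncomputable def relY1p22 (t1 t2 t3 t4 Z : ℂ) : ℂ :=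
  -2^20 * 3^4 * 5^9 * 28807 * Z^8 * t2 * t3 * t4^8
    + 2^17 * 5^5 * 3 * 7 * 2544911109121 * t2^2 * t3 * t4^8
    + 2^25 * 3^2 * 5^9 * 19 * 43 * 829 * Z^11 * t3^2 * t4^8
    + 2^26 * 3^3 * 5^7 * 7 * 53 * 167 * 116381 * Z * t1 * t3^2 * t4^8
    - 2^26 * 3^2 * 5^5 * 167 * 5651 * 157637 * Z^3 * t2 * t3^2 * t4^8
    + 2^26 * 3^2 * 5^5 * 19 * 47 * 359 * 6805069 * Z^6 * t3^3 * t4^8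
    + 2^32 * 5^6 * 3 * 31 * 1249 * 8516173 * Z * t3^4 * t4^8
    + 2^18 * 3^3 * 5^7 * 11 * 151 * 2281 * Z^10 * t2 * t4^9

noncomputable def relY1p23 (t1 t2 t3 t4 Z : ℂ) : ℂ :=
  -2^18 * 3^3 * 5^5 * 7^2 * 1453 * 9140533 * t1 * t2 * t4^9
    + 2^16 * 5^5 * 8861954242873 * Z^2 * t2^2 * t4^9
    - 2^23 * 3^3 * 5^8 * 73 * 7541 * Z^13 * t3 * t4^9
    - 2^25 * 3^3 * 5^5 * 7 * 4139 * 129119 * Z^3 * t1 * t3 * t4^9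
    - 2^23 * 5^5 * 151 * 5680110559 * Z^5 * t2 * t3 * t4^9
    - 2^26 * 3^2 * 5^7 * 40185941 * Z^8 * t3^2 * t4^9
    + 2^24 * 5^4 * 17 * 23621998776373 * t2 * t3^2 * t4^9
    + 2^30 * 5^4 * 11 * 764381 * 5742169 * Z^3 * t3^3 * t4^9

noncomputable def relY1p24 (t1 t2 t3 t4 Z : ℂ) : ℂ :=
  -2^24 * 3^14 * 5^4 * 7 * 11 * 863 * Z^5 * t1 * t4^10
    + 2^20 * 5^3 * 17 * 233941 * 6976421 * Z^7 * t2 * t4^10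
    - 2^25 * 3^2 * 5^6 * 7 * 1381231 * Z^10 * t3 * t4^10
    - 2^25 * 3^3 * 5^5 * 7 * 7457 * 33020201 * t1 * t3 * t4^10
    - 2^25 * 5^3 * 58812201936403 * Z^2 * t2 * t3 * t4^10
    + 2^29 * 5^3 * 39878573708081 * Z^5 * t3^2 * t4^10
    + 2^32 * 5^4 * 3909211 * 4328957 * t3^3 * t4^10 + 2^22 * 3^2 * 5^5 * 7541^2 * Z^12 * t4^11

noncomputable def relY1p25 (t1 t2 t3 t4 Z : ℂ) : ℂ :=
  2^24 * 3^13 * 5^4 * 7^2 * 5399 * Z^2 * t1 * t4^11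
    - 2^28 * 3^2 * 5^5 * 7 * 53 * 7541 * Z^9 * t4^12
    + 2^22 * 5^2 * 225349 * 1564621501 * Z^4 * t2 * t4^11
    - 2^27 * 5^2 * 3 * 107 * 127 * 4920163967 * Z^7 * t3 * t4^11
    - 2^31 * 5^3 * 13 * 1583 * 4421 * 158759 * Z^2 * t3^2 * t4^11
    - 2^26 * 5 * 296367312358063 * Z * t2 * t4^12
    - 2^32 * 5 * 1383659 * 123837583 * Z^4 * t3 * t4^12
    + 2^30 * 7 * 249677 * 73045429 * Z^6 * t4^13

noncomputable def relY1p26 (t3 t4 Z : ℂ) : ℂ :=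
  2^33 * 5 * 296367312358063 * Z * t3 * t4^13 - 2^32 * 11 * 43 * 104455205831 * Z^3 * t4^14
    - 2^50 * 5^10 * 7 * 349 * t4^15

/-- The right-hand side of the relation for `y_1`. -/
noncomputable def relY1 (t1 t2 t3 t4 Z : ℂ) : ℂ :=
  -(5^4 / (3^28 * 7)) * (
    relY1p1 t1 t2 t3 Z + relY1p2 t1 t2 t3 Z + relY1p3 t1 t2 t3 Z + relY1p4 t1 t2 t3 t4 Z
      + relY1p5 t1 t2 t3 t4 Z + relY1p6 t1 t2 t3 t4 Z + relY1p7 t1 t2 t3 t4 Z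
      + relY1p8 t1 t2 t3 t4 Z + relY1p9 t1 t2 t3 t4 Z + relY1p10 t1 t2 t3 t4 Z
      + relY1p11 t1 t2 t3 t4 Z + relY1p12 t1 t2 t3 t4 Z + relY1p13 t1 t2 t3 t4 Z
      + relY1p14 t1 t2 t3 t4 Z + relY1p15 t1 t2 t3 t4 Z + relY1p16 t1 t2 t3 t4 Z
      + relY1p17 t1 t2 t3 t4 Z + relY1p18 t1 t2 t3 t4 Z + relY1p19 t1 t2 t3 t4 Z
      + relY1p20 t1 t2 t3 t4 Z + relY1p21 t1 t2 t3 t4 Z + relY1p22 t1 t2 t3 t4 Z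
      + relY1p23 t1 t2 t3 t4 Z + relY1p24 t1 t2 t3 t4 Z + relY1p25 t1 t2 t3 t4 Z
      + relY1p26 t3 t4 Z)

noncomputable def relY2p1 (t1 t2 t3 Z : ℂ) : ℂ :=
  2^2 * 3^3 * 5^13 * t1^3 - 3^2 * 5^10 * 17 * Z^4 * t1 * t2^2 - 5^8 * 2 * 3 * 7 * Z^6 * t2^3
    - 2^5 * 3^3 * 5^10 * 11 * Z^7 * t1 * t2 * t3 + 2^5 * 3^3 * 5^8 * 31 * Z * t2^3 * t3
    + 2^8 * 3^4 * 5^12 * 19 * t1^2 * t3^2 - 2^9 * 3^2 * 5^10 * 353 * Z^2 * t1 * t2 * t3^2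
    - 2^6 * 3^2 * 5^8 * 367 * Z^4 * t2^2 * t3^2

noncomputable def relY2p2 (t1 t2 t3 t4 Z : ℂ) : ℂ :=
  2^15 * 3^2 * 5^10 * 29 * Z^5 * t1 * t3^3 - 2^11 * 5^8 * 3 * 4327 * Z^7 * t2 * t3^3
    + 2^14 * 3^3 * 5^10 * 1319 * t1 * t3^4 - 2^15 * 5^8 * 3 * 109 * 137 * Z^2 * t2 * t3^4
    - 2^21 * 5^11 * 3 * 11 * Z^5 * t3^5 + 2^20 * 3^2 * 5^10 * 97 * t3^6
    - 2^4 * 5^7 * 5023 * Z^3 * t2^3 * t4 + 2^4 * 3^2 * 5^9 * 11 * 13 * Z * t1 * t2^2 * t4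

noncomputable def relY2p3 (t1 t2 t3 t4 Z : ℂ) : ℂ :=
  -2^7 * 3^3 * 5^10 * 7^2 * Z^4 * t1 * t2 * t3 * t4 + 2^7 * 5^7 * 3 * 4817 * Z^6 * t2^2 * t3 * t4
    + 2^15 * 3^2 * 5^9 * 53 * Z^7 * t1 * t3^2 * t4
    - 2^10 * 5^7 * 3 * 13 * 397 * Z * t2^2 * t3^2 * t4
    + 2^16 * 3^2 * 5^10 * 353 * Z^2 * t1 * t3^3 * t4
    - 2^13 * 5^7 * 19 * 41 * 317 * Z^4 * t2 * t3^3 * t4 + 2^19 * 5^8 * 11 * 1723 * Z^7 * t3^4 * t4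
    + 2^22 * 5^8 * 3 * 109 * 137 * Z^2 * t3^5 * t4

noncomputable def relY2p4 (t1 t2 t3 t4 Z : ℂ) : ℂ :=
  -2^5 * 3^2 * 5^8 * 547 * Z^6 * t1 * t2 * t4^2 - 2^4 * 3^2 * 5^6 * 7 * 13 * 167 * t2^3 * t4^2
    - 2^10 * 3^2 * 5^8 * 11 * 103 * Z * t1 * t2 * t3 * t4^2
    - 2^9 * 5^6 * 3 * 7 * 3907 * Z^3 * t2^2 * t3 * t4^2
    + 2^15 * 3^2 * 5^8 * 881 * Z^4 * t1 * t3^2 * t4^2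
    + 2^11 * 3^2 * 5^7 * 31883 * Z^6 * t2 * t3^2 * t4^2
    - 2^16 * 5^8 * 43 * 461 * Z * t2 * t3^3 * t4^2 + 2^22 * 5^7 * 127 * 1301 * Z^4 * t3^4 * t4^2

noncomputable def relY2p5 (t1 t2 t3 t4 Z : ℂ) : ℂ :=
  2^9 * 3^2 * 5^7 * 823 * Z^3 * t1 * t2 * t4^3 - 2^8 * 5^6 * 3 * 7 * 37 * 53 * Z^5 * t2^2 * t4^3
    - 2^13 * 3^2 * 5^8 * 7 * 53 * Z^6 * t1 * t3 * t4^3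
    - 2^12 * 5^6 * 3 * 73 * 1877 * t2^2 * t3 * t4^3 - 2^17 * 3^5 * 5^8 * 11 * Z * t1 * t3^2 * t4^3
    + 2^17 * 3^2 * 5^6 * 13 * 137 * Z^3 * t2 * t3^2 * t4^3
    - 2^19 * 3^4 * 5^7 * 641 * Z^6 * t3^3 * t4^3 + 2^23 * 5^7 * 96601 * Z * t3^4 * t4^3

noncomputable def relY2p6 (t1 t2 t3 t4 Z : ℂ) : ℂ :=
  2^8 * 3^2 * 5^6 * 7 * 13 * 67 * 79 * t1 * t2 * t4^4
    - 2^10 * 5^5 * 7^2 * 10343 * Z^2 * t2^2 * t4^4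
    + 2^14 * 3^2 * 5^6 * 19 * 443 * Z^3 * t1 * t3 * t4^4
    + 2^13 * 5^5 * 7^2 * 29 * 409 * Z^5 * t2 * t3 * t4^4
    - 2^14 * 5^5 * 17 * 379 * 17209 * t2 * t3^2 * t4^4
    - 2^20 * 5^5 * 17 * 19 * 13931 * Z^3 * t3^3 * t4^4 + 2^13 * 3^7 * 5^5 * 79 * Z^5 * t1 * t4^5
    - 2^12 * 5^3 * 13 * 59 * 5623 * Z^7 * t2 * t4^5

noncomputable def relY2p7 (t1 t2 t3 t4 Z : ℂ) : ℂ :=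
  2^15 * 3^2 * 5^6 * 13 * 103 * 883 * t1 * t3 * t4^5
    + 2^15 * 5^3 * 11 * 5478043 * Z^2 * t2 * t3 * t4^5
    - 2^19 * 5^3 * 11 * 83 * 32839 * Z^5 * t3^2 * t4^5 + 2^21 * 5^5 * 5189507 * t3^3 * t4^5
    - 2^14 * 3^7 * 5^5 * 59 * Z^2 * t1 * t4^6 - 2^12 * 5^2 * 327966773 * Z^4 * t2 * t4^6
    + 2^18 * 5^2 * 3 * 83 * 593 * 613 * Z^7 * t3 * t4^6
    + 2^20 * 5^3 * 1249 * 3677 * Z^2 * t3^2 * t4^6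

noncomputable def relY2p8 (t2 t3 t4 Z : ℂ) : ℂ :=
  2^17 * 5 * 139571863 * Z * t2 * t4^7 + 2^19 * 5 * 1099915517 * Z^4 * t3 * t4^7
    - 2^18 * 13 * 49685821 * Z^6 * t4^8 - 2^24 * 5 * 139571863 * Z * t3 * t4^8
    + 2^23 * 19 * 1661677 * Z^3 * t4^9 + 2^35 * 5^7 * 17 * t4^10

/-- The right-hand side of the relation for `y_2`. -/
noncomputable def relY2 (t1 t2 t3 t4 Z : ℂ) : ℂ :=
  5^3 / (2^3 * 3^18) * (
    relY2p1 t1 t2 t3 Z + relY2p2 t1 t2 t3 t4 Z + relY2p3 t1 t2 t3 t4 Z + relY2p4 t1 t2 t3 t4 Z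
      + relY2p5 t1 t2 t3 t4 Z + relY2p6 t1 t2 t3 t4 Z + relY2p7 t1 t2 t3 t4 Z
      + relY2p8 t2 t3 t4 Z)

noncomputable def relY3p1 (t1 t2 t3 t4 Z : ℂ) : ℂ :=
  3^3 * 5^6 * t1 * t2 - 2^2 * 5^4 * 13 * Z^2 * t2^2 + 2^6 * 5^4 * 23 * Z^5 * t2 * t3
    + 2^6 * 5^4 * 587 * t2 * t3^2 + 2^13 * 5^7 * Z^3 * t3^3 - 2^5 * 5^3 * Z^7 * t2 * t4
    + 2^7 * 3^3 * 5^5 * 11 * t1 * t3 * t4 + 2^9 * 5^3 * 53 * Z^2 * t2 * t3 * t4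

noncomputable def relY3p2 (t2 t3 t4 Z : ℂ) : ℂ :=
  2^12 * 5^5 * Z^5 * t3^2 * t4 + 2^13 * 5^4 * 23 * 131 * t3^3 * t4
    - 2^4 * 5^2 * 1523 * Z^4 * t2 * t4^2 + 2^9 * 5^3 * 3 * 73 * Z^7 * t3 * t4^2
    - 2^13 * 5^3 * 29 * Z^2 * t3^2 * t4^2 + 2^8 * 5 * 31 * 41 * Z * t2 * t4^3
    + 2^11 * 5 * 7 * 491 * Z^4 * t3 * t4^3 - 2^9 * 7541 * Z^6 * t4^4

noncomputable def relY3p3 (t3 t4 Z : ℂ) : ℂ :=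
  -2^15 * 5 * 31 * 41 * Z * t3 * t4^4 + 2^14 * 7 * 53 * Z^3 * t4^5 + 2^21 * 5^3 * 11 * t4^6

/-- The right-hand side of the relation for `y_3`. -/
noncomputable def relY3 (t1 t2 t3 t4 Z : ℂ) : ℂ :=
  -(5^3 / (2^2 * 3^11)) * (
    relY3p1 t1 t2 t3 t4 Z + relY3p2 t2 t3 t4 Z + relY3p3 t3 t4 Z)

/-- The right-hand side of the relation for `y_4`. -/
noncomputable def relY4 (t4 : ℂ) : ℂ := 40 / 3 * t4

/-- The four polynomials in `t` and `Z` (`t i` is `t_{i+1}`), in the order `y_1, y_2, y_3, y_4`. -/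
noncomputable def relY (t : Fin 4 → ℂ) (Z : ℂ) : Fin 4 → ℂ :=
  ![relY1 (t 0) (t 1) (t 2) (t 3) Z, relY2 (t 0) (t 1) (t 2) (t 3) Z,
    relY3 (t 0) (t 1) (t 2) (t 3) Z, relY4 (t 3)]

end Relations

end H47

/-! Sparse polynomials in five variables with integer coefficients, and a test for identities
between weighted homogeneous expressions in them which the kernel can evaluate. -/

/-! Write `y` for the orbit map `basicInvariant` and `Y` for the map from `t` to `relY t (Z t)`. The
core of the argument is that two metrics have the same matrix. The products of the gradients of the
`y_k` for the standard form are polynomials in the invariants, collected in `gramMatrix`. The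
products of the gradients of the `Y_k` for the intersection form `g` are the same polynomials
evaluated at `Y`. So `J_y J_yᵀ = G(y)` and `J_Y g J_Yᵀ = G(Y)` with one matrix `G`
(`euclProd_basicInvariant_eq_gramMatrix`, `gradProd_relY_eq_gramMatrix`).

Suppose `x` is an analytic lift, `y(x(t)) = Y(t)`, where `det G(Y)` does not vanish. Then `J_Y = J_y
J_x` with `J_y` invertible, and cancelling `J_y` on both sides leaves `J_x g J_xᵀ = 1`. The Euler
condition follows in the same way, because `y_k` is homogeneous in `x` and `Y_k` is quasihomogeneous
under `E` with proportional degrees (`isFlatCoords_of_basicInvariant_eq`).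

Lifts exist because every value off the discriminant is attained by the orbit map. The invariants
have only the origin as common zero, hence `y` is proper with closed image. The image is open at
points with `det G ≠ 0`, and such a point can be joined to a known regular value within a complex
line minus a countable set (`mem_range_basicInvariant`). The inverse function theorem then gives the
lift (`exists_flatCoords`). The set of good points is dense: on the hypersurface `P = 0` the
coordinate `t₂` is a polynomial in `Z, t₁, t₃, t₄`, so `det G(Y)` is a polynomial in these four free
coordinates, and it is nonzero at one point (`subset_closure_regularSet`).

For the second claim, two systems of normalised flat coordinates pull the standard form back to the
same metric. Equality of the Christoffel symbols makes the transition matrix constant, and the Euler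
condition excludes translations (`IsFlatCoords.exists_orthogonal`). Given any `x` on a connected
`W`, compare it near a regular point of `W` with the lift constructed above; the identity theorem
spreads the resulting relation over `W`.

The large polynomial identities are reduced to integer arithmetic. A homogeneous polynomial with
bounded coefficients vanishes as soon as one Kronecker substitution by powers of `2 ^ b` does
(`Ex.den_eq_zero`). All derivatives along the branch are multiplied by `∂P/∂Z` to stay polynomial.
-/

namespace SparsePoly

/-- The monomial `c * v₀ ^ e₀ * ⋯ * v₄ ^ e₄`. -/
structure Mono where
  c : ℕ
  e₀ : ℕ
  e₁ : ℕ
  e₂ : ℕ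
  e₃ : ℕ
  e₄ : ℕ

/-- A sparse polynomial: the difference of two sums of monomials. -/
structure SP where
  pos : List Mono
  neg : List Mono

/-- Sums and products of sparse polynomials; every leaf carries its weight. -/
inductive Ex
  | leaf (w : ℕ) (p : SP)
  | add (a b : Ex)
  | mul (a b : Ex)

section Denotation

variable {A : Type*} [CommSemiring A]

def Mono.den (m : Mono) (v : Fin 5 → A) : A :=
  m.c * v 0 ^ m.e₀ * v 1 ^ m.e₁ * v 2 ^ m.e₂ * v 3 ^ m.e₃ * v 4 ^ m.e₄

def listDen : List Mono → (Fin 5 → A) → A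
  | [], _ => 0
  | m :: l, v => m.den v + listDen l v

def SP.abs (p : SP) (v : Fin 5 → A) : A := listDen p.pos v + listDen p.neg v

def Ex.abs (v : Fin 5 → A) : Ex → A
  | .leaf _ p => p.abs v
  | .add a b => a.abs v + b.abs v
  | .mul a b => a.abs v * b.abs v

def SP.den {A : Type*} [CommRing A] (p : SP) (v : Fin 5 → A) : A :=
  listDen p.pos v - listDen p.neg v

def Ex.den {A : Type*} [CommRing A] (v : Fin 5 → A) : Ex → A
  | .leaf _ p => p.den v
  | .add a b => a.den v + b.den v
  | .mul a b => a.den v * b.den v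

/-- The point whose last coordinate is the value of `q` at the first four. -/
def SP.point {A : Type*} [CommRing A] (q : SP) (v : Fin 4 → A) : Fin 5 → A :=
  ![v 0, v 1, v 2, v 3, q.den ![v 0, v 1, v 2, v 3, 0]]

def SP.absPoint (q : SP) (v : Fin 4 → A) : Fin 5 → A :=
  ![v 0, v 1, v 2, v 3, q.abs ![v 0, v 1, v 2, v 3, 0]]

theorem listDen_map {B : Type*} [CommSemiring B] (f : A →+* B) (l : List Mono) (v : Fin 5 → A) :
    f (listDen l v) = listDen l (fun i => f (v i)) := by
  induction l with
  | nil => simp [listDen]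
  | cons m l ih => simp [listDen, Mono.den, ih]

theorem SP.den_map {A B : Type*} [CommRing A] [CommRing B] (f : A →+* B) (p : SP)
    (v : Fin 5 → A) : f (p.den v) = p.den (fun i => f (v i)) := by
  simp [SP.den, listDen_map]

theorem SP.abs_map {B : Type*} [CommSemiring B] (f : A →+* B) (p : SP)
    (v : Fin 5 → A) : f (p.abs v) = p.abs (fun i => f (v i)) := by
  simp [SP.abs, listDen_map]

theorem Ex.den_map {A B : Type*} [CommRing A] [CommRing B] (f : A →+* B) (e : Ex)
    (v : Fin 5 → A) : f (e.den v) = e.den (fun i => f (v i)) := by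
  induction e with
  | leaf w p => exact p.den_map f v
  | add a b iha ihb => simp [Ex.den, iha, ihb]
  | mul a b iha ihb => simp [Ex.den, iha, ihb]

theorem Ex.abs_map {B : Type*} [CommSemiring B] (f : A →+* B) (e : Ex)
    (v : Fin 5 → A) : f (e.abs v) = e.abs (fun i => f (v i)) := by
  induction e with
  | leaf w p => exact p.abs_map f v
  | add a b iha ihb => simp [Ex.abs, iha, ihb]
  | mul a b iha ihb => simp [Ex.abs, iha, ihb]

theorem SP.point_map {A B : Type*} [CommRing A] [CommRing B] (f : A →+* B) (q : SP)
    (v : Fin 4 → A) : (fun i => f (q.point v i)) = q.point (fun i => f (v i)) := by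
  funext i
  fin_cases i <;> simp [SP.point, SP.den_map]
  congr 1
  funext i
  fin_cases i <;> simp

theorem SP.absPoint_map {B : Type*} [CommSemiring B] (f : A →+* B) (q : SP)
    (v : Fin 4 → A) : (fun i => f (q.absPoint v i)) = q.absPoint (fun i => f (v i)) := by
  funext i
  fin_cases i <;> simp [SP.absPoint, SP.abs_map]
  congr 1
  funext i
  fin_cases i <;> simp

end Denotation

/-! ### Weighted homogeneity of sparse expressions. -/

section Homogeneity

/-- The weights of the variables; the first one has weight `1`. -/
structure Weights where
  w₁ : ℕ
  w₂ : ℕ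
  w₃ : ℕ
  w₄ : ℕ

def Mono.hom (W : Weights) (w : ℕ) (m : Mono) : Bool :=
  m.c == 0 || m.e₀ + m.e₁ * W.w₁ + m.e₂ * W.w₂ + m.e₃ * W.w₃ + m.e₄ * W.w₄ == w

def SP.hom (W : Weights) (w : ℕ) (p : SP) : Bool :=
  p.pos.all (Mono.hom W w) && p.neg.all (Mono.hom W w)

def Ex.wt : Ex → ℕ
  | .leaf w _ => w
  | .add a _ => a.wt
  | .mul a b => a.wt + b.wt

def Ex.hom (W : Weights) : Ex → Bool
  | .leaf w p => p.hom W w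
  | .add a b => a.hom W && b.hom W && a.wt == b.wt
  | .mul a b => a.hom W && b.hom W

open MvPolynomial

def Weights.fn (W : Weights) : Fin 4 → ℕ := ![1, W.w₁, W.w₂, W.w₃]

/-- The two alternatives for `a` serve two uses: expressions in which the last variable stands for
the homogeneous polynomial `q`, and `q` itself, in which that variable does not occur. -/
theorem listDen_isWeightedHomogeneous (W : Weights) (w : ℕ) (l : List Mono)
    (h : l.all (Mono.hom W w) = true) (a : MvPolynomial (Fin 4) ℤ)
    (ha : IsWeightedHomogeneous W.fn a W.w₄ ∨ ∀ m ∈ l, m.e₄ = 0) :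
    IsWeightedHomogeneous W.fn (listDen l ![X 0, X 1, X 2, X 3, a]) w := by
  induction l with
  | nil => exact isWeightedHomogeneous_zero _ _ _
  | cons m l ih =>
    rw [List.all_cons, Bool.and_eq_true] at h
    refine .add ?_ (ih h.2 (ha.imp_right fun H m hm => H m (List.mem_cons_of_mem _ hm)))
    rw [Mono.den]
    have h1 := h.1
    simp only [Mono.hom, Bool.or_eq_true, beq_iff_eq] at h1
    rcases h1 with h1 | h1
    · rw [h1]
      simpa using isWeightedHomogeneous_zero _ _ _
    · have hX : ∀ i : Fin 4, ∀ e : ℕ,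
          IsWeightedHomogeneous W.fn ((X i : MvPolynomial (Fin 4) ℤ) ^ e) (e • W.fn i) :=
        fun i e => (isWeightedHomogeneous_X ℤ W.fn i).pow e
      have hc : IsWeightedHomogeneous W.fn (m.c : MvPolynomial (Fin 4) ℤ) 0 := by
        simpa using isWeightedHomogeneous_C W.fn (m.c : ℤ)
      have ha' : IsWeightedHomogeneous W.fn (a ^ m.e₄) (m.e₄ • W.w₄) := by
        rcases ha with ha | ha
        · exact ha.pow _
        · rw [ha m (by simp)]
          simpa using isWeightedHomogeneous_one ℤ W.fn
      convert! ((((hc.mul (hX 0 m.e₀)).mul (hX 1 m.e₁)).mul (hX 2 m.e₂)).mul (hX 3 m.e₃)).mul ha'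
        using 1
      simp [Weights.fn, ← h1]

def SP.closed (q : SP) : Bool := q.pos.all (fun m => m.e₄ == 0) && q.neg.all (fun m => m.e₄ == 0)

theorem SP.den_point_isWeightedHomogeneous {W : Weights} {q : SP} (hq : q.hom W W.w₄ = true)
    (hc : q.closed = true) {w : ℕ} {p : SP} (hp : p.hom W w = true) :
    IsWeightedHomogeneous W.fn (p.den (q.point (X : Fin 4 → MvPolynomial (Fin 4) ℤ))) w := by
  simp only [SP.hom, SP.closed, Bool.and_eq_true, List.all_eq_true, beq_iff_eq] at hq hc hp
  have H : IsWeightedHomogeneous W.fn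
      (q.den (![X 0, X 1, X 2, X 3, 0] : Fin 5 → MvPolynomial (Fin 4) ℤ)) W.w₄ :=
    .sub (listDen_isWeightedHomogeneous W _ _ (List.all_eq_true.2 hq.1) 0 (.inr hc.1))
      (listDen_isWeightedHomogeneous W _ _ (List.all_eq_true.2 hq.2) 0 (.inr hc.2))
  exact .sub (listDen_isWeightedHomogeneous W _ _ (List.all_eq_true.2 hp.1) _ (.inl H))
      (listDen_isWeightedHomogeneous W _ _ (List.all_eq_true.2 hp.2) _ (.inl H))

theorem Ex.den_point_isWeightedHomogeneous {W : Weights} {q : SP} (hq : q.hom W W.w₄ = true)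
    (hc : q.closed = true) {e : Ex} (he : e.hom W = true) :
    IsWeightedHomogeneous W.fn (e.den (q.point (X : Fin 4 → MvPolynomial (Fin 4) ℤ))) e.wt := by
  induction e with
  | leaf w p => exact SP.den_point_isWeightedHomogeneous hq hc he
  | add a b iha ihb =>
    simp only [Ex.hom, Bool.and_eq_true, beq_iff_eq] at he
    exact (iha he.1.1).add (he.2 ▸ ihb he.1.2)
  | mul a b iha ihb =>
    simp only [Ex.hom, Bool.and_eq_true] at he
    exact (iha he.1).mul (ihb he.2)

end Homogeneity

/-! ### Coefficient bounds by majorants. -/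

section Bound

open MvPolynomial

/-- The coefficients of `P` bound those of `p`. -/
def Majorant {σ : Type*} (p : MvPolynomial σ ℤ) (P : MvPolynomial σ ℕ) : Prop :=
  ∀ m, |coeff m p| ≤ coeff m P

namespace Majorant

variable {σ : Type*} {p q : MvPolynomial σ ℤ} {P Q : MvPolynomial σ ℕ}

theorem add (hp : Majorant p P) (hq : Majorant q Q) : Majorant (p + q) (P + Q) := fun m => by
  simpa using (abs_add_le _ _).trans (add_le_add (hp m) (hq m))

theorem sub (hp : Majorant p P) (hq : Majorant q Q) : Majorant (p - q) (P + Q) := fun m => by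
  simpa using (abs_sub _ _).trans (add_le_add (hp m) (hq m))

theorem mul (hp : Majorant p P) (hq : Majorant q Q) : Majorant (p * q) (P * Q) := fun m => by
  classical
  rw [coeff_mul, coeff_mul, Nat.cast_sum]
  refine (Finset.abs_sum_le_sum_abs _ _).trans (Finset.sum_le_sum fun x _ => ?_)
  rw [abs_mul, Nat.cast_mul]
  exact mul_le_mul (hp _) (hq _) (abs_nonneg _) (Nat.cast_nonneg _)

theorem natCast (c : ℕ) : Majorant (c : MvPolynomial σ ℤ) (c : MvPolynomial σ ℕ) := fun m => by
  classical
  rw [← map_natCast (C : ℤ →+* MvPolynomial σ ℤ), ← map_natCast (C : ℕ →+* MvPolynomial σ ℕ),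
    coeff_C, coeff_C]
  split <;> simp

theorem X (i : σ) : Majorant (X i : MvPolynomial σ ℤ) (X i : MvPolynomial σ ℕ) := fun m => by
  classical
  rw [coeff_X, coeff_X]
  split <;> simp

theorem pow (hp : Majorant p P) (n : ℕ) : Majorant (p ^ n) (P ^ n) := by
  induction n with
  | zero => simpa using natCast (σ := σ) 1
  | succ n ih => simpa [pow_succ] using ih.mul hp

theorem listDen {v : Fin 5 → MvPolynomial σ ℤ} {V : Fin 5 → MvPolynomial σ ℕ}
    (h : ∀ i, Majorant (v i) (V i)) (l : List Mono) :
    Majorant (SparsePoly.listDen l v) (SparsePoly.listDen l V) := by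
  induction l with
  | nil => simpa [SparsePoly.listDen] using natCast (σ := σ) 0
  | cons m l ih =>
    exact .add ((((((natCast _).mul ((h 0).pow _)).mul ((h 1).pow _)).mul ((h 2).pow _)).mul
      ((h 3).pow _)).mul ((h 4).pow _)) ih

theorem SP {v : Fin 5 → MvPolynomial σ ℤ} {V : Fin 5 → MvPolynomial σ ℕ}
    (h : ∀ i, Majorant (v i) (V i)) (p : SP) : Majorant (p.den v) (p.abs V) :=
  (listDen h p.pos).sub (listDen h p.neg)

theorem Ex {v : Fin 5 → MvPolynomial σ ℤ} {V : Fin 5 → MvPolynomial σ ℕ}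
    (h : ∀ i, Majorant (v i) (V i)) (e : Ex) : Majorant (e.den v) (e.abs V) := by
  induction e with
  | leaf w p => exact .SP h p
  | add a b iha ihb => exact iha.add ihb
  | mul a b iha ihb => exact iha.mul ihb

theorem point (q : SparsePoly.SP) (i : Fin 5) :
    Majorant (q.point (MvPolynomial.X : Fin 4 → MvPolynomial (Fin 4) ℤ) i)
      (q.absPoint (MvPolynomial.X : Fin 4 → MvPolynomial (Fin 4) ℕ) i) := by
  have h0 : Majorant (0 : MvPolynomial (Fin 4) ℤ) 0 := by simpa using natCast (σ := Fin 4) 0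
  fin_cases i
  · exact X 0
  · exact X 1
  · exact X 2
  · exact X 3
  · refine SP (fun i => ?_) q
    fin_cases i
    · exact X 0
    · exact X 1
    · exact X 2
    · exact X 3
    · exact h0

end Majorant

/-- With natural coefficients the value at `(1, …, 1)` is the sum of all coefficients. This makes a
majorant effective: one evaluation bounds every coefficient. -/
theorem coeff_le_eval_one {σ : Type*} (P : MvPolynomial σ ℕ) (m : σ →₀ ℕ) :
    coeff m P ≤ eval (fun _ => 1) P := by
  rw [eval_eq]
  simp only [one_pow, Finset.prod_const_one, mul_one]
  by_cases h : m ∈ P.support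
  · exact Finset.single_le_sum (f := fun d => coeff d P) (fun _ _ => Nat.zero_le _) h
  · simp [notMem_support_iff.1 h]

/-- A bound for the absolute values of the coefficients. -/
def Ex.norm (q : SP) (e : Ex) : ℕ := e.abs (q.absPoint fun _ => 1)

theorem Ex.abs_coeff_le_norm (q : SP) (e : Ex) (m : Fin 4 →₀ ℕ) :
    |coeff m (e.den (q.point (X : Fin 4 → MvPolynomial (Fin 4) ℤ)))| ≤ e.norm q := by
  refine (Majorant.Ex (Majorant.point q) e m).trans ?_
  have h := coeff_le_eval_one (e.abs (q.absPoint (X : Fin 4 → MvPolynomial (Fin 4) ℕ))) m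
  rw [Ex.abs_map (eval fun _ => 1), SP.absPoint_map] at h
  simpa [Ex.norm] using h

end Bound

/-! ### Reading off coefficients as digits. -/

section Digits

/-- Take the nonzero coefficient with the smallest exponent. Modulo the next power of `N` it is the
only surviving term, so `N` divides it, against its size. Working from the lowest digit, signed
coefficients of absolute value below `N` suffice; no bound by `N / 2` is needed. -/
theorem eq_zero_of_pow_dvd_sum {ι : Type*} (S : Finset ι) (c : ι → ℤ) (κ : ι → ℕ) (N K : ℕ)
    (hκ : Set.InjOn κ S) (hK : ∀ i ∈ S, κ i < K) (hc : ∀ i ∈ S, |c i| < N)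
    (h : (N : ℤ) ^ K ∣ ∑ i ∈ S, c i * (N : ℤ) ^ κ i) : ∀ i ∈ S, c i = 0 := by
  classical
  by_contra! hne
  obtain ⟨i₀, hi₀, hmin⟩ := (S.filter fun i => c i ≠ 0).exists_min_image κ
    (by obtain ⟨i, hi, hi'⟩ := hne; exact ⟨i, by simp [hi, hi']⟩)
  rw [Finset.mem_filter] at hi₀
  have hN : (0 : ℤ) < N := (abs_nonneg _).trans_lt (hc i₀ hi₀.1)
  have h1 : (N : ℤ) ^ (κ i₀ + 1) ∣ ∑ i ∈ S, c i * (N : ℤ) ^ κ i :=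
    (pow_dvd_pow _ (hK i₀ hi₀.1)).trans h
  rw [← Finset.add_sum_erase S _ hi₀.1] at h1
  have h2 : (N : ℤ) ^ (κ i₀ + 1) ∣ ∑ i ∈ S.erase i₀, c i * (N : ℤ) ^ κ i := by
    refine Finset.dvd_sum fun i hi => ?_
    rw [Finset.mem_erase] at hi
    by_cases hci : c i = 0
    · simp [hci]
    · refine Dvd.dvd.mul_left (pow_dvd_pow _ ?_) _
      have := hmin i (by simp [hi.2, hci])
      have h3 : κ i ≠ κ i₀ := fun h => hi.1 (hκ hi.2 hi₀.1 h)
      omega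
  have h3 := (Int.dvd_add_left h2).1 h1
  rw [pow_succ', mul_comm (c i₀)] at h3
  rw [mul_comm] at h3
  have h4 : (N : ℤ) ∣ c i₀ := Int.dvd_of_mul_dvd_mul_left (pow_pos hN _).ne' h3
  exact hi₀.2 (Int.eq_zero_of_abs_lt_dvd h4 (hc i₀ hi₀.1))

end Digits

/-! ### Kronecker substitution as a test for vanishing. -/

section Test

/-- Number of values of the exponent of the variable of weight `w` in weight `wt`. -/
def bound (wt w : ℕ) : ℕ := wt / w + 1

/-- Place values of a mixed radix system: the exponent of `v₃` is the lowest digit, that of `v₂`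
counts in units of `k₂`, that of `v₁` in units of `k₁`, and `slots` bounds all resulting numbers.
The exponent of `v₀` needs no digit, since the weight determines it. -/
def Weights.k₂ (W : Weights) (wt : ℕ) : ℕ := bound wt W.w₃

def Weights.k₁ (W : Weights) (wt : ℕ) : ℕ := bound wt W.w₃ * bound wt W.w₂

def Weights.slots (W : Weights) (wt : ℕ) : ℕ := bound wt W.w₃ * bound wt W.w₂ * bound wt W.w₁

def listVal (b k₁ k₂ a : ℕ) : List Mono → ℕ
  | [] => 0
  | m :: l => (m.c * a ^ m.e₄) <<< (b * (m.e₁ * k₁ + m.e₂ * k₂ + m.e₃)) + listVal b k₁ k₂ a l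

/-- The remainder modulo `2 ^ k`. -/
def lowBits (k x : ℕ) : ℕ := x &&& (2 ^ k - 1)

/-- Subtraction modulo `2 ^ k` is done by adding the complement, so that the computation stays
within natural numbers. -/
def SP.val (b k₁ k₂ k a : ℕ) (p : SP) : ℕ :=
  lowBits k (listVal b k₁ k₂ a p.pos + (2 ^ k - lowBits k (listVal b k₁ k₂ a p.neg)))

def Ex.val (b k₁ k₂ k a : ℕ) : Ex → ℕ
  | .leaf _ p => p.val b k₁ k₂ k a
  | .add x y => lowBits k (x.val b k₁ k₂ k a + y.val b k₁ k₂ k a)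
  | .mul x y => lowBits k (x.val b k₁ k₂ k a * y.val b k₁ k₂ k a)

/-- A test, with `b`-bit digits, for the vanishing of `e` where the last variable is `q`. -/
def Ex.vanishes (W : Weights) (q : SP) (b : ℕ) (e : Ex) : Bool :=
  q.hom W W.w₄ && q.closed && e.hom W && Nat.blt 0 W.w₁ && Nat.blt 0 W.w₂ && Nat.blt 0 W.w₃
    && Nat.blt (e.norm q) (2 ^ b)
    && Nat.beq (e.val b (W.k₁ e.wt) (W.k₂ e.wt) (b * W.slots e.wt)
      (q.val b (W.k₁ e.wt) (W.k₂ e.wt) (b * W.slots e.wt) 0)) 0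

theorem lowBits_eq (k x : ℕ) : lowBits k x = x % 2 ^ k := Nat.and_two_pow_sub_one_eq_mod x k

theorem listVal_eq (b k₁ k₂ a : ℕ) (l : List Mono) :
    listVal b k₁ k₂ a l = listDen l ![1, (2 ^ b) ^ k₁, (2 ^ b) ^ k₂, 2 ^ b, a] := by
  induction l with
  | nil => rfl
  | cons m l ih =>
    rw [listVal, listDen, ih, Nat.shiftLeft_eq, Mono.den]
    simp
    ring

theorem listDen_modEq {M : ℤ} {u v : Fin 5 → ℤ} (h : ∀ i, u i ≡ v i [ZMOD M]) (l : List Mono) :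
    listDen l u ≡ listDen l v [ZMOD M] := by
  induction l with
  | nil => rfl
  | cons m l ih =>
    exact .add (((((((Int.ModEq.refl _).mul ((h 0).pow _)).mul ((h 1).pow _)).mul
      ((h 2).pow _)).mul ((h 3).pow _)).mul ((h 4).pow _))) ih

theorem SP.val_modEq (b k₁ k₂ k a : ℕ) (a' : ℤ) (ha : (a : ℤ) ≡ a' [ZMOD (2 ^ k : ℕ)])
    (p : SP) : (p.val b k₁ k₂ k a : ℤ) ≡
      p.den ![1, ((2 ^ b : ℕ) : ℤ) ^ k₁, ((2 ^ b : ℕ) : ℤ) ^ k₂, ((2 ^ b : ℕ) : ℤ), a'] [ZMOD (2 ^ k : ℕ)] := by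
  have key : ∀ l : List Mono, ((listVal b k₁ k₂ a l : ℕ) : ℤ) ≡
      listDen l ![1, ((2 ^ b : ℕ) : ℤ) ^ k₁, ((2 ^ b : ℕ) : ℤ) ^ k₂, ((2 ^ b : ℕ) : ℤ), a']
      [ZMOD (2 ^ k : ℕ)] := fun l => by
    rw [listVal_eq]
    refine (congrArg (· % ((2 ^ k : ℕ) : ℤ)) (listDen_map (Nat.castRingHom ℤ) l _)).trans ?_
    refine listDen_modEq (fun i => ?_) l
    fin_cases i <;> simp <;> first | rfl | exact ha
  rw [SP.val, lowBits_eq, lowBits_eq, Int.natCast_mod, SP.den]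
  refine (Int.mod_modEq _ _).trans ?_
  rw [Nat.cast_add, Nat.cast_sub (Nat.mod_lt _ (by positivity)).le, sub_eq_add_neg]
  refine (key _).add ?_
  rw [Int.natCast_mod]
  have h1 : ((2 ^ k : ℕ) : ℤ) - (listVal b k₁ k₂ a p.neg : ℤ) % (2 ^ k : ℕ) ≡
      0 - (listVal b k₁ k₂ a p.neg : ℤ)
      [ZMOD (2 ^ k : ℕ)] := .sub (by simp [Int.ModEq]) (Int.mod_modEq _ _)
  rw [zero_sub] at h1
  exact h1.trans (key _).neg

theorem Ex.val_modEq (b k₁ k₂ k a : ℕ) (a' : ℤ) (ha : (a : ℤ) ≡ a' [ZMOD (2 ^ k : ℕ)])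
    (e : Ex) : (e.val b k₁ k₂ k a : ℤ) ≡
      e.den ![1, ((2 ^ b : ℕ) : ℤ) ^ k₁, ((2 ^ b : ℕ) : ℤ) ^ k₂, ((2 ^ b : ℕ) : ℤ), a'] [ZMOD (2 ^ k : ℕ)] := by
  induction e with
  | leaf w p => exact p.val_modEq b k₁ k₂ k a a' ha
  | add x y ihx ihy =>
    rw [Ex.val, lowBits_eq, Int.natCast_mod, Nat.cast_add]
    exact (Int.mod_modEq _ _).trans (ihx.add ihy)
  | mul x y ihx ihy =>
    rw [Ex.val, lowBits_eq, Int.natCast_mod, Nat.cast_mul]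
    exact (Int.mod_modEq _ _).trans (ihx.mul ihy)

theorem digits_inj {a b c a' b' c' A B : ℕ} (ha : a < A) (hb : b < B) (ha' : a' < A) (hb' : b' < B)
    (h : c * (A * B) + b * A + a = c' * (A * B) + b' * A + a') : a = a' ∧ b = b' ∧ c = c' := by
  have e : ∀ a b c : ℕ, c * (A * B) + b * A + a = a + A * (b + B * c) := fun a b c => by ring
  rw [e, e] at h
  have h1 := congrArg (· % A) h
  simp only [Nat.add_mul_mod_self_left, Nat.mod_eq_of_lt ha, Nat.mod_eq_of_lt ha'] at h1
  subst h1
  have h2 := Nat.eq_of_mul_eq_mul_left (Nat.pos_of_ne_zero (by omega)) (Nat.add_left_cancel h)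
  have h3 := congrArg (· % B) h2
  simp only [Nat.add_mul_mod_self_left, Nat.mod_eq_of_lt hb, Nat.mod_eq_of_lt hb'] at h3
  subst h3
  exact ⟨rfl, rfl, Nat.eq_of_mul_eq_mul_left (Nat.pos_of_ne_zero (by omega))
    (Nat.add_left_cancel h2)⟩

theorem lt_bound {w wt e : ℕ} (hw : 0 < w) (h : e * w ≤ wt) : e < bound wt w :=
  Nat.lt_succ_of_le ((Nat.le_div_iff_mul_le hw).2 h)

-- The identity is proved for the universal point, in the polynomial ring over `ℤ`. There
-- homogeneity lets `v₀` be set to `1`, the other variables become powers of `N = 2 ^ b` with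
-- distinct total exponents for distinct monomials, and the norm bound makes the coefficients
-- digits.
open MvPolynomial in
theorem Ex.den_eq_zero {W : Weights} {q : SP} {b : ℕ} {e : Ex} (h : e.vanishes W q b = true)
    {A : Type*} [CommRing A] (v : Fin 4 → A) : e.den (q.point v) = 0 := by
  simp only [Ex.vanishes, Bool.and_eq_true, Nat.blt_eq] at h
  obtain ⟨⟨⟨⟨⟨⟨⟨hq, hc⟩, he⟩, h1⟩, h2⟩, h3⟩, hn⟩, hv⟩ := h
  set p := e.den (q.point (X : Fin 4 → MvPolynomial (Fin 4) ℤ)) with hp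
  have hom : IsWeightedHomogeneous W.fn p e.wt := Ex.den_point_isWeightedHomogeneous hq hc he
  set N : ℕ := 2 ^ b with hN
  set M : ℕ := 2 ^ (b * W.slots e.wt) with hM
  set k₁ := W.k₁ e.wt with hk₁
  set k₂ := W.k₂ e.wt with hk₂
  set κ : (Fin 4 →₀ ℕ) → ℕ := fun m => m 1 * k₁ + m 2 * k₂ + m 3 with hκ
  have hMN : (M : ℤ) = (N : ℤ) ^ W.slots e.wt := by
    rw [hM, hN, pow_mul]
    push_cast
    rfl
  have hval : (M : ℤ) ∣ eval ![1, (N : ℤ) ^ k₁, (N : ℤ) ^ k₂, (N : ℤ)] p := by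
    rw [hp, Ex.den_map (A := MvPolynomial (Fin 4) ℤ) (B := ℤ) (eval _),
      SP.point_map (A := MvPolynomial (Fin 4) ℤ) (B := ℤ) (eval _)]
    simp only [eval_X]
    have h4 := q.val_modEq b k₁ k₂ (b * W.slots e.wt) 0 0 (by rfl)
    have h5 := e.val_modEq b k₁ k₂ _ _ _ h4
    rw [Nat.eq_of_beq_eq_true hv] at h5
    exact (Int.modEq_zero_iff_dvd).1 h5.symm
  have hwt : ∀ m ∈ p.support, m 0 + m 1 * W.w₁ + m 2 * W.w₂ + m 3 * W.w₃ = e.wt := fun m hm => by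
    have := hom (mem_support_iff.1 hm)
    rw [Finsupp.weight_apply, Finsupp.sum_fintype _ _ (by simp), Fin.sum_univ_four] at this
    simpa [Weights.fn] using this
  have hp0 : p = 0 := by
    rw [eval_eq'] at hval
    have key := eq_zero_of_pow_dvd_sum p.support (fun m => coeff m p) κ N (W.slots e.wt) ?_ ?_ ?_ ?_
    · ext m
      by_cases hm : m ∈ p.support
      · simpa using key m hm
      · simpa using notMem_support_iff.1 hm
    · intro m hm m' hm' hmm
      have e1 := hwt m hm
      have e2 := hwt m' hm'
      obtain ⟨d3, d2, d1⟩ := digits_inj (lt_bound h3 (by omega)) (lt_bound h2 (by omega))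
        (lt_bound h3 (by omega)) (lt_bound h2 (by omega)) hmm
      ext i
      fin_cases i
      -- The variable `v₀` has weight `1`, so its exponent is the weight that remains.
      · simp only [d1, d2, d3] at e1
        show m 0 = m' 0
        omega
      · exact d1
      · exact d2
      · exact d3
    · intro m hm
      have e1 := hwt m hm
      have b1 : m 1 < bound e.wt W.w₁ := lt_bound h1 (by omega)
      have b2 : m 2 < bound e.wt W.w₂ := lt_bound h2 (by omega)
      have b3 : m 3 < bound e.wt W.w₃ := lt_bound h3 (by omega)
      simp only [hκ, hk₁, hk₂, Weights.k₁, Weights.k₂, Weights.slots]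
      calc _ < m 1 * (bound e.wt W.w₃ * bound e.wt W.w₂) + m 2 * bound e.wt W.w₃
            + bound e.wt W.w₃ := by omega
        _ = m 1 * (bound e.wt W.w₃ * bound e.wt W.w₂) + bound e.wt W.w₃ * (m 2 + 1) := by ring
        _ ≤ m 1 * (bound e.wt W.w₃ * bound e.wt W.w₂) + bound e.wt W.w₃ * bound e.wt W.w₂ := by
          gcongr
          omega
        _ = bound e.wt W.w₃ * bound e.wt W.w₂ * (m 1 + 1) := by ring
        _ ≤ _ := by
          gcongr
          omega
    · intro m _
      exact (Ex.abs_coeff_le_norm q e m).trans_lt (by exact_mod_cast hn)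
    · rw [← hMN]
      refine hval.trans (dvd_of_eq (Finset.sum_congr rfl fun m _ => ?_))
      rw [Fin.prod_univ_four]
      simp only [hκ, Matrix.cons_val, one_pow, one_mul]
      ring
  -- Specialisation of the universal identity to the given ring and point.
  have h6 := congrArg (eval₂Hom (Int.castRingHom A) v) hp0
  rw [hp, Ex.den_map, SP.point_map, map_zero] at h6
  simpa using h6

end Test

end SparsePoly

/-! ### Formal derivatives and signed expressions. -/

namespace SparsePoly

/-- The truncated `e - 1` at `e = 0` is harmless, as the coefficient becomes `0`; for the same
reason `Mono.hom` accepts monomials with coefficient `0` in any weight. -/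
def Mono.deriv : Fin 5 → Mono → Mono
  | 0, ⟨c, e₀, e₁, e₂, e₃, e₄⟩ => ⟨c * e₀, e₀ - 1, e₁, e₂, e₃, e₄⟩
  | 1, ⟨c, e₀, e₁, e₂, e₃, e₄⟩ => ⟨c * e₁, e₀, e₁ - 1, e₂, e₃, e₄⟩
  | 2, ⟨c, e₀, e₁, e₂, e₃, e₄⟩ => ⟨c * e₂, e₀, e₁, e₂ - 1, e₃, e₄⟩
  | 3, ⟨c, e₀, e₁, e₂, e₃, e₄⟩ => ⟨c * e₃, e₀, e₁, e₂, e₃ - 1, e₄⟩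
  | 4, ⟨c, e₀, e₁, e₂, e₃, e₄⟩ => ⟨c * e₄, e₀, e₁, e₂, e₃, e₄ - 1⟩

/-- The partial derivative of a sparse polynomial. -/
def SP.deriv (i : Fin 5) (p : SP) : SP := ⟨p.pos.map (Mono.deriv i), p.neg.map (Mono.deriv i)⟩

def Ex.nat (c : ℕ) : Ex := .leaf 0 ⟨[⟨c, 0, 0, 0, 0, 0⟩], []⟩

def Ex.neg (a : Ex) : Ex := .mul (.leaf 0 ⟨[], [⟨1, 0, 0, 0, 0, 0⟩]⟩) a

def Ex.sub (a b : Ex) : Ex := .add a b.neg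

def Ex.sq (a : Ex) : Ex := .mul a a

end SparsePoly

/-! ### Explicit polynomials and certificates on the Frobenius manifold side. -/

namespace H47

open SparsePoly

/-! The polynomials of the Frobenius manifold, in the variables `Z, t₁, t₃, t₄ / 5, t₂` of weights
`1, 10, 5, 3, 8`. -/

def rootSP : SP :=
  ⟨[⟨1, 8, 0, 0, 0, 0⟩, ⟨32, 5, 0, 0, 1, 0⟩, ⟨64, 3, 0, 1, 0, 0⟩, ⟨640, 0, 0, 1, 1, 0⟩],
   [⟨320, 2, 0, 0, 2, 0⟩]⟩

/-- `rootSP - t₂`. -/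
def branchSP : SP := ⟨rootSP.pos, ⟨1, 0, 0, 0, 0, 1⟩ :: rootSP.neg⟩

/-- This is `19213740 * F`; the factor clears the denominators left after the use of `t₄ / 5` as a
variable. The arrays `gradSP` and `hessSP` carry the same factor. -/
def potentialSP : SP :=
  ⟨[⟨42432, 23, 0, 0, 0, 0⟩, ⟨4330716, 20, 0, 0, 1, 0⟩, ⟨10084672, 18, 0, 1, 0, 0⟩,
    ⟨80084160, 17, 0, 0, 2, 0⟩, ⟨669492096, 15, 0, 1, 1, 0⟩, ⟨745915392, 13, 0, 2, 0, 0⟩,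
    ⟨1776203520, 12, 0, 1, 2, 0⟩, ⟨24453052416, 10, 0, 2, 1, 0⟩, ⟨14428237824, 8, 0, 3, 0, 0⟩,
    ⟨614839680000, 8, 0, 0, 5, 0⟩, ⟨1858182144000, 6, 0, 1, 4, 0⟩,
    ⟨1049326387200, 2, 0, 3, 2, 0⟩, ⟨87443865600000, 2, 0, 0, 7, 0⟩, ⟨48034350, 0, 2, 0, 1, 0⟩,
    ⟨19213740, 0, 1, 1, 0, 1⟩],
   [⟨2683824000, 14, 0, 0, 3, 0⟩, ⟨42941184000, 11, 0, 0, 4, 0⟩, ⟨301889536000, 9, 0, 1, 3, 0⟩,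
    ⟨320419307520, 7, 0, 2, 2, 0⟩, ⟨104932638720, 5, 0, 3, 1, 0⟩,
    ⟨12242141184000, 5, 0, 0, 6, 0⟩, ⟨209865277440, 3, 0, 4, 0, 0⟩,
    ⟨17488773120000, 3, 0, 1, 5, 0⟩, ⟨918160588800, 0, 0, 4, 1, 0⟩,
    ⟨291479552000000, 0, 0, 1, 6, 0⟩]⟩

def gradSP0 : SP :=
  ⟨[⟨96068700, 0, 1, 0, 1, 0⟩, ⟨19213740, 0, 0, 1, 0, 1⟩],
   []⟩

def gradSP1 : SP :=
  ⟨[⟨121992, 15, 0, 0, 0, 0⟩, ⟨8386950, 12, 0, 0, 1, 0⟩, ⟨19762704, 10, 0, 1, 0, 0⟩,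
    ⟨12199200, 9, 0, 0, 2, 0⟩, ⟨658756800, 7, 0, 1, 1, 0⟩, ⟨737807616, 5, 0, 2, 0, 0⟩,
    ⟨27326208000, 3, 0, 0, 4, 0⟩, ⟨19213740, 0, 1, 1, 0, 0⟩],
   [⟨4269720000, 6, 0, 0, 3, 0⟩, ⟨9222595200, 4, 0, 1, 2, 0⟩, ⟨3279144960, 0, 0, 3, 0, 0⟩,
    ⟨273262080000, 0, 0, 0, 5, 0⟩]⟩

def gradSP2 : SP :=
  ⟨[⟨2277184, 18, 0, 0, 0, 0⟩, ⟨54652416, 15, 0, 0, 1, 0⟩, ⟨227017728, 13, 0, 1, 0, 0⟩,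
    ⟨2841925632000, 6, 0, 0, 4, 0⟩, ⟨5902460928000, 4, 0, 1, 3, 0⟩,
    ⟨3147979161600, 2, 0, 2, 2, 0⟩, ⟨19213740, 0, 1, 0, 0, 1⟩],
   [⟨4372193280, 12, 0, 0, 2, 0⟩, ⟨5902460928, 10, 0, 1, 1, 0⟩, ⟨36434944000, 9, 0, 0, 3, 0⟩,
    ⟨3934973952, 8, 0, 2, 0, 0⟩, ⟨472196874240, 7, 0, 1, 2, 0⟩, ⟨786994790400, 5, 0, 2, 1, 0⟩,
    ⟨629595832320, 3, 0, 3, 0, 0⟩, ⟨17488773120000, 3, 0, 0, 5, 0⟩,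
    ⟨1573989580800, 0, 0, 3, 1, 0⟩, ⟨116591820800000, 0, 0, 0, 6, 0⟩]⟩

def gradSP3 : SP :=
  ⟨[⟨426972, 20, 0, 0, 0, 0⟩, ⟨4262888448000, 6, 0, 1, 3, 0⟩, ⟨5902460928000, 4, 0, 2, 2, 0⟩,
    ⟨437219328000000, 2, 0, 0, 6, 0⟩, ⟨48034350, 0, 2, 0, 0, 0⟩, ⟨1180492185600, 0, 0, 4, 0, 0⟩],
   [⟨30139200, 17, 0, 0, 1, 0⟩, ⟨40989312, 15, 0, 1, 0, 0⟩, ⟨3074198400, 14, 0, 0, 2, 0⟩,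
    ⟨10247328000, 12, 0, 1, 1, 0⟩, ⟨27326208000, 11, 0, 0, 3, 0⟩, ⟨11804921856, 10, 0, 2, 0, 0⟩,
    ⟨196748697600, 9, 0, 1, 2, 0⟩, ⟨532861056000, 8, 0, 0, 4, 0⟩, ⟨590246092800, 7, 0, 2, 1, 0⟩,
    ⟨472196874240, 5, 0, 3, 0, 0⟩, ⟨47219687424000, 5, 0, 0, 5, 0⟩,
    ⟨104932638720000, 3, 0, 1, 4, 0⟩, ⟨1573989580800000, 0, 0, 1, 5, 0⟩]⟩

def gradSP : Fin 4 → SP := ![gradSP0, gradSP1, gradSP2, gradSP3]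

def hessSP00 : SP :=
  ⟨[⟨96068700, 0, 0, 0, 1, 0⟩],
   []⟩

def hessSP01 : SP :=
  ⟨[⟨19213740, 0, 0, 1, 0, 0⟩],
   []⟩

def hessSP02 : SP :=
  ⟨[⟨19213740, 0, 0, 0, 0, 1⟩],
   []⟩

def hessSP03 : SP :=
  ⟨[⟨96068700, 0, 1, 0, 0, 0⟩],
   []⟩

def hessSP11 : SP :=
  ⟨[⟨228735, 7, 0, 0, 0, 0⟩, ⟨8005725, 4, 0, 0, 1, 0⟩, ⟨19213740, 2, 0, 1, 0, 0⟩],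
   [⟨128091600, 1, 0, 0, 2, 0⟩]⟩

def hessSP12 : SP :=
  ⟨[⟨5123664, 10, 0, 0, 0, 0⟩, ⟨245935872, 5, 0, 1, 0, 0⟩, ⟨81978624000, 1, 0, 0, 3, 0⟩,
    ⟨19213740, 0, 1, 0, 0, 0⟩],
   [⟨6148396800, 4, 0, 0, 2, 0⟩, ⟨12296793600, 2, 0, 1, 1, 0⟩, ⟨9837434880, 0, 0, 2, 0, 0⟩]⟩

def hessSP13 : SP :=
  ⟨[⟨1067430, 12, 0, 0, 0, 0⟩, ⟨27326208000, 3, 0, 0, 3, 0⟩, ⟨81978624000, 1, 0, 1, 2, 0⟩],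
   [⟨85394400, 9, 0, 0, 1, 0⟩, ⟨102473280, 7, 0, 1, 0, 0⟩, ⟨3586564800, 6, 0, 0, 2, 0⟩,
    ⟨11272060800, 4, 0, 1, 1, 0⟩, ⟨12296793600, 2, 0, 2, 0, 0⟩, ⟨1366310400000, 0, 0, 0, 4, 0⟩]⟩

def hessSP22 : SP :=
  ⟨[⟨4590802944000, 4, 0, 0, 3, 0⟩, ⟨14165906227200, 2, 0, 1, 2, 0⟩,
    ⟨1573989580800, 0, 0, 2, 1, 0⟩],
   [⟨100896768, 13, 0, 0, 0, 0⟩, ⟨9181605888, 10, 0, 0, 1, 0⟩, ⟨23609843712, 8, 0, 1, 0, 0⟩,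
    ⟨78699479040, 7, 0, 0, 2, 0⟩, ⟨944393748480, 5, 0, 1, 1, 0⟩, ⟨1259191664640, 3, 0, 2, 0, 0⟩,
    ⟨52466319360000, 1, 0, 0, 4, 0⟩]⟩

def hessSP23 : SP :=
  ⟨[⟨87443865600, 9, 0, 0, 2, 0⟩, ⟨4809412608000, 6, 0, 0, 3, 0⟩,
    ⟨13772408832000, 4, 0, 1, 2, 0⟩, ⟨7869947904000, 2, 0, 2, 1, 0⟩,
    ⟨4721968742400, 0, 0, 3, 0, 0⟩],
   [⟨109304832, 15, 0, 0, 0, 0⟩, ⟨5465241600, 12, 0, 0, 1, 0⟩, ⟨17051553792, 10, 0, 1, 0, 0⟩,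
    ⟨393497395200, 7, 0, 1, 1, 0⟩, ⟨629595832320, 5, 0, 2, 0, 0⟩,
    ⟨34977546240000, 3, 0, 0, 4, 0⟩, ⟨52466319360000, 1, 0, 1, 3, 0⟩,
    ⟨699550924800000, 0, 0, 0, 5, 0⟩]⟩

def hessSP33 : SP :=
  ⟨[⟨5246631936000, 6, 0, 1, 2, 0⟩, ⟨11149092864000, 4, 0, 2, 1, 0⟩,
    ⟨7869947904000, 2, 0, 3, 0, 0⟩, ⟨1748877312000000, 2, 0, 0, 5, 0⟩],
   [⟨64296960, 17, 0, 0, 0, 0⟩, ⟨2732620800, 14, 0, 0, 1, 0⟩, ⟨7651338240, 12, 0, 1, 0, 0⟩,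
    ⟨21860966400, 11, 0, 0, 2, 0⟩, ⟨43721932800, 9, 0, 1, 1, 0⟩, ⟨5301284352000, 8, 0, 0, 3, 0⟩,
    ⟨131165798400, 7, 0, 2, 0, 0⟩, ⟨174887731200000, 5, 0, 0, 4, 0⟩,
    ⟨384753008640000, 3, 0, 1, 3, 0⟩, ⟨52466319360000, 1, 0, 2, 2, 0⟩,
    ⟨6995509248000000, 0, 0, 1, 4, 0⟩]⟩

def hessSP : Fin 4 → Fin 4 → SP := ![
  ![hessSP00, hessSP01, hessSP02, hessSP03],
  ![hessSP01, hessSP11, hessSP12, hessSP13],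
  ![hessSP02, hessSP12, hessSP22, hessSP23],
  ![hessSP03, hessSP13, hessSP23, hessSP33]]

/-- Up to sign, `relSP0`, `relSP1`, `relSP2` are the polynomials `q_k` divided by `5 ^ 13`, `5 ^ 8`,
`5 ^ 4`; these powers of `5` come out when `t₄` is replaced by `5 * (t₄ / 5)`. -/
def relSP0 : SP :=
  ⟨[⟨645857280000, 14, 0, 1, 6, 1⟩, ⟨77926555975680000, 13, 0, 1, 9, 0⟩,
    ⟨1695744000, 12, 0, 1, 4, 2⟩, ⟨704530907136000, 11, 0, 1, 7, 1⟩,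
    ⟨364978070618112000, 10, 0, 1, 10, 0⟩, ⟨140357350195200000, 9, 0, 3, 7, 0⟩,
    ⟨2372087808000, 9, 0, 1, 5, 2⟩, ⟨4224402157731840000, 9, 0, 0, 12, 0⟩,
    ⟨3033936955441152000, 8, 0, 2, 9, 0⟩, ⟨1529195397120000, 8, 0, 1, 8, 1⟩,
    ⟨10319400000, 7, 3, 1, 1, 0⟩, ⟨2365222809600, 7, 2, 3, 1, 0⟩, ⟨2310638400, 7, 2, 2, 0, 1⟩,
    ⟨24315553382400, 7, 1, 5, 1, 0⟩, ⟨473652264960, 7, 1, 4, 0, 1⟩,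
    ⟨1164522304862945280, 7, 1, 2, 6, 0⟩, ⟨12754400732774400, 7, 0, 7, 1, 0⟩,
    ⟨363833893355520, 7, 0, 2, 4, 2⟩, ⟨26921435428200583790592, 7, 0, 1, 11, 0⟩,
    ⟨183954615040, 7, 0, 1, 3, 3⟩, ⟨21664720, 7, 0, 0, 2, 4⟩, ⟨88476494400, 6, 2, 1, 2, 1⟩,
    ⟨7014915145728000, 6, 1, 4, 3, 0⟩, ⟨66059952537600, 6, 1, 3, 2, 1⟩,
    ⟨7712288640, 6, 1, 2, 1, 2⟩, ⟨13511610, 6, 1, 1, 0, 3⟩, ⟨1334347215667200, 6, 0, 5, 2, 1⟩,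
    ⟨310694272, 6, 0, 3, 0, 3⟩, ⟨5843006494308827136, 6, 0, 2, 7, 1⟩,
    ⟨311622528491520, 6, 0, 1, 6, 2⟩, ⟨3175200000, 5, 3, 2, 0, 0⟩,
    ⟨803329228800, 5, 2, 4, 0, 0⟩, ⟨869890594406400, 5, 2, 1, 5, 0⟩,
    ⟨487420880486400, 5, 1, 6, 0, 0⟩, ⟨221250355200, 5, 1, 1, 3, 2⟩,
    ⟨26661770589917675520, 5, 1, 0, 10, 0⟩, ⟨9263813283020800, 5, 0, 8, 0, 0⟩,
    ⟨21159587648389513216, 5, 0, 5, 5, 0⟩, ⟨105509114226933760, 5, 0, 4, 4, 1⟩,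
    ⟨35974406761464463360, 5, 0, 1, 9, 1⟩, ⟨38426080, 5, 0, 1, 1, 4⟩, ⟨12817, 5, 0, 0, 0, 5⟩,
    ⟨274654800000, 4, 3, 1, 2, 0⟩, ⟨47561897779200, 4, 2, 3, 2, 0⟩,
    ⟨11926700281036800, 4, 1, 5, 2, 0⟩, ⟨14584818769920, 4, 1, 4, 1, 1⟩,
    ⟨4786871040, 4, 1, 3, 0, 2⟩, ⟨32377639856646389760, 4, 1, 2, 7, 0⟩,
    ⟨3011443155586252800, 4, 0, 7, 2, 0⟩, ⟨2738007121920, 4, 0, 5, 0, 2⟩,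
    ⟨17587610705707008, 4, 0, 2, 5, 2⟩, ⟨735938292173119592333312, 4, 0, 1, 12, 0⟩,
    ⟨3506808642560, 4, 0, 1, 4, 3⟩, ⟨254016000000, 3, 3, 0, 4, 0⟩,
    ⟨9068501836800, 3, 2, 1, 3, 1⟩, ⟨209493820440576000, 3, 1, 4, 4, 0⟩,
    ⟨759033328435200, 3, 1, 3, 3, 1⟩, ⟨16946003055571107840, 3, 1, 1, 9, 0⟩,
    ⟨82479600, 3, 1, 1, 1, 3⟩, ⟨117480552443412480, 3, 1, 0, 8, 1⟩,
    ⟨207255376704307200, 3, 0, 5, 3, 1⟩, ⟨51315325501440, 3, 0, 4, 2, 2⟩,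
    ⟨137730561024, 3, 0, 3, 1, 3⟩, ⟨89850880286684872704, 3, 0, 2, 8, 1⟩,
    ⟨42399168, 3, 0, 2, 0, 4⟩, ⟨1061013953805686134538240, 3, 0, 0, 14, 0⟩,
    ⟨889056000000, 2, 3, 2, 1, 0⟩, ⟨44764876800, 2, 2, 3, 0, 1⟩,
    ⟨2502332227584000, 2, 2, 1, 6, 0⟩, ⟨5867065206374400, 2, 1, 6, 1, 0⟩,
    ⟨48808649549257113600, 2, 1, 3, 6, 0⟩, ⟨471857374638899200, 2, 0, 8, 1, 0⟩,
    ⟨1771115278139129856, 2, 0, 4, 5, 1⟩, ⟨11557435052687360, 2, 0, 3, 4, 2⟩,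
    ⟨155089718136001727037440, 2, 0, 2, 11, 0⟩, ⟨10791090887680, 2, 0, 2, 3, 3⟩,
    ⟨1973410030645302788096, 2, 0, 1, 10, 1⟩, ⟨6105304800, 2, 0, 1, 2, 4⟩,
    ⟨340970, 2, 0, 0, 1, 5⟩, ⟨10716300000, 1, 3, 0, 2, 1⟩, ⟨5161111603200, 1, 2, 2, 2, 1⟩,
    ⟨3061800, 1, 2, 0, 0, 3⟩, ⟨77321849536512000, 1, 1, 5, 3, 0⟩, ⟨123386941440, 1, 1, 3, 1, 2⟩,
    ⟨1151824315299840, 1, 1, 0, 6, 2⟩, ⟨26654401011646464000, 1, 0, 7, 3, 0⟩,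
    ⟨51315728056320, 1, 0, 5, 1, 2⟩, ⟨180563125679771615232, 1, 0, 3, 7, 1⟩,
    ⟨36956857755107328, 1, 0, 2, 6, 2⟩, ⟨19888873659082769170432, 1, 0, 0, 12, 1⟩,
    ⟨6378750000, 0, 4, 1, 0, 0⟩, ⟨1328140800000, 0, 3, 3, 0, 0⟩,
    ⟨281594880000000, 0, 3, 0, 5, 0⟩, ⟨280637109043200, 0, 2, 5, 0, 0⟩,
    ⟨624524863979520000, 0, 2, 2, 5, 0⟩, ⟨490002742656000, 0, 2, 1, 4, 1⟩,
    ⟨5321408400, 0, 2, 0, 3, 2⟩, ⟨24720367524249600, 0, 1, 7, 0, 0⟩,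
    ⟨39038719146252985958400, 0, 1, 1, 10, 0⟩, ⟨23030687669979709440, 0, 1, 0, 9, 1⟩,
    ⟨116235, 0, 1, 0, 1, 4⟩, ⟨673253055214387200, 0, 0, 9, 0, 0⟩,
    ⟨5765280827541815296000, 0, 0, 6, 5, 0⟩, ⟨5938607092242841600, 0, 0, 5, 4, 1⟩,
    ⟨671526726664192000000000000, 0, 0, 0, 15, 0⟩],
   [⟨5657709772800000, 14, 0, 2, 7, 0⟩, ⟨18432000, 14, 0, 0, 5, 2⟩,
    ⟨4447862784000, 13, 0, 0, 8, 1⟩, ⟨2066743296000000, 12, 0, 3, 6, 0⟩,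
    ⟨29591470080000, 12, 0, 2, 5, 1⟩, ⟨268330666033152000, 12, 0, 0, 11, 0⟩,
    ⟨127834773258240000, 11, 0, 2, 8, 0⟩, ⟨28071936000, 11, 0, 0, 6, 2⟩,
    ⟨20856176640000000, 10, 0, 4, 5, 0⟩, ⟨4246732800000, 10, 0, 3, 4, 1⟩,
    ⟨39002112000, 10, 0, 2, 3, 2⟩, ⟨3352035557376000, 10, 0, 0, 9, 1⟩,
    ⟨832234586112000, 9, 0, 2, 6, 1⟩, ⟨59904000, 9, 0, 0, 4, 3⟩,
    ⟨3774873600000000, 8, 0, 5, 4, 0⟩, ⟨54263808000000, 8, 0, 4, 3, 1⟩,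
    ⟨17541333504000, 8, 0, 0, 7, 2⟩, ⟨14175000, 7, 3, 0, 0, 1⟩, ⟨13713728716800, 7, 2, 0, 6, 0⟩,
    ⟨670033689292800, 7, 1, 1, 5, 1⟩, ⟨799425244800, 7, 1, 0, 4, 2⟩,
    ⟨28675514040320, 7, 0, 6, 0, 1⟩, ⟨97792797162992566272, 7, 0, 4, 6, 0⟩,
    ⟨130267830462709760, 7, 0, 3, 5, 1⟩, ⟨29092956484651712512, 7, 0, 0, 10, 1⟩,
    ⟨13494600000, 6, 3, 0, 3, 0⟩, ⟨123578058240000, 6, 2, 2, 3, 0⟩, ⟨102570300, 6, 2, 0, 1, 2⟩,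
    ⟨6537622820502896640, 6, 1, 1, 8, 0⟩, ⟨2189734897029120, 6, 1, 0, 7, 1⟩,
    ⟨4106514581998796800, 6, 0, 6, 3, 0⟩, ⟨1331444244480, 6, 0, 4, 1, 2⟩,
    ⟨1317652338908571107328, 6, 0, 3, 8, 0⟩, ⟨137078546697679529836544, 6, 0, 0, 13, 0⟩,
    ⟨2041977272064, 6, 0, 0, 5, 3⟩, ⟨238085568000, 5, 2, 0, 4, 1⟩,
    ⟨299743901531504640, 5, 1, 3, 5, 0⟩, ⟨226631507558400, 5, 1, 2, 4, 1⟩,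
    ⟨952106400, 5, 1, 0, 2, 3⟩, ⟨46352908943360, 5, 0, 3, 3, 2⟩,
    ⟨21409646235916668239872, 5, 0, 2, 10, 0⟩, ⟨8969945600, 5, 0, 2, 2, 3⟩,
    ⟨72057954554511360, 5, 0, 0, 8, 2⟩, ⟨520931250, 4, 3, 0, 1, 1⟩,
    ⟨166055702400, 4, 2, 2, 1, 1⟩, ⟨82243350, 4, 2, 1, 0, 2⟩, ⟨548549148672000, 4, 2, 0, 7, 0⟩,
    ⟨50789054213775360, 4, 1, 1, 6, 1⟩, ⟨26471373384960, 4, 1, 0, 5, 2⟩,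
    ⟨1207383204823040, 4, 0, 6, 1, 1⟩, ⟨1008743869709505527808, 4, 0, 4, 7, 0⟩,
    ⟨7880205474510405632, 4, 0, 3, 6, 1⟩, ⟨1478852411408143876096, 4, 0, 0, 11, 1⟩,
    ⟨2286041520, 4, 0, 0, 3, 4⟩, ⟨2767479644160000, 3, 2, 2, 4, 0⟩, ⟨4494722400, 3, 2, 0, 2, 2⟩,
    ⟨4277587345920, 3, 1, 2, 2, 2⟩, ⟨322245, 3, 1, 0, 0, 4⟩,
    ⟨202413688293320294400, 3, 0, 6, 4, 0⟩, ⟨51841601419586773712896, 3, 0, 3, 9, 0⟩,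
    ⟨55478527296208896, 3, 0, 1, 7, 2⟩, ⟨149990998931456, 3, 0, 0, 6, 3⟩,
    ⟨1389150000, 2, 3, 1, 0, 1⟩, ⟨28649521152000, 2, 2, 4, 1, 0⟩,
    ⟨9809125401600, 2, 2, 0, 5, 1⟩, ⟨9167289384960, 2, 1, 5, 0, 1⟩,
    ⟨30017716131594240, 2, 1, 2, 5, 1⟩, ⟨32757344524800, 2, 1, 1, 4, 2⟩,
    ⟨176907246726492979200, 2, 1, 0, 11, 0⟩, ⟨43391451600, 2, 1, 0, 3, 3⟩,
    ⟨737277147873280, 2, 0, 7, 0, 1⟩, ⟨9814581540493815971840, 2, 0, 5, 6, 0⟩,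
    ⟨2903885166304624640, 2, 0, 0, 9, 2⟩, ⟨6858432000000, 1, 3, 1, 3, 0⟩,
    ⟨1554598821888000, 1, 2, 3, 3, 0⟩, ⟨6228381600, 1, 2, 1, 1, 2⟩,
    ⟨26065118822400, 1, 1, 4, 2, 1⟩, ⟨326630040985298534400, 1, 1, 2, 8, 0⟩,
    ⟨424116000, 1, 1, 2, 0, 3⟩, ⟨226808122752368640, 1, 1, 1, 7, 1⟩,
    ⟨54500798968627200, 1, 0, 6, 2, 1⟩, ⟨21243189720155192033280, 1, 0, 4, 8, 0⟩,
    ⟨48800704512, 1, 0, 4, 0, 3⟩, ⟨12728879141812972269076480, 1, 0, 1, 13, 0⟩,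
    ⟨322989300678656, 1, 0, 1, 5, 3⟩, ⟨147730305280, 1, 0, 0, 4, 4⟩,
    ⟨19858445932953600000, 0, 1, 4, 5, 0⟩, ⟨140531893125120000, 0, 1, 3, 4, 1⟩,
    ⟨159612409958400, 0, 1, 2, 3, 2⟩, ⟨36988086240, 0, 1, 1, 2, 3⟩,
    ⟨4022559186944000, 0, 0, 4, 3, 2⟩, ⟨363414498567567399976960, 0, 0, 3, 10, 0⟩,
    ⟨3262840555520, 0, 0, 3, 2, 3⟩, ⟨6737293388990073798656, 0, 0, 2, 9, 1⟩,
    ⟨1914094784, 0, 0, 2, 1, 4⟩, ⟨7004898366788861952, 0, 0, 1, 8, 2⟩, ⟨535388, 0, 0, 1, 0, 5⟩,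
    ⟨2185819819954176, 0, 0, 0, 7, 3⟩]⟩

def relSP1 : SP :=
  ⟨[⟨390758400, 7, 1, 2, 1, 0⟩, ⟨49684152320, 7, 0, 4, 1, 0⟩, ⟨23727634120704, 7, 0, 1, 6, 0⟩,
    ⟨2938337280, 6, 0, 2, 2, 1⟩, ⟨1849728, 6, 0, 1, 1, 2⟩, ⟨213811200, 5, 1, 3, 0, 0⟩,
    ⟨35383910400, 5, 1, 0, 5, 0⟩, ⟨23805501440, 5, 0, 1, 4, 1⟩, ⟨6495436800, 4, 1, 2, 2, 0⟩,
    ⟨3465061335040, 4, 0, 4, 2, 0⟩, ⟨576672506576896, 4, 0, 1, 7, 0⟩,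
    ⟨31028428800, 3, 1, 1, 4, 0⟩, ⟨94809600, 3, 1, 0, 3, 1⟩, ⟨10504765440, 3, 0, 2, 3, 1⟩,
    ⟨1324219912683520, 3, 0, 0, 9, 0⟩, ⟨26025984000, 2, 1, 3, 1, 0⟩,
    ⟨939503124480, 2, 0, 5, 1, 0⟩, ⟨24078309130240, 2, 0, 2, 6, 0⟩,
    ⟨1974549643264, 2, 0, 1, 5, 1⟩, ⟨514800, 1, 1, 0, 1, 2⟩, ⟨20258698035200, 1, 0, 4, 3, 0⟩,
    ⟨26784, 1, 0, 1, 0, 3⟩, ⟨18293963227136, 1, 0, 0, 7, 1⟩, ⟨337500, 0, 3, 0, 0, 0⟩,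
    ⟨246240000, 0, 2, 2, 0, 0⟩, ⟨14587084800, 0, 1, 4, 0, 0⟩, ⟨43585671168000, 0, 1, 1, 5, 0⟩,
    ⟨27743788800, 0, 1, 0, 4, 1⟩, ⟨22885171200, 0, 0, 6, 0, 0⟩,
    ⟨272079624601600, 0, 0, 3, 5, 0⟩, ⟨1140850688000000000, 0, 0, 0, 10, 0⟩],
   [⟨237600, 7, 1, 1, 0, 1⟩, ⟨26585088, 7, 0, 3, 0, 1⟩, ⟨17665396736, 7, 0, 0, 5, 1⟩,
    ⟨3419136000, 6, 1, 1, 3, 0⟩, ⟨3938400, 6, 1, 0, 2, 1⟩, ⟨680538931200, 6, 0, 3, 3, 0⟩,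
    ⟨169322918182912, 6, 0, 0, 8, 0⟩, ⟨42, 6, 0, 0, 0, 3⟩, ⟨8650752000, 5, 0, 5, 0, 0⟩,
    ⟨15719206486016, 5, 0, 2, 5, 0⟩, ⟨52711680, 5, 0, 0, 3, 2⟩, ⟨21168000, 4, 1, 1, 1, 1⟩,
    ⟨3825, 4, 1, 0, 0, 2⟩, ⟨2022957056, 4, 0, 3, 1, 1⟩, ⟨211392, 4, 0, 2, 0, 2⟩,
    ⟨1343351902208, 4, 0, 0, 6, 1⟩, ⟨23591455293440, 3, 0, 3, 4, 0⟩, ⟨42008064, 3, 0, 1, 2, 2⟩,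
    ⟨80368, 3, 0, 0, 1, 3⟩, ⟨40665600, 2, 1, 2, 0, 1⟩, ⟨264259584000, 2, 1, 0, 6, 0⟩,
    ⟨1467973632, 2, 0, 4, 0, 1⟩, ⟨2594851840, 2, 0, 0, 4, 2⟩, ⟨43794432000, 1, 1, 2, 3, 0⟩,
    ⟨261043200, 1, 1, 1, 2, 1⟩, ⟨32478003200, 1, 0, 3, 2, 1⟩, ⟨15854592, 1, 0, 2, 1, 2⟩,
    ⟨11708136465367040, 1, 0, 1, 8, 0⟩, ⟨9083091927040, 0, 0, 2, 4, 1⟩,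
    ⟨8418570240, 0, 0, 1, 3, 2⟩, ⟨2188368, 0, 0, 0, 2, 3⟩]⟩

def relSP2 : SP :=
  ⟨[⟨32, 7, 0, 0, 1, 1⟩, ⟨3860992, 6, 0, 0, 4, 0⟩, ⟨24368, 4, 0, 0, 2, 1⟩,
    ⟨1187840, 2, 0, 2, 2, 0⟩, ⟨52, 2, 0, 0, 0, 2⟩, ⟨208240640, 1, 0, 1, 4, 0⟩],
   [⟨560640, 7, 0, 1, 2, 0⟩, ⟨102400, 5, 0, 2, 1, 0⟩, ⟨1472, 5, 0, 1, 0, 1⟩,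
    ⟨7038976, 4, 0, 1, 3, 0⟩, ⟨1024000, 3, 0, 3, 0, 0⟩, ⟨30392320, 3, 0, 0, 5, 0⟩,
    ⟨27136, 2, 0, 1, 1, 1⟩, ⟨325376, 1, 0, 0, 3, 1⟩, ⟨950400, 0, 1, 1, 1, 0⟩,
    ⟨675, 0, 1, 0, 0, 1⟩, ⟨123412480, 0, 0, 3, 1, 0⟩, ⟨37568, 0, 0, 2, 0, 1⟩,
    ⟨72089600000, 0, 0, 0, 6, 0⟩]⟩

def relSP : Fin 3 → SP := ![relSP0, relSP1, relSP2]

def relWt : Fin 3 → ℕ := ![45, 30, 18]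

def tWt : Fin 4 → ℕ := ![10, 8, 5, 3]

/-- The position of `t i` among the variables. -/
def tVar : Fin 4 → Fin 5 := ![1, 4, 2, 3]

def tEx (i : Fin 4) : Ex :=
  .leaf (tWt i) (![⟨[⟨1, 0, 1, 0, 0, 0⟩], []⟩, ⟨[⟨1, 0, 0, 0, 0, 1⟩], []⟩, ⟨[⟨1, 0, 0, 1, 0, 0⟩], []⟩,
    ⟨[⟨1, 0, 0, 0, 1, 0⟩], []⟩] i)

def branchDZ : Ex := .leaf 7 (branchSP.deriv 0)

def tWeights : Weights := ⟨10, 5, 3, 8⟩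

/-- The derivative with respect to `t i` of a polynomial of weight `w` on the hypersurface
`branchSP = 0`, multiplied by `branchDZ`. -/
def tangentD (i : Fin 4) (w : ℕ) (p : SP) : Ex :=
  -- The relation `P` does not contain `t₁`, so the second term is absent. The case is separate
  -- because `8 - 10` would be truncated and break the bookkeeping of weights.
  if i = 0 then .mul (.leaf (w - 10) (p.deriv 1)) branchDZ
  else .sub (.mul (.leaf (w - tWt i) (p.deriv (tVar i))) branchDZ)
    (.mul (.leaf (w - 1) (p.deriv 0)) (.leaf (8 - tWt i) (branchSP.deriv (tVar i))))

def sumEx (f : Fin 4 → Ex) : Ex := .add (.add (.add (f 0) (f 1)) (f 2)) (f 3)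

/-- On the hypersurface the implicit derivative is divisible by `∂P/∂Z`, so the gradient of `F` is
again polynomial in `Z` and `t`. The same happens for the second derivatives in `hessSP_check`. -/
theorem gradSP_check : ∀ k, (Ex.sub (tangentD k 23 potentialSP)
    (.mul branchDZ (.leaf (23 - tWt k) (gradSP k)))).vanishes tWeights rootSP 128 = true := by
  decide +kernel

theorem hessSP_check : ∀ j k, (Ex.sub (tangentD j (23 - tWt k) (gradSP k))
    (.mul branchDZ (.leaf (23 - tWt k - tWt j) (hessSP j k)))).vanishes tWeights rootSP 128
      = true := by
  decide +kernel

/-- Euler's relation: `F` has degree `3 - d = 23 / 10`, and all weights are ten times the degrees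
for `E`. -/
theorem eulerGradSP_check : ∀ k,
    (Ex.sub (sumEx fun l => .mul (.nat (tWt l)) (.mul (tEx l)
        (.leaf (23 - tWt k - tWt l) (hessSP k l))))
      (.mul (.nat (23 - tWt k)) (.leaf (23 - tWt k) (gradSP k)))).vanishes tWeights rootSP 128
      = true := by
  decide +kernel

/-- The weights `45, 30, 18` are `10 * (3 / 20)` times the degrees `30, 20, 12` of the invariants,
because `E` scales `x` with exponent `(1 - d) / 2 = 3 / 20`. -/
theorem eulerRelSP_check : ∀ k,
    (Ex.sub (sumEx fun l => .mul (.nat (tWt l)) (.mul (tEx l) (tangentD l (relWt k) (relSP k))))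
      (.mul (.nat (relWt k)) (.mul branchDZ (.leaf (relWt k) (relSP k))))).vanishes
        tWeights rootSP 160 = true := by
  decide +kernel

def dualScale : Fin 4 → ℕ := ![1, 5, 5, 1]

/-- A multiple of the intersection form. -/
def formEx (i j : Fin 4) : Ex :=
  .mul (.nat ((tWt i + tWt j - 3) * dualScale i * dualScale j))
    (.leaf (23 - tWt i.rev - tWt j.rev) (hessSP i.rev j.rev))

def relFormEx (k l : Fin 3) : Ex :=
  sumEx fun i => .mul (tangentD i (relWt k) (relSP k))
    (sumEx fun j => .mul (formEx i j) (tangentD j (relWt l) (relSP l)))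

def relEx (k : Fin 3) : Ex := .leaf (relWt k) (relSP k)

def t4Ex (k c : ℕ) : Ex := .leaf (3 * k) ⟨[⟨c, 0, 0, 0, k, 0⟩], []⟩

/-- The expressions `relGramEx` are the entries of `gramMatrix` rewritten by `y_k = relCoeff k *
relSP k` and `y_4 = 200 / 3 * (t₄ / 5)`. The constants collect these factors together with the
multiple `4803435000` of the intersection form in `formEx`. -/
def relGramEx00 : Ex :=
  .add (.add (.add (.mul (relEx 0) (.mul (relEx 1) (t4Ex 4 50200430192640000000)))
      (.mul (relEx 0) (.mul (relEx 2) (.mul (relEx 2) (t4Ex 2 13073028696000000)))))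
      (.mul (relEx 1) (.mul (relEx 1) (.mul (relEx 2) (t4Ex 3 164720161569600000)))))
      (.mul (relEx 1) (.mul (relEx 2) (.mul (relEx 2) (.mul (relEx 2) (t4Ex 1 92146695322500)))))

def relGramEx01 : Ex :=
  .sub (.mul (relEx 1) (.mul (relEx 1) (t4Ex 4 15060129057792000000)))
    (.add (.add (.mul (relEx 0) (.mul (relEx 2) (t4Ex 3 1195248337920000000)))
      (.mul (relEx 1) (.mul (relEx 2) (.mul (relEx 2) (t4Ex 2 6100746724800000)))))
      (.mul (relEx 2) (.mul (relEx 2) (.mul (relEx 2) (.mul (relEx 2) (t4Ex 0 302616405000))))))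

def relGramEx02 : Ex :=
  .neg (.add (.add (.add (.mul (relEx 0) (t4Ex 5 2294876808806400000000))
      (.mul (relEx 1) (.mul (relEx 1) (t4Ex 0 181569843000))))
      (.mul (relEx 1) (.mul (relEx 2) (t4Ex 4 5020043019264000000))))
      (.mul (relEx 2) (.mul (relEx 2) (.mul (relEx 2) (t4Ex 2 290511748800000)))))

def relGramEx11 : Ex :=
  .sub (.add (.mul (relEx 0) (t4Ex 4 36426616012800000000))
      (.mul (relEx 2) (.mul (relEx 2) (.mul (relEx 2) (t4Ex 1 87614654400000)))))
    (.mul (relEx 1) (.mul (relEx 2) (t4Ex 3 557782557696000000)))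

def relGramEx12 : Ex :=
  .sub (.mul (relEx 2) (.mul (relEx 2) (t4Ex 3 79683222528000000)))
    (.add (.mul (relEx 0) (t4Ex 0 395254080000))
      (.mul (relEx 1) (t4Ex 5 1376926085283840000000)))

def relGramEx22 : Ex :=
  .sub (.mul (relEx 1) (t4Ex 1 18260738496000))
    (.mul (relEx 2) (t4Ex 5 458975361761280000000))

/-- Each of the two gradients carries one factor `∂P/∂Z`, hence the square on the right. The digit
width must exceed the size of the coefficients, which is why it varies with the weight of the entry
in the six checks. -/
theorem relForm_check00 : (Ex.sub (relFormEx 0 0) (.mul branchDZ.sq relGramEx00)).vanishes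
    tWeights rootSP 420 = true := by
  decide +kernel

theorem relForm_check01 : (Ex.sub (relFormEx 0 1) (.mul branchDZ.sq relGramEx01)).vanishes
    tWeights rootSP 360 = true := by
  decide +kernel

theorem relForm_check02 : (Ex.sub (relFormEx 0 2) (.mul branchDZ.sq relGramEx02)).vanishes
    tWeights rootSP 320 = true := by
  decide +kernel

theorem relForm_check11 : (Ex.sub (relFormEx 1 1) (.mul branchDZ.sq relGramEx11)).vanishes
    tWeights rootSP 320 = true := by
  decide +kernel

theorem relForm_check12 : (Ex.sub (relFormEx 1 2) (.mul branchDZ.sq relGramEx12)).vanishes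
    tWeights rootSP 280 = true := by
  decide +kernel

theorem relForm_check22 : (Ex.sub (relFormEx 2 2) (.mul branchDZ.sq relGramEx22)).vanishes
    tWeights rootSP 240 = true := by
  decide +kernel

end H47

/-! ### Explicit polynomials and certificates on the invariant side. -/

namespace H47

open SparsePoly

/-! The invariants, up to a constant factor, as polynomials in `h₂, x₁², h₆, h₁₀` of weights
`1, 1, 3, 5`. -/

/-- The three polynomials are `15 y_1`, `2 y_2` and `2 y_3`, the multiples that clear denominators.
-/
def invSP0 : SP :=
  ⟨[⟨160, 12, 3, 0, 0, 0⟩, ⟨4032, 10, 5, 0, 0, 0⟩, ⟨1800, 9, 3, 1, 0, 0⟩, ⟨4080, 8, 7, 0, 0, 0⟩,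
    ⟨240, 8, 2, 0, 1, 0⟩, ⟨4080, 7, 8, 0, 0, 0⟩, ⟨24120, 7, 5, 1, 0, 0⟩, ⟨32160, 6, 4, 0, 1, 0⟩,
    ⟨19980, 6, 3, 2, 0, 0⟩, ⟨4032, 5, 10, 0, 0, 0⟩, ⟨900, 5, 2, 1, 1, 0⟩,
    ⟨18720, 4, 8, 1, 0, 0⟩, ⟨213240, 4, 6, 0, 1, 0⟩, ⟨299520, 4, 5, 2, 0, 0⟩,
    ⟨1260, 4, 2, 3, 0, 0⟩, ⟨120, 4, 1, 0, 2, 0⟩, ⟨160, 3, 12, 0, 0, 0⟩, ⟨163620, 3, 4, 1, 1, 0⟩,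
    ⟨4320, 3, 3, 3, 0, 0⟩, ⟨10080, 2, 10, 1, 0, 0⟩, ⟨150360, 2, 8, 0, 1, 0⟩,
    ⟨278820, 2, 7, 2, 0, 0⟩, ⟨17520, 2, 3, 0, 2, 0⟩, ⟨6120, 2, 2, 2, 1, 0⟩,
    ⟨2025, 2, 1, 4, 0, 0⟩, ⟨352620, 1, 6, 1, 1, 0⟩, ⟨110250, 1, 5, 3, 0, 0⟩,
    ⟨5400, 0, 10, 0, 1, 0⟩, ⟨16200, 0, 9, 2, 0, 0⟩, ⟨48600, 0, 5, 0, 2, 0⟩,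
    ⟨35910, 0, 3, 4, 0, 0⟩, ⟨5220, 0, 2, 1, 2, 0⟩, ⟨27, 0, 0, 5, 0, 0⟩, ⟨20, 0, 0, 0, 3, 0⟩],
   [⟨1200, 11, 4, 0, 0, 0⟩, ⟨6640, 9, 6, 0, 0, 0⟩, ⟨10080, 8, 4, 1, 0, 0⟩,
    ⟨5160, 7, 3, 0, 1, 0⟩, ⟨1260, 7, 2, 2, 0, 0⟩, ⟨6640, 6, 9, 0, 0, 0⟩, ⟨18720, 6, 6, 1, 0, 0⟩,
    ⟨107400, 5, 5, 0, 1, 0⟩, ⟨103860, 5, 4, 2, 0, 0⟩, ⟨90, 5, 1, 3, 0, 0⟩,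
    ⟨1200, 4, 11, 0, 0, 0⟩, ⟨32580, 4, 3, 1, 1, 0⟩, ⟨24120, 3, 9, 1, 0, 0⟩,
    ⟨252840, 3, 7, 0, 1, 0⟩, ⟨410940, 3, 6, 2, 0, 0⟩, ⟨2280, 3, 2, 0, 2, 0⟩,
    ⟨630, 3, 1, 2, 1, 0⟩, ⟨379980, 2, 5, 1, 1, 0⟩, ⟨29340, 2, 4, 3, 0, 0⟩,
    ⟨1800, 1, 11, 1, 0, 0⟩, ⟨43200, 1, 9, 0, 1, 0⟩, ⟨84420, 1, 8, 2, 0, 0⟩,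
    ⟨48480, 1, 4, 0, 2, 0⟩, ⟨28620, 1, 3, 2, 1, 0⟩, ⟨13635, 1, 2, 4, 0, 0⟩, ⟨45, 1, 0, 3, 1, 0⟩,
    ⟨114300, 0, 7, 1, 1, 0⟩, ⟨86940, 0, 6, 3, 0, 0⟩, ⟨13590, 0, 4, 2, 1, 0⟩,
    ⟨1305, 0, 1, 3, 1, 0⟩]⟩

def invSP1 : SP :=
  ⟨[⟨8, 8, 2, 0, 0, 0⟩, ⟨88, 6, 4, 0, 0, 0⟩, ⟨60, 5, 2, 1, 0, 0⟩, ⟨88, 4, 6, 0, 0, 0⟩,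
    ⟨8, 4, 1, 0, 1, 0⟩, ⟨804, 3, 4, 1, 0, 0⟩, ⟨8, 2, 8, 0, 0, 0⟩, ⟨592, 2, 3, 0, 1, 0⟩,
    ⟨336, 2, 2, 2, 0, 0⟩, ⟨276, 1, 6, 1, 0, 0⟩, ⟨360, 0, 5, 0, 1, 0⟩, ⟨588, 0, 4, 2, 0, 0⟩,
    ⟨57, 0, 1, 3, 0, 0⟩, ⟨2, 0, 0, 0, 2, 0⟩],
   [⟨40, 7, 3, 0, 0, 0⟩, ⟨88, 5, 5, 0, 0, 0⟩, ⟨276, 4, 3, 1, 0, 0⟩, ⟨40, 3, 7, 0, 0, 0⟩,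
    ⟨152, 3, 2, 0, 1, 0⟩, ⟨42, 3, 1, 2, 0, 0⟩, ⟨804, 2, 5, 1, 0, 0⟩, ⟨928, 1, 4, 0, 1, 0⟩,
    ⟨612, 1, 3, 2, 0, 0⟩, ⟨3, 1, 0, 3, 0, 0⟩, ⟨60, 0, 7, 1, 0, 0⟩, ⟨228, 0, 2, 1, 1, 0⟩]⟩

def invSP2 : SP :=
  ⟨[⟨12, 4, 2, 0, 0, 0⟩, ⟨12, 2, 4, 0, 0, 0⟩, ⟨66, 0, 3, 1, 0, 0⟩, ⟨22, 0, 1, 0, 1, 0⟩,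
    ⟨3, 0, 0, 2, 0, 0⟩],
   [⟨4, 5, 1, 0, 0, 0⟩, ⟨28, 3, 3, 0, 0, 0⟩, ⟨4, 1, 5, 0, 0, 0⟩, ⟨66, 1, 2, 1, 0, 0⟩,
    ⟨2, 1, 0, 0, 1, 0⟩]⟩

def invSP : Fin 3 → SP := ![invSP0, invSP1, invSP2]

def invWt : Fin 3 → ℕ := ![15, 10, 6]

def hWt : Fin 4 → ℕ := ![1, 1, 3, 5]

def hVar : Fin 4 → Fin 5 := ![0, 1, 2, 3]

/-- The last weight is a dummy: there are only four variables, and the fifth is replaced by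
`zeroSP`. -/
def hWeights : Weights := ⟨1, 3, 5, 1⟩

def zeroSP : SP := ⟨[], []⟩

/-- The products of the gradients of `h₂, x₁², h₆, h₁₀`. -/
def gramHSP : Fin 4 → Fin 4 → SP :=
  ![![⟨[⟨4, 1, 0, 0, 0, 0⟩], []⟩, zeroSP, ⟨[⟨12, 0, 0, 1, 0, 0⟩], []⟩,
      ⟨[⟨20, 0, 0, 0, 1, 0⟩], []⟩],
    ![zeroSP, ⟨[⟨4, 0, 1, 0, 0, 0⟩], []⟩, zeroSP, zeroSP],
    ![⟨[⟨12, 0, 0, 1, 0, 0⟩], []⟩, zeroSP, ⟨[⟨8, 0, 0, 0, 1, 0⟩, ⟨8, 2, 0, 1, 0, 0⟩], []⟩,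
      ⟨[⟨28, 1, 0, 2, 0, 0⟩, ⟨8, 4, 0, 1, 0, 0⟩], []⟩],
    ![⟨[⟨20, 0, 0, 0, 1, 0⟩], []⟩, zeroSP, ⟨[⟨28, 1, 0, 2, 0, 0⟩, ⟨8, 4, 0, 1, 0, 0⟩], []⟩,
      ⟨[⟨30, 0, 0, 3, 0, 0⟩, ⟨36, 3, 0, 2, 0, 0⟩, ⟨8, 4, 0, 0, 1, 0⟩], []⟩]]

def invDEx (k : Fin 3) (i : Fin 4) : Ex := .leaf (invWt k - hWt i) ((invSP k).deriv (hVar i))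

def gramHEx (i j : Fin 4) : Ex := .leaf (hWt i + hWt j - 1) (gramHSP i j)

def invFormEx (k l : Fin 3) : Ex :=
  sumEx fun i => .mul (invDEx k i) (sumEx fun j => .mul (gramHEx i j) (invDEx l j))

def invEx (k : Fin 3) : Ex := .leaf (invWt k) (invSP k)

/-- `c * (x₁² + h₂) ^ k`. -/
def y4Ex (c : ℕ) : ℕ → Ex
  | 0 => .nat c
  | k + 1 => .mul (.leaf 1 ⟨[⟨1, 1, 0, 0, 0, 0⟩, ⟨1, 0, 1, 0, 0, 0⟩], []⟩) (y4Ex c k)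

def hEx (i : Fin 4) : Ex :=
  .leaf (hWt i) (![⟨[⟨1, 1, 0, 0, 0, 0⟩], []⟩, ⟨[⟨1, 0, 1, 0, 0, 0⟩], []⟩,
    ⟨[⟨1, 0, 0, 1, 0, 0⟩], []⟩, ⟨[⟨1, 0, 0, 0, 1, 0⟩], []⟩] i)

theorem eulerInvSP_check : ∀ k,
    (Ex.sub (sumEx fun i => .mul (.nat (hWt i)) (.mul (hEx i) (invDEx k i)))
      (.mul (.nat (invWt k)) (invEx k))).vanishes hWeights zeroSP 64 = true := by
  decide +kernel

def invGramEx00 : Ex :=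
  .add (.add (.add (.mul (invEx 0) (.mul (invEx 1) (y4Ex 1200 4)))
      (.mul (invEx 0) (.mul (invEx 2) (.mul (invEx 2) (y4Ex 900 2)))))
      (.mul (invEx 1) (.mul (invEx 1) (.mul (invEx 2) (y4Ex 2700 3)))))
      (.mul (invEx 1) (.mul (invEx 2) (.mul (invEx 2) (.mul (invEx 2) (y4Ex 4350 1)))))

theorem invForm_check00 : (Ex.sub (.mul (.nat 1) (invFormEx 0 0)) invGramEx00).vanishes
    hWeights zeroSP 128 = true := by
  decide +kernel

def invGramEx01 : Ex :=
  .sub (.mul (invEx 1) (.mul (invEx 1) (y4Ex 360 4)))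
    (.add (.add (.mul (invEx 0) (.mul (invEx 2) (y4Ex 120 3)))
      (.mul (invEx 1) (.mul (invEx 2) (.mul (invEx 2) (y4Ex 420 2)))))
      (.mul (invEx 2) (.mul (invEx 2) (.mul (invEx 2) (.mul (invEx 2) (y4Ex 60 0))))))

theorem invForm_check01 : (Ex.sub (.mul (.nat 1) (invFormEx 0 1)) invGramEx01).vanishes
    hWeights zeroSP 128 = true := by
  decide +kernel

def invGramEx02 : Ex :=
  .neg (.add (.add (.add (.mul (invEx 0) (y4Ex 80 5))
      (.mul (invEx 1) (.mul (invEx 1) (y4Ex 600 0))))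
      (.mul (invEx 1) (.mul (invEx 2) (y4Ex 120 4))))
      (.mul (invEx 2) (.mul (invEx 2) (.mul (invEx 2) (y4Ex 20 2)))))

theorem invForm_check02 : (Ex.sub (.mul (.nat 1) (invFormEx 0 2)) invGramEx02).vanishes
    hWeights zeroSP 128 = true := by
  decide +kernel

def invGramEx11 : Ex :=
  .sub (.add (.mul (invEx 0) (y4Ex 16 4))
      (.mul (invEx 2) (.mul (invEx 2) (.mul (invEx 2) (y4Ex 76 1)))))
    (.mul (invEx 1) (.mul (invEx 2) (y4Ex 168 3)))

/-- The factor `3` clears the coefficient `152 / 3` of `gramMatrix`. The other entries are integral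
after the scaling of the invariants. -/
theorem invForm_check11 : (Ex.sub (.mul (.nat 3) (invFormEx 1 1)) invGramEx11).vanishes
    hWeights zeroSP 128 = true := by
  decide +kernel

def invGramEx12 : Ex :=
  .sub (.mul (invEx 2) (.mul (invEx 2) (y4Ex 8 3)))
    (.add (.mul (invEx 0) (y4Ex 8 0))
      (.mul (invEx 1) (y4Ex 48 5)))

theorem invForm_check12 : (Ex.sub (.mul (.nat 1) (invFormEx 1 2)) invGramEx12).vanishes
    hWeights zeroSP 128 = true := by
  decide +kernel

def invGramEx22 : Ex :=
  .sub (.mul (invEx 1) (y4Ex 88 1))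
    (.mul (invEx 2) (y4Ex 16 5))

theorem invForm_check22 : (Ex.sub (.mul (.nat 1) (invFormEx 2 2)) invGramEx22).vanishes
    hWeights zeroSP 128 = true := by
  decide +kernel

end H47

/-! ### Analyticity and derivatives of sparse polynomials. -/

namespace SparsePoly

theorem Mono.den_vec {A : Type*} [CommSemiring A] (c e₀ e₁ e₂ e₃ e₄ : ℕ) (z x y w a : A) :
    Mono.den ⟨c, e₀, e₁, e₂, e₃, e₄⟩ ![z, x, y, w, a] =
      c * z ^ e₀ * x ^ e₁ * y ^ e₂ * w ^ e₃ * a ^ e₄ := rfl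

theorem Mono.analyticAt {m : Mono} {E : Type*} [NormedAddCommGroup E] [NormedSpace ℂ E]
    {v : E → Fin 5 → ℂ} {t : E} (hv : ∀ i, AnalyticAt ℂ (fun s => v s i) t) :
    AnalyticAt ℂ (fun s => m.den (v s)) t := by
  have := hv 0
  have := hv 1
  have := hv 2
  have := hv 3
  have := hv 4
  unfold Mono.den
  fun_prop

theorem listDen_analyticAt (l : List Mono) {E : Type*} [NormedAddCommGroup E] [NormedSpace ℂ E]
    {v : E → Fin 5 → ℂ} {t : E} (hv : ∀ i, AnalyticAt ℂ (fun s => v s i) t) :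
    AnalyticAt ℂ (fun s => listDen l (v s)) t := by
  induction l with
  | nil => exact analyticAt_const
  | cons m l ih => exact (Mono.analyticAt hv).add ih

theorem SP.analyticAt (p : SP) {E : Type*} [NormedAddCommGroup E] [NormedSpace ℂ E]
    {v : E → Fin 5 → ℂ} {t : E} (hv : ∀ i, AnalyticAt ℂ (fun s => v s i) t) :
    AnalyticAt ℂ (fun s => p.den (v s)) t :=
  (listDen_analyticAt _ hv).sub (listDen_analyticAt _ hv)

theorem Mono.hasFDerivAt (m : Mono) {E : Type*} [NormedAddCommGroup E] [NormedSpace ℂ E]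
    {v : E → Fin 5 → ℂ} {v' : Fin 5 → E →L[ℂ] ℂ} {t : E}
    (hv : ∀ i, HasFDerivAt (fun s => v s i) (v' i) t) :
    HasFDerivAt (fun s => m.den (v s)) (∑ i, (m.deriv i).den (v t) • v' i) t := by
  have h := ((((((hv 0).pow m.e₀).const_mul (m.c : ℂ)).mul ((hv 1).pow m.e₁)).mul
    ((hv 2).pow m.e₂)).mul ((hv 3).pow m.e₃)).mul ((hv 4).pow m.e₄)
  refine h.congr_fderiv ?_
  ext x
  simp [Fin.sum_univ_five, Mono.deriv, Mono.den]
  ring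

theorem listDen_hasFDerivAt (l : List Mono) {E : Type*} [NormedAddCommGroup E] [NormedSpace ℂ E]
    {v : E → Fin 5 → ℂ} {v' : Fin 5 → E →L[ℂ] ℂ} {t : E}
    (hv : ∀ i, HasFDerivAt (fun s => v s i) (v' i) t) :
    HasFDerivAt (fun s => listDen l (v s)) (∑ i, listDen (l.map (Mono.deriv i)) (v t) • v' i) t := by
  induction l with
  | nil => exact (hasFDerivAt_const (0 : ℂ) t).congr_fderiv (by ext; simp [listDen])
  | cons m l ih =>
    refine ((m.hasFDerivAt hv).add ih).congr_fderiv ?_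
    ext x
    simp [listDen, add_mul, Finset.sum_add_distrib]

theorem SP.hasFDerivAt (p : SP) {E : Type*} [NormedAddCommGroup E] [NormedSpace ℂ E]
    {v : E → Fin 5 → ℂ} {v' : Fin 5 → E →L[ℂ] ℂ} {t : E}
    (hv : ∀ i, HasFDerivAt (fun s => v s i) (v' i) t) :
    HasFDerivAt (fun s => p.den (v s)) (∑ i, (p.deriv i).den (v t) • v' i) t := by
  refine ((listDen_hasFDerivAt p.pos hv).sub (listDen_hasFDerivAt p.neg hv)).congr_fderiv ?_
  ext x
  simp [SP.den, SP.deriv, sub_mul, Finset.sum_sub_distrib]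

end SparsePoly

/-! ### Implicit differentiation on the branch and the derivatives of the prepotential. -/

namespace H47

open SparsePoly

theorem pd_den (p : SP) {v : (Fin 4 → ℂ) → Fin 5 → ℂ} {t : Fin 4 → ℂ}
    (hv : ∀ i, DifferentiableAt ℂ (fun s => v s i) t) (j : Fin 4) :
    pd j (fun s => p.den (v s)) t = ∑ i, (p.deriv i).den (v t) * pd j (fun s => v s i) t := by
  have h := (p.hasFDerivAt fun i => (hv i).hasFDerivAt).fderiv
  rw [pd, h]
  simp [pd]

theorem pd_coord (i j : Fin 4) (t : Fin 4 → ℂ) :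
    pd j (fun s => s i) t = if i = j then 1 else 0 := by
  rw [pd, (hasFDerivAt_apply i t).fderiv]
  simp [Pi.single_apply]

theorem pd_const_mul (c : ℂ) {f : (Fin 4 → ℂ) → ℂ} {t : Fin 4 → ℂ} (j : Fin 4) :
    pd j (fun s => c * f s) t = c * pd j f t := by
  have h : fderiv ℂ (c • f) t = c • fderiv ℂ f t :=
    congrFun (fderiv_const_smul_field c) t
  exact congrArg (fun L : (Fin 4 → ℂ) →L[ℂ] ℂ => L (Pi.single j 1)) h

theorem pd_congr {f g : (Fin 4 → ℂ) → ℂ} {U : Set (Fin 4 → ℂ)} (hU : IsOpen U)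
    (h : ∀ s ∈ U, f s = g s) {t : Fin 4 → ℂ} (ht : t ∈ U) (j : Fin 4) : pd j f t = pd j g t := by
  rw [pd, pd, Filter.EventuallyEq.fderiv_eq (Filter.mem_of_superset (hU.mem_nhds ht) h)]

/-- The values of the variables `Z, t₁, t₃, t₄ / 5, t₂`. -/
noncomputable def vars (Z : (Fin 4 → ℂ) → ℂ) (t : Fin 4 → ℂ) : Fin 5 → ℂ :=
  ![Z t, t 0, t 2, t 3 / 5, t 1]

/-- The derivatives of the variables `t₁, t₂, t₃, t₄ / 5` with respect to `t`. -/
noncomputable def tScale : Fin 4 → ℂ := ![1, 1, 1, 1 / 5]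

section Branch

variable {U : Set (Fin 4 → ℂ)} {Z : (Fin 4 → ℂ) → ℂ}

theorem branchSP_den (t : Fin 4 → ℂ) :
    branchSP.den (vars Z t) = P (t 1) (t 2) (t 3) (Z t) := by
  simp only [vars, branchSP, rootSP, SP.den, listDen, Mono.den_vec, P]
  push_cast
  ring

/-- `P` is linear in `t₂`, so the hypersurface is the graph of `rootSP` over the free variables `Z,
t₁, t₃, t₄ / 5`. Identities on the branch thereby become identities in a polynomial ring. -/
theorem vars_eq_point (hZ : IsBranch U Z) {t : Fin 4 → ℂ} (ht : t ∈ U) :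
    vars Z t = rootSP.point ![Z t, t 0, t 2, t 3 / 5] := by
  have h := hZ.2.2 t ht
  rw [← branchSP_den] at h
  simp only [vars, branchSP, rootSP, SP.den, listDen, Mono.den_vec, SP.point] at h ⊢
  funext i
  fin_cases i
  · rfl
  · rfl
  · rfl
  · rfl
  · simp at h ⊢
    linear_combination -h

theorem vars_analyticAt (hZ : IsBranch U Z) {t : Fin 4 → ℂ} (ht : t ∈ U) (i : Fin 5) :
    AnalyticAt ℂ (fun s => vars Z s i) t := by
  have h : ∀ i : Fin 4, AnalyticAt ℂ (fun s : Fin 4 → ℂ => s i) t := fun i =>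
    (ContinuousLinearMap.proj (R := ℂ) (φ := fun _ : Fin 4 => ℂ) i).analyticAt t
  fin_cases i
  · exact hZ.2.1 t ht
  · exact h 0
  · exact h 2
  · exact (h 3).div_const
  · exact h 1

theorem den_vars_analyticAt (hZ : IsBranch U Z) (p : SP) {t : Fin 4 → ℂ} (ht : t ∈ U) :
    AnalyticAt ℂ (fun s => p.den (vars Z s)) t := p.analyticAt (vars_analyticAt hZ ht)

theorem pd_vars (hZ : IsBranch U Z) (p : SP) {t : Fin 4 → ℂ} (ht : t ∈ U) (j : Fin 4) :
    pd j (fun s => p.den (vars Z s)) t = (p.deriv 0).den (vars Z t) * pd j Z t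
      + tScale j * (p.deriv (tVar j)).den (vars Z t) := by
  rw [pd_den p (fun i => (vars_analyticAt hZ ht i).differentiableAt), Fin.sum_univ_five]
  have h0 : pd j (fun s => vars Z s 0) t = pd j Z t := rfl
  have h1 : pd j (fun s => vars Z s 1) t = _ := pd_coord 0 j t
  have h2 : pd j (fun s => vars Z s 2) t = _ := pd_coord 2 j t
  have h3 : pd j (fun s => vars Z s 3) t = 1 / 5 * if (3 : Fin 4) = j then 1 else 0 := by
    rw [← pd_coord, ← pd_const_mul]
    congr 1
    funext s
    simp [vars]
    ring
  have h4 : pd j (fun s => vars Z s 4) t = _ := pd_coord 1 j t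
  rw [h0, h1, h2, h3, h4]
  fin_cases j <;> simp [tScale, tVar] <;> ring

theorem branch_relation (hZ : IsBranch U Z) {t : Fin 4 → ℂ} (ht : t ∈ U) (j : Fin 4) :
    (branchSP.deriv 0).den (vars Z t) * pd j Z t
      + tScale j * (branchSP.deriv (tVar j)).den (vars Z t) = 0 := by
  rw [← pd_vars hZ branchSP ht, pd_congr hZ.1 (g := fun _ => 0)
    (fun s hs => (branchSP_den s).trans (hZ.2.2 s hs)) ht]
  simp [pd]

theorem branch_deriv_t2 (v : Fin 5 → ℂ) : (branchSP.deriv 4).den v = -1 := by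
  simp [branchSP, rootSP, SP.deriv, Mono.deriv, SP.den, listDen, Mono.den]

/-- Since `∂P/∂t₂ = -1`, implicit differentiation gives `∂P/∂Z * ∂Z/∂t₂ = 1`. The existence of a
holomorphic branch alone keeps `U` away from the ramification locus. -/
theorem branchDZ_ne_zero (hZ : IsBranch U Z) {t : Fin 4 → ℂ} (ht : t ∈ U) :
    (branchSP.deriv 0).den (vars Z t) ≠ 0 := by
  intro h
  have := branch_relation hZ ht 1
  rw [h, show tVar 1 = 4 from rfl, branch_deriv_t2] at this
  simp [tScale] at this

theorem pd_Z_one_ne_zero (hZ : IsBranch U Z) {t : Fin 4 → ℂ} (ht : t ∈ U) : pd 1 Z t ≠ 0 := by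
  intro h
  have := branch_relation hZ ht 1
  rw [h, show tVar 1 = 4 from rfl, branch_deriv_t2] at this
  simp [tScale] at this

theorem Ex.den_sub {A : Type*} [CommRing A] (v : Fin 5 → A) (a b : Ex) :
    (Ex.sub a b).den v = a.den v - b.den v := by
  simp [Ex.sub, Ex.neg, Ex.den, SP.den, listDen, Mono.den]
  ring

theorem tangentD_den (j : Fin 4) (w : ℕ) (p : SP) (v : Fin 5 → ℂ) :
    (tangentD j w p).den v = (p.deriv (tVar j)).den v * (branchSP.deriv 0).den v
      - (p.deriv 0).den v * (branchSP.deriv (tVar j)).den v := by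
  by_cases hj : j = 0
  · subst hj
    have : (branchSP.deriv 1).den v = 0 := by
      simp [branchSP, rootSP, SP.deriv, Mono.deriv, SP.den, listDen, Mono.den]
    simp [tangentD, tVar, Ex.den, branchDZ, this]
  · simp [tangentD, hj, Ex.den_sub, Ex.den, branchDZ]

theorem branchDZ_mul_pd (hZ : IsBranch U Z) (p : SP) (w : ℕ) {t : Fin 4 → ℂ} (ht : t ∈ U)
    (j : Fin 4) : (branchSP.deriv 0).den (vars Z t) * pd j (fun s => p.den (vars Z s)) t
      = tScale j * (tangentD j w p).den (vars Z t) := by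
  rw [pd_vars hZ p ht, tangentD_den]
  linear_combination (p.deriv 0).den (vars Z t) * branch_relation hZ ht j

/-- The passage from the computed certificates to identities between functions on `U`. -/
theorem den_vars_eq_zero (hZ : IsBranch U Z) {e : Ex} {b : ℕ}
    (h : e.vanishes tWeights rootSP b = true) {t : Fin 4 → ℂ} (ht : t ∈ U) :
    e.den (vars Z t) = 0 := by
  rw [vars_eq_point hZ ht]
  exact e.den_eq_zero h _

theorem F_eq (t : Fin 4 → ℂ) : F Z t = 1 / 19213740 * potentialSP.den (vars Z t) := by
  simp only [vars, potentialSP, SP.den, listDen, Mono.den_vec, F, prepotential]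
  push_cast
  ring

theorem pd_F (hZ : IsBranch U Z) {t : Fin 4 → ℂ} (ht : t ∈ U) (k : Fin 4) :
    pd k (F Z) t = tScale k / 19213740 * (gradSP k).den (vars Z t) := by
  have h1 := den_vars_eq_zero hZ (gradSP_check k) ht
  rw [Ex.den_sub, sub_eq_zero] at h1
  have h2 := branchDZ_mul_pd hZ potentialSP 23 ht k
  rw [pd_congr hZ.1 (fun s _ => F_eq s) ht, pd_const_mul]
  refine mul_left_cancel₀ (branchDZ_ne_zero hZ ht) ?_
  rw [h1] at h2
  simp only [Ex.den, branchDZ] at h2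
  linear_combination 1 / 19213740 * h2

theorem pd_pd_F (hZ : IsBranch U Z) {t : Fin 4 → ℂ} (ht : t ∈ U) (j k : Fin 4) :
    pd j (pd k (F Z)) t = tScale j * tScale k / 19213740 * (hessSP j k).den (vars Z t) := by
  have h1 := den_vars_eq_zero hZ (hessSP_check j k) ht
  rw [Ex.den_sub, sub_eq_zero] at h1
  have h2 := branchDZ_mul_pd hZ (gradSP k) (23 - tWt k) ht j
  rw [pd_congr hZ.1 (fun s hs => pd_F hZ hs k) ht, pd_const_mul]
  refine mul_left_cancel₀ (branchDZ_ne_zero hZ ht) ?_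
  rw [h1] at h2
  simp only [Ex.den, branchDZ] at h2
  linear_combination tScale k / 19213740 * h2

end Branch

end H47

/-! ### The metric and the intersection form. -/

namespace H47

open SparsePoly

theorem pd_add {f g : (Fin 4 → ℂ) → ℂ} {t : Fin 4 → ℂ} (hf : DifferentiableAt ℂ f t)
    (hg : DifferentiableAt ℂ g t) (j : Fin 4) :
    pd j (fun s => f s + g s) t = pd j f t + pd j g t := by
  simp [pd, fderiv_fun_add hf hg]

theorem pd_mul {f g : (Fin 4 → ℂ) → ℂ} {t : Fin 4 → ℂ} (hf : DifferentiableAt ℂ f t)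
    (hg : DifferentiableAt ℂ g t) (j : Fin 4) :
    pd j (fun s => f s * g s) t = f t * pd j g t + g t * pd j f t := by
  simp [pd, fderiv_fun_mul hf hg]

theorem E_apply (t : Fin 4 → ℂ) (l : Fin 4) : E t l = (tWt l : ℂ) / 10 * t l := by
  fin_cases l <;> simp [E, tWt, -mul_eq_mul_right_iff] <;> ring

theorem differentiableAt_coord (l : Fin 4) (t : Fin 4 → ℂ) :
    DifferentiableAt ℂ (fun s : Fin 4 → ℂ => s l) t := (hasFDerivAt_apply l t).differentiableAt

theorem hessSP_symm (j k : Fin 4) : hessSP j k = hessSP k j := by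
  fin_cases j <;> fin_cases k <;> rfl

section Branch

variable {U : Set (Fin 4 → ℂ)} {Z : (Fin 4 → ℂ) → ℂ}

theorem cLower_eq (hZ : IsBranch U Z) {t : Fin 4 → ℂ} (ht : t ∈ U) (i j k : Fin 4) :
    cLower (F Z) i j k t
      = tScale j * tScale k / 19213740 * pd i (fun s => (hessSP j k).den (vars Z s)) t := by
  rw [cLower, pd_congr hZ.1 (fun s hs => pd_pd_F hZ hs j k) ht, pd_const_mul]

/-- Only `t₁t₂t₃ + t₁²t₄ / 2` involves `t₁`, so `∂F/∂t₁ = t₂t₃ + t₁t₄`, whose gradient is `t` in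
reversed order. This makes `η` antidiagonal and raising an index the reversal of indices. -/
theorem hessSP_zero (t : Fin 4 → ℂ) (j : Fin 4) :
    tScale j / 19213740 * (hessSP j 0).den (vars Z t) = t j.rev := by
  fin_cases j <;>
    simp [hessSP, hessSP00, hessSP01, hessSP02, hessSP03, SP.den, listDen, Mono.den_vec, vars,
      tScale, Fin.rev] <;> ring

theorem eta_eq (hZ : IsBranch U Z) {t : Fin 4 → ℂ} (ht : t ∈ U) :
    eta (F Z) t = Matrix.of fun i j => if j = i.rev then 1 else 0 := by
  ext i j
  have h : pd i (fun s => tScale j / 19213740 * (hessSP j 0).den (vars Z s)) t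
      = pd i (fun s => s j.rev) t := by
    congr 1
    funext s
    exact hessSP_zero s j
  rw [pd_const_mul, pd_coord] at h
  rw [eta, Matrix.of_apply, cLower_eq hZ ht, Matrix.of_apply]
  simp only [show tScale 0 = 1 from rfl, mul_one]
  rw [h]
  simp only [Fin.rev_eq_iff]

theorem eta_inv (hZ : IsBranch U Z) {t : Fin 4 → ℂ} (ht : t ∈ U) :
    (eta (F Z) t)⁻¹ = Matrix.of fun i j => if j = i.rev then 1 else 0 := by
  refine Matrix.inv_eq_right_inv ?_
  rw [eta_eq hZ ht]
  ext i j
  fin_cases i <;> fin_cases j <;> simp [Matrix.mul_apply, Fin.sum_univ_four, Fin.rev]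

theorem cUpper_eq (hZ : IsBranch U Z) {t : Fin 4 → ℂ} (ht : t ∈ U) (i j k : Fin 4) :
    cUpper (F Z) i j k t = cLower (F Z) i.rev j.rev k t := by
  simp [cUpper, eta_inv hZ ht]

theorem tEx_den (t : Fin 4 → ℂ) (l : Fin 4) : (tEx l).den (vars Z t) = tScale l * t l := by
  fin_cases l <;> simp [tEx, Ex.den, SP.den, listDen, Mono.den, vars, tScale]
  ring

theorem nat_den (c : ℕ) (v : Fin 5 → ℂ) : (Ex.nat c).den v = c := by
  simp [Ex.nat, Ex.den, SP.den, listDen, Mono.den]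

theorem sumEx_den (f : Fin 4 → Ex) (v : Fin 5 → ℂ) : (sumEx f).den v = ∑ i, (f i).den v := by
  simp [sumEx, Ex.den, Fin.sum_univ_four]

theorem tWt_le (k : Fin 4) : tWt k ≤ 23 := by fin_cases k <;> simp [tWt]

theorem euler_pd_F (hZ : IsBranch U Z) {t : Fin 4 → ℂ} (ht : t ∈ U) (b : Fin 4) :
    ∑ l, E t l * pd b (pd l (F Z)) t = (23 - tWt b) / 10 * pd b (F Z) t := by
  have h := den_vars_eq_zero hZ (eulerGradSP_check b) ht
  simp only [Ex.den_sub, sumEx_den, Ex.den, nat_den, tEx_den] at h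
  rw [sub_eq_zero, Nat.cast_sub (tWt_le b)] at h
  simp only [pd_pd_F hZ ht, pd_F hZ ht, E_apply]
  calc _ = tScale b / 192137400 * ∑ l, (tWt l : ℂ)
        * (tScale l * t l * (hessSP b l).den (vars Z t)) := by
        rw [Finset.mul_sum]
        exact Finset.sum_congr rfl fun l _ => by ring
    _ = _ := by
        rw [h]
        push_cast
        ring

theorem pd_pd_F_differentiableAt (hZ : IsBranch U Z) {t : Fin 4 → ℂ} (ht : t ∈ U)
    (j k : Fin 4) : DifferentiableAt ℂ (pd j (pd k (F Z))) t :=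
  ((den_vars_analyticAt hZ (hessSP j k) ht).differentiableAt.const_mul _).congr_of_eventuallyEq
    (Filter.mem_of_superset (hZ.1.mem_nhds ht) fun _ hs => pd_pd_F hZ hs j k)

/-- Differentiate the Euler relation for `∂_b F` along `t_a`: the derivative of the coefficients of
`E` contributes the further weight `tWt a`. The third derivatives contracted with `E` are thus
multiples of second derivatives. -/
theorem euler_cLower (hZ : IsBranch U Z) {t : Fin 4 → ℂ} (ht : t ∈ U) (a b : Fin 4) :
    ∑ l, E t l * cLower (F Z) a b l t
      = (23 - tWt a - tWt b) / 10 * pd a (pd b (F Z)) t := by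
  have h := pd_congr hZ.1 (fun s hs => euler_pd_F hZ hs b) ht a
  have hE : ∀ l, DifferentiableAt ℂ (fun s => E s l) t := fun l => by
    simp only [E_apply]
    exact (differentiableAt_coord l t).const_mul _
  have hpE : ∀ l, pd a (fun s => E s l) t = (tWt l : ℂ) / 10 * if l = a then 1 else 0 := fun l => by
    rw [← pd_coord, ← pd_const_mul]
    congr 1
    funext s
    exact E_apply s l
  have hd : ∀ l, DifferentiableAt ℂ (fun s => E s l * pd b (pd l (F Z)) s) t := fun l =>
    (hE l).mul (pd_pd_F_differentiableAt hZ ht b l)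
  have hs : ∀ l, pd a (fun s => E s l * pd b (pd l (F Z)) s) t = E t l * cLower (F Z) a b l t
      + pd b (pd l (F Z)) t * ((tWt l : ℂ) / 10 * if l = a then 1 else 0) := fun l => by
    rw [pd_mul (hE l) (pd_pd_F_differentiableAt hZ ht b l), hpE]
    rfl
  simp only [Fin.sum_univ_four] at h
  rw [pd_add (((hd 0).fun_add (hd 1)).fun_add (hd 2)) (hd 3), pd_add ((hd 0).fun_add (hd 1)) (hd 2),
    pd_add (hd 0) (hd 1), hs, hs, hs, hs, pd_const_mul] at h
  have hsum : ∑ l, pd b (pd l (F Z)) t * ((tWt l : ℂ) / 10 * if l = a then 1 else 0)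
      = (tWt a : ℂ) / 10 * pd b (pd a (F Z)) t := by
    simp [mul_comm]
  have hsym : pd b (pd a (F Z)) t = pd a (pd b (F Z)) t := by
    rw [pd_pd_F hZ ht, pd_pd_F hZ ht, hessSP_symm]
    ring
  rw [hsym, Fin.sum_univ_four] at hsum
  rw [Fin.sum_univ_four]
  linear_combination h - hsum

theorem tWt_rev (a : Fin 4) : (tWt a.rev : ℂ) = 13 - tWt a := by
  fin_cases a <;> simp [tWt, Fin.rev] <;> norm_num

/-- Dual weights add up to `13`, which turns `23 - w_{i'} - w_{j'}` for the reversed indices into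
`w_i + w_j - 3`. -/
theorem intersectionForm_eq (hZ : IsBranch U Z) {t : Fin 4 → ℂ} (ht : t ∈ U) (i j : Fin 4) :
    intersectionForm (F Z) E t i j = (tWt i + tWt j - 3) / 10
      * (tScale i.rev * tScale j.rev / 19213740 * (hessSP i.rev j.rev).den (vars Z t)) := by
  rw [intersectionForm, Matrix.of_apply]
  simp only [cUpper_eq hZ ht]
  rw [euler_cLower hZ ht, pd_pd_F hZ ht, tWt_rev, tWt_rev]
  ring

theorem intersectionForm_symm (hZ : IsBranch U Z) {t : Fin 4 → ℂ} (ht : t ∈ U) (i j : Fin 4) :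
    intersectionForm (F Z) E t i j = intersectionForm (F Z) E t j i := by
  rw [intersectionForm_eq hZ ht, intersectionForm_eq hZ ht, hessSP_symm]
  ring

/-- The differential of `t₄` is dual to the unity field, so pairing with it by `g` is
differentiation along `E`. This disposes of the last row of the Gram matrix. -/
theorem intersectionForm_three (hZ : IsBranch U Z) {t : Fin 4 → ℂ} (ht : t ∈ U) (j : Fin 4) :
    intersectionForm (F Z) E t 3 j = E t j := by
  have h := hessSP_zero (Z := Z) t j.rev
  rw [intersectionForm_eq hZ ht, E_apply, hessSP_symm, show (3 : Fin 4).rev = 0 from rfl]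
  rw [Fin.rev_rev] at h
  rw [← h, show tScale 0 = 1 from rfl, show (tWt 3 : ℂ) = 3 by simp [tWt]]
  ring

end Branch

/-- The products of the gradients of the basic invariants, in terms of the invariants. -/
noncomputable def gramMatrix (y : Fin 4 → ℂ) : Matrix (Fin 4) (Fin 4) ℂ :=
  let m01 := -32 * y 2 ^ 4 - 112 * y 1 * y 2 ^ 2 * y 3 ^ 2 + 48 * y 1 ^ 2 * y 3 ^ 4
    - 120 * y 0 * y 2 * y 3 ^ 3
  let m02 := -(16 / 3) * y 2 ^ 3 * y 3 ^ 2 - 16 * y 1 * y 2 * y 3 ^ 4 - 80 * y 1 ^ 2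
    - 40 * y 0 * y 3 ^ 5
  let m12 := 8 * y 2 ^ 2 * y 3 ^ 3 - 24 * y 1 * y 3 ^ 5 - 30 * y 0
  !![928 / 3 * y 1 * y 2 ^ 3 * y 3 + 96 * y 1 ^ 2 * y 2 * y 3 ^ 3 + 240 * y 0 * y 2 ^ 2 * y 3 ^ 2
      + 160 * y 0 * y 1 * y 3 ^ 4, m01, m02, 60 * y 0;
    m01, 152 / 3 * y 2 ^ 3 * y 3 - 56 * y 1 * y 2 * y 3 ^ 3 + 20 * y 0 * y 3 ^ 4, m12, 40 * y 1;
    m02, m12, 44 * y 1 * y 3 - 8 * y 2 * y 3 ^ 5, 24 * y 2;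
    60 * y 0, 40 * y 1, 24 * y 2, 4 * y 3]

end H47

/-! ### Gram matrix of the right-hand sides for the intersection form. -/

namespace H47

open SparsePoly

noncomputable def relCoeff : Fin 3 → ℂ :=
  ![762939453125 / 160137547184727, 48828125 / 3099363912, 78125 / 708588]

section Branch

variable {U : Set (Fin 4 → ℂ)} {Z : (Fin 4 → ℂ) → ℂ}

theorem relY1_eq (t : Fin 4 → ℂ) : relY1 (t 0) (t 1) (t 2) (t 3) (Z t)
    = 762939453125 / 160137547184727 * relSP0.den (vars Z t) := by
  simp only [vars, relSP0, SP.den, listDen, Mono.den_vec, relY1, relY1p1, relY1p2, relY1p3, relY1p4,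
    relY1p5, relY1p6, relY1p7, relY1p8, relY1p9, relY1p10, relY1p11, relY1p12, relY1p13, relY1p14,
    relY1p15, relY1p16, relY1p17, relY1p18, relY1p19, relY1p20, relY1p21, relY1p22, relY1p23,
    relY1p24, relY1p25, relY1p26]
  push_cast
  ring

theorem relY2_eq (t : Fin 4 → ℂ) : relY2 (t 0) (t 1) (t 2) (t 3) (Z t)
    = 48828125 / 3099363912 * relSP1.den (vars Z t) := by
  simp only [vars, relSP1, SP.den, listDen, Mono.den_vec, relY2, relY2p1, relY2p2, relY2p3, relY2p4,
    relY2p5, relY2p6, relY2p7, relY2p8]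
  push_cast
  ring

theorem relY3_eq (t : Fin 4 → ℂ) : relY3 (t 0) (t 1) (t 2) (t 3) (Z t)
    = 78125 / 708588 * relSP2.den (vars Z t) := by
  simp only [vars, relSP2, SP.den, listDen, Mono.den_vec, relY3, relY3p1, relY3p2, relY3p3]
  push_cast
  ring

theorem relY_castSucc (t : Fin 4 → ℂ) (k : Fin 3) :
    relY t (Z t) k.castSucc = relCoeff k * (relSP k).den (vars Z t) := by
  fin_cases k
  · exact relY1_eq t
  · exact relY2_eq t
  · exact relY3_eq t

theorem relY_three (t : Fin 4 → ℂ) (z : ℂ) : relY t z 3 = 40 / 3 * t 3 := rfl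

theorem branchDZ_mul_pd_relY (hZ : IsBranch U Z) {t : Fin 4 → ℂ} (ht : t ∈ U) (j : Fin 4)
    (k : Fin 3) : (branchSP.deriv 0).den (vars Z t) * pd j (fun s => relY s (Z s) k.castSucc) t
      = relCoeff k * (tScale j * (tangentD j (relWt k) (relSP k)).den (vars Z t)) := by
  have h : pd j (fun s => relY s (Z s) k.castSucc) t
      = relCoeff k * pd j (fun s => (relSP k).den (vars Z s)) t := by
    rw [← pd_const_mul]
    congr 1
    funext s
    exact relY_castSucc s k
  rw [h, ← branchDZ_mul_pd hZ (relSP k) _ ht]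
  ring

theorem formEx_den (hZ : IsBranch U Z) {t : Fin 4 → ℂ} (ht : t ∈ U) (i j : Fin 4) :
    (formEx i j).den (vars Z t)
      = 4803435000 * (tScale i * tScale j * intersectionForm (F Z) E t i j) := by
  have hs : ∀ i, (dualScale i : ℂ) = 5 * (tScale i * tScale i.rev) := fun i => by
    fin_cases i <;> simp [dualScale, tScale, Fin.rev]
  have hw : 3 ≤ tWt i + tWt j := by fin_cases i <;> fin_cases j <;> simp [tWt]
  rw [intersectionForm_eq hZ ht]
  simp only [formEx, Ex.den, nat_den, Nat.cast_mul, Nat.cast_sub hw, hs]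
  push_cast
  ring

/-- The product of the gradients of `f` and `g` with respect to the intersection form. -/
noncomputable def gradProd (Z : (Fin 4 → ℂ) → ℂ) (f g : (Fin 4 → ℂ) → ℂ) (t : Fin 4 → ℂ) : ℂ :=
  ∑ a, ∑ b, intersectionForm (F Z) E t a b * pd a f t * pd b g t

theorem gradProd_symm (hZ : IsBranch U Z) {t : Fin 4 → ℂ} (ht : t ∈ U)
    (f g : (Fin 4 → ℂ) → ℂ) : gradProd Z f g t = gradProd Z g f t := by
  rw [gradProd, gradProd, Finset.sum_comm]
  refine Finset.sum_congr rfl fun a _ => Finset.sum_congr rfl fun b _ => ?_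
  rw [intersectionForm_symm hZ ht]
  ring

/-- Both sides are compared after multiplication by `(∂P/∂Z)²`, where the gradients are polynomial
and the certificate applies; the nonvanishing factor is then cancelled. -/
theorem gradProd_relY (hZ : IsBranch U Z) {t : Fin 4 → ℂ} (ht : t ∈ U) (k l : Fin 3) {e : Ex}
    {b : ℕ} (h : (Ex.sub (relFormEx k l) (.mul branchDZ.sq e)).vanishes tWeights rootSP b = true) :
    gradProd Z (fun s => relY s (Z s) k.castSucc) (fun s => relY s (Z s) l.castSucc) t
      = relCoeff k * relCoeff l / 4803435000 * e.den (vars Z t) := by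
  have h0 := branchDZ_ne_zero hZ ht
  have h1 := den_vars_eq_zero hZ h ht
  rw [Ex.den_sub, sub_eq_zero] at h1
  have hB : branchDZ.den (vars Z t) = (branchSP.deriv 0).den (vars Z t) := rfl
  simp only [relFormEx, sumEx_den, Ex.den, formEx_den hZ ht, Ex.sq, hB] at h1
  refine mul_left_cancel₀ (mul_ne_zero h0 h0) ?_
  rw [mul_left_comm, ← h1, gradProd, Finset.mul_sum, Finset.mul_sum]
  refine Finset.sum_congr rfl fun i _ => ?_
  rw [Finset.mul_sum, Finset.mul_sum, Finset.mul_sum]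
  refine Finset.sum_congr rfl fun j _ => ?_
  have hi := branchDZ_mul_pd_relY hZ ht i k
  have hj := branchDZ_mul_pd_relY hZ ht j l
  calc _ = intersectionForm (F Z) E t i j
        * ((branchSP.deriv 0).den (vars Z t) * pd i (fun s => relY s (Z s) k.castSucc) t)
        * ((branchSP.deriv 0).den (vars Z t) * pd j (fun s => relY s (Z s) l.castSucc) t) := by ring
    _ = _ := by
      rw [hi, hj]
      ring

theorem relEx_den (t : Fin 4 → ℂ) (k : Fin 3) :
    (relEx k).den (vars Z t) = (relCoeff k)⁻¹ * relY t (Z t) k.castSucc := by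
  have h : relCoeff k ≠ 0 := by fin_cases k <;> simp [relCoeff]
  rw [relY_castSucc, inv_mul_cancel_left₀ h]
  rfl

theorem t4Ex_den (t : Fin 4 → ℂ) (k c : ℕ) :
    (t4Ex k c).den (vars Z t) = c * (3 / 200 * relY t (Z t) 3) ^ k := by
  rw [relY_three]
  simp [t4Ex, Ex.den, SP.den, listDen, Mono.den, vars]
  left
  congr 1
  ring

theorem Ex.den_neg {A : Type*} [CommRing A] (v : Fin 5 → A) (a : Ex) :
    a.neg.den v = -a.den v := by
  simp [Ex.neg, Ex.den, SP.den, listDen, Mono.den]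

theorem pd_relY_three (t : Fin 4 → ℂ) (j : Fin 4) :
    pd j (fun s => relY s (Z s) 3) t = if j = 3 then 40 / 3 else 0 := by
  simp only [relY_three, pd_const_mul, pd_coord]
  simp [eq_comm]

theorem euler_relY (hZ : IsBranch U Z) {t : Fin 4 → ℂ} (ht : t ∈ U) (l : Fin 3) :
    ∑ b, E t b * pd b (fun s => relY s (Z s) l.castSucc) t
      = relWt l / 10 * relY t (Z t) l.castSucc := by
  have h1 := den_vars_eq_zero hZ (eulerRelSP_check l) ht
  have hB : branchDZ.den (vars Z t) = (branchSP.deriv 0).den (vars Z t) := rfl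
  simp only [Ex.den_sub, sumEx_den, Ex.den, nat_den, tEx_den, hB] at h1
  rw [sub_eq_zero] at h1
  refine mul_left_cancel₀ (branchDZ_ne_zero hZ ht) ?_
  rw [relY_castSucc, Finset.mul_sum]
  calc _ = relCoeff l / 10 * ∑ b, (tWt b : ℂ)
        * (tScale b * t b * (tangentD b (relWt l) (relSP l)).den (vars Z t)) := by
        rw [Finset.mul_sum]
        refine Finset.sum_congr rfl fun b _ => ?_
        rw [mul_left_comm, branchDZ_mul_pd_relY hZ ht, E_apply]
        ring
    _ = _ := by
        rw [h1]
        ring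

theorem gradProd_relY_three (hZ : IsBranch U Z) {t : Fin 4 → ℂ} (ht : t ∈ U)
    (f : (Fin 4 → ℂ) → ℂ) : gradProd Z (fun s => relY s (Z s) 3) f t
      = 40 / 3 * ∑ b, E t b * pd b f t := by
  rw [gradProd, Fin.sum_univ_four]
  simp only [pd_relY_three, intersectionForm_three hZ ht]
  simp [Finset.mul_sum]
  exact Finset.sum_congr rfl fun b _ => by ring

/-- First half of the comparison of metrics: six entries come from certificates, and those involving
`y_4` from the Euler field. -/
theorem gradProd_relY_eq_gramMatrix (hZ : IsBranch U Z) {t : Fin 4 → ℂ} (ht : t ∈ U)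
    (k l : Fin 4) : gradProd Z (fun s => relY s (Z s) k) (fun s => relY s (Z s) l) t
      = gramMatrix (relY t (Z t)) k l := by
  have h00 := gradProd_relY hZ ht 0 0 relForm_check00
  have h01 := gradProd_relY hZ ht 0 1 relForm_check01
  have h02 := gradProd_relY hZ ht 0 2 relForm_check02
  have h11 := gradProd_relY hZ ht 1 1 relForm_check11
  have h12 := gradProd_relY hZ ht 1 2 relForm_check12
  have h22 := gradProd_relY hZ ht 2 2 relForm_check22
  have h3 : ∀ l : Fin 3, gradProd Z (fun s => relY s (Z s) 3)
      (fun s => relY s (Z s) l.castSucc) t = 40 / 3 * (relWt l / 10 * relY t (Z t) l.castSucc) :=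
    fun l => by rw [gradProd_relY_three hZ ht, euler_relY hZ ht]
  have h33 : gradProd Z (fun s => relY s (Z s) 3) (fun s => relY s (Z s) 3) t
      = 4 * relY t (Z t) 3 := by
    rw [gradProd_relY_three hZ ht]
    simp only [pd_relY_three]
    simp only [E_apply, mul_ite, mul_zero, Finset.sum_ite_eq', Finset.mem_univ,
      if_true, relY_three, show tWt 3 = 3 from rfl]
    push_cast
    ring
  have h30 := h3 0
  have h31 := h3 1
  have h32 := h3 2
  simp only [relGramEx00, relGramEx01, relGramEx02, relGramEx11, relGramEx12, relGramEx22, Ex.den,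
    Ex.den_sub, Ex.den_neg, relEx_den, t4Ex_den, relCoeff, relWt, Matrix.cons_val,
    show (0 : Fin 3).castSucc = 0 from rfl, show (1 : Fin 3).castSucc = 1 from rfl,
    show (2 : Fin 3).castSucc = 2 from rfl] at h00 h01 h02 h11 h12 h22 h30 h31 h32
  have hsymm := gradProd_symm hZ ht
  generalize relY t (Z t) = y at *
  fin_cases k <;> fin_cases l <;> simp only [gramMatrix, Matrix.of_apply, Matrix.cons_val,
    Fin.zero_eta, Fin.mk_one, Fin.reduceFinMk]
  · rw [h00]; push_cast; ring
  · rw [h01]; push_cast; ring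
  · rw [h02]; push_cast; ring
  · rw [hsymm, h30]; push_cast; ring
  · rw [hsymm, h01]; push_cast; ring
  · rw [h11]; push_cast; ring
  · rw [h12]; push_cast; ring
  · rw [hsymm, h31]; push_cast; ring
  · rw [hsymm, h02]; push_cast; ring
  · rw [hsymm, h12]; push_cast; ring
  · rw [h22]; push_cast; ring
  · rw [hsymm, h32]; push_cast; ring
  · rw [h30]; push_cast; ring
  · rw [h31]; push_cast; ring
  · rw [h32]; push_cast; ring
  · exact h33

end Branch

end H47

/-! ### Gradients of the icosahedral invariants for the standard form. -/

namespace H47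

open SparsePoly

/-- The product of the gradients of `f` and `g` with respect to the standard form. -/
noncomputable def euclProd (f g : (Fin 4 → ℂ) → ℂ) (x : Fin 4 → ℂ) : ℂ := ∑ j, pd j f x * pd j g x

theorem euclProd_symm (f g : (Fin 4 → ℂ) → ℂ) (x : Fin 4 → ℂ) :
    euclProd f g x = euclProd g f x := by
  simp [euclProd, mul_comm]

theorem euclProd_den (p q : SP) {v : (Fin 4 → ℂ) → Fin 5 → ℂ} {x : Fin 4 → ℂ}
    (hv : ∀ i, DifferentiableAt ℂ (fun s => v s i) x) :
    euclProd (fun s => p.den (v s)) (fun s => q.den (v s)) x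
      = ∑ a, ∑ b, (p.deriv a).den (v x) * (q.deriv b).den (v x)
        * euclProd (fun s => v s a) (fun s => v s b) x := by
  simp only [euclProd, pd_den _ hv, Finset.sum_mul_sum]
  rw [Finset.sum_comm]
  refine Finset.sum_congr rfl fun a _ => ?_
  rw [Finset.sum_comm]
  refine Finset.sum_congr rfl fun b _ => ?_
  rw [Finset.mul_sum]
  exact Finset.sum_congr rfl fun j _ => by ring

theorem pd_const (j : Fin 4) (c : ℂ) (x : Fin 4 → ℂ) : pd j (fun _ => c) x = 0 := by simp [pd]

section Elementary

noncomputable def elemVars (x : Fin 4 → ℂ) : Fin 5 → ℂ := ![x 1, x 2, x 3, 0, 0]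

/-- `eps1`, `eps2`, `eps3` and `delta`. -/
def elemSP : Fin 4 → SP :=
  ![⟨[⟨1, 2, 0, 0, 0, 0⟩, ⟨1, 0, 2, 0, 0, 0⟩, ⟨1, 0, 0, 2, 0, 0⟩], []⟩,
    ⟨[⟨1, 2, 2, 0, 0, 0⟩, ⟨1, 2, 0, 2, 0, 0⟩, ⟨1, 0, 2, 2, 0, 0⟩], []⟩,
    ⟨[⟨1, 2, 2, 2, 0, 0⟩], []⟩,
    ⟨[⟨1, 4, 2, 0, 0, 0⟩, ⟨1, 0, 4, 2, 0, 0⟩, ⟨1, 2, 0, 4, 0, 0⟩],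
     [⟨1, 4, 0, 2, 0, 0⟩, ⟨1, 2, 4, 0, 0, 0⟩, ⟨1, 0, 2, 4, 0, 0⟩]⟩]

noncomputable def rootVars (x : Fin 4 → ℂ) : Fin 5 → ℂ :=
  ![sqrtFive, eps1 (x 1) (x 2) (x 3), eps2 (x 1) (x 2) (x 3), eps3 (x 1) (x 2) (x 3),
    delta (x 1) (x 2) (x 3)]

theorem elemVars_differentiableAt (x : Fin 4 → ℂ) (i : Fin 5) :
    DifferentiableAt ℂ (fun s => elemVars s i) x := by
  fin_cases i
  · exact differentiableAt_coord 1 x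
  · exact differentiableAt_coord 2 x
  · exact differentiableAt_coord 3 x
  · exact differentiableAt_const 0
  · exact differentiableAt_const 0

theorem pd_elemVars (x : Fin 4 → ℂ) (i : Fin 5) (j : Fin 4) :
    pd j (fun s => elemVars s i) x = (![![0, 1, 0, 0], ![0, 0, 1, 0], ![0, 0, 0, 1], 0, 0] :
      Fin 5 → Fin 4 → ℂ) i j := by
  fin_cases i
  · exact (pd_coord 1 j x).trans (by fin_cases j <;> rfl)
  · exact (pd_coord 2 j x).trans (by fin_cases j <;> rfl)
  · exact (pd_coord 3 j x).trans (by fin_cases j <;> rfl)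
  · exact pd_const j 0 x
  · exact pd_const j 0 x

theorem elemSP_den (x : Fin 4 → ℂ) (a : Fin 4) :
    (elemSP a).den (elemVars x) = rootVars x a.succ := by
  fin_cases a <;>
    simp [elemSP, elemVars, rootVars, SP.den, listDen, Mono.den_vec, eps1, eps2, eps3, delta] <;>
    ring

theorem rootVars_differentiableAt (x : Fin 4 → ℂ) (i : Fin 5) :
    DifferentiableAt ℂ (fun s => rootVars s i) x := by
  refine Fin.cases (differentiableAt_const _) (fun a => ?_) i
  simp only [← elemSP_den]
  exact ((elemSP a).hasFDerivAt fun i =>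
    (elemVars_differentiableAt x i).hasFDerivAt).differentiableAt

theorem pd_rootVars_succ (x : Fin 4 → ℂ) (a j : Fin 4) :
    pd j (fun s => rootVars s a.succ) x
      = ∑ i, ((elemSP a).deriv i).den (elemVars x) * pd j (fun s => elemVars s i) x := by
  simp only [← elemSP_den]
  exact pd_den _ (elemVars_differentiableAt x) j

/-- The partial derivatives of `eps1`, `eps2`, `eps3`, `delta`. -/
noncomputable def elemJac (x : Fin 4 → ℂ) : Fin 5 → Fin 4 → ℂ :=
  ![0, ![0, 2 * x 1, 2 * x 2, 2 * x 3],
    ![0, 2 * x 1 * (x 2 ^ 2 + x 3 ^ 2), 2 * x 2 * (x 1 ^ 2 + x 3 ^ 2),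
      2 * x 3 * (x 1 ^ 2 + x 2 ^ 2)],
    ![0, 2 * x 1 * x 2 ^ 2 * x 3 ^ 2, 2 * x 1 ^ 2 * x 2 * x 3 ^ 2, 2 * x 1 ^ 2 * x 2 ^ 2 * x 3],
    ![0, 2 * x 1 * (2 * x 1 ^ 2 - x 2 ^ 2 - x 3 ^ 2) * (x 2 ^ 2 - x 3 ^ 2),
      2 * x 2 * (2 * x 2 ^ 2 - x 1 ^ 2 - x 3 ^ 2) * (x 3 ^ 2 - x 1 ^ 2),
      2 * x 3 * (2 * x 3 ^ 2 - x 1 ^ 2 - x 2 ^ 2) * (x 1 ^ 2 - x 2 ^ 2)]]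

theorem pd_rootVars (x : Fin 4 → ℂ) (a : Fin 5) (j : Fin 4) :
    pd j (fun s => rootVars s a) x = elemJac x a j := by
  refine Fin.cases ?_ (fun a => ?_) a
  · exact (pd_const j _ x).trans (by simp [elemJac])
  · rw [pd_rootVars_succ]
    simp only [pd_elemVars, Fin.sum_univ_five]
    fin_cases a <;> fin_cases j <;>
      simp [elemSP, elemVars, elemJac, SP.deriv, Mono.deriv, SP.den, listDen, Mono.den_vec] <;> ring

/-- The products of the gradients of `eps1`, `eps2`, `eps3`, `delta`. -/
def elemGram (e₁ e₂ e₃ d : ℂ) : Fin 5 → Fin 5 → ℂ :=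
  ![0, ![0, 4 * e₁, 8 * e₂, 12 * e₃, 12 * d],
    ![0, 8 * e₂, 12 * e₃ + 4 * e₁ * e₂, 8 * e₁ * e₃, 4 * e₁ * d],
    ![0, 12 * e₃, 8 * e₁ * e₃, 4 * e₂ * e₃, 0],
    ![0, 12 * d, 4 * e₁ * d, 0,
      108 * e₂ * e₃ - 12 * e₁ * e₂ ^ 2 - 36 * e₁ ^ 2 * e₃ + 4 * e₁ ^ 3 * e₂]]

theorem euclProd_rootVars (x : Fin 4 → ℂ) (a b : Fin 5) :
    euclProd (fun s => rootVars s a) (fun s => rootVars s b) x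
      = elemGram (eps1 (x 1) (x 2) (x 3)) (eps2 (x 1) (x 2) (x 3)) (eps3 (x 1) (x 2) (x 3))
        (delta (x 1) (x 2) (x 3)) a b := by
  have h : ∀ a j, pd j (fun s => rootVars s a) x = elemJac x a j := pd_rootVars x
  simp only [euclProd, h, Fin.sum_univ_four, elemGram, elemJac, eps1, eps2, eps3, delta]
  fin_cases a <;> fin_cases b <;>
    simp only [Fin.zero_eta, Fin.mk_one, Fin.reduceFinMk, Matrix.cons_val, Pi.zero_apply] <;> ring

/-- The discriminant of the cubic with roots `a², b², c²` in terms of its coefficients. -/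
theorem delta_sq (a b c : ℂ) : delta a b c ^ 2 = -27 * eps3 a b c ^ 2 - 4 * eps2 a b c ^ 3
    + 18 * eps1 a b c * eps2 a b c * eps3 a b c + eps1 a b c ^ 2 * eps2 a b c ^ 2
    - 4 * eps1 a b c ^ 3 * eps3 a b c := by
  simp only [delta, eps1, eps2, eps3]
  ring

theorem sqrtFive_sq : sqrtFive ^ 2 = 5 := by
  rw [sqrtFive, ← Complex.ofReal_pow, Real.sq_sqrt (by norm_num)]
  norm_num

end Elementary

section Icosahedral

/-- `h₂`, `h₆`, `h₁₀` as polynomials in `√5, eps1, eps2, eps3, delta`. -/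
def icoSP : Fin 3 → SP :=
  ![⟨[⟨1, 0, 1, 0, 0, 0⟩], []⟩,
    ⟨[⟨1, 1, 0, 0, 0, 1⟩, ⟨1, 0, 1, 1, 0, 0⟩], [⟨11, 0, 0, 0, 1, 0⟩]⟩,
    ⟨[⟨95, 0, 0, 1, 1, 0⟩, ⟨2, 0, 3, 1, 0, 0⟩, ⟨3, 1, 0, 1, 0, 1⟩],
     [⟨32, 0, 2, 0, 1, 0⟩, ⟨5, 0, 1, 2, 0, 0⟩]⟩]

/-- The variables `h₂, x₁², h₆, h₁₀` and `0`. -/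
noncomputable def invVars (x : Fin 4 → ℂ) : Fin 5 → ℂ :=
  zeroSP.point ![h2 (x 1) (x 2) (x 3), x 0 ^ 2, h6 (x 1) (x 2) (x 3), h10 (x 1) (x 2) (x 3)]

theorem invVars_four (x : Fin 4 → ℂ) : invVars x 4 = 0 := by
  simp [invVars, SP.point, zeroSP, SP.den, listDen]

/-- The position of the invariants among the variables. -/
def icoVar : Fin 3 → Fin 5 := ![0, 2, 3]

theorem icoSP_den (x : Fin 4 → ℂ) (a : Fin 3) :
    (icoSP a).den (rootVars x) = invVars x (icoVar a) := by
  fin_cases a <;>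
    simp [icoSP, rootVars, SP.den, listDen, Mono.den_vec, invVars, icoVar, SP.point, h2, h6, h10] <;>
    ring

theorem invVars_icoVar_differentiableAt (x : Fin 4 → ℂ) (a : Fin 3) :
    DifferentiableAt ℂ (fun s => invVars s (icoVar a)) x := by
  simp only [← icoSP_den]
  exact ((icoSP a).hasFDerivAt fun i =>
    (rootVars_differentiableAt x i).hasFDerivAt).differentiableAt

theorem invVars_one (x : Fin 4 → ℂ) : invVars x 1 = x 0 ^ 2 := rfl

theorem invVars_differentiableAt (x : Fin 4 → ℂ) (i : Fin 5) :
    DifferentiableAt ℂ (fun s => invVars s i) x := by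
  fin_cases i
  · exact invVars_icoVar_differentiableAt x 0
  · exact (differentiableAt_coord 0 x).fun_pow 2
  · exact invVars_icoVar_differentiableAt x 1
  · exact invVars_icoVar_differentiableAt x 2
  · exact (differentiableAt_const (0 : ℂ)).congr_of_eventuallyEq (.of_forall invVars_four)

theorem pd_invVars_one (x : Fin 4 → ℂ) (j : Fin 4) :
    pd j (fun s => invVars s 1) x = if j = 0 then 2 * x 0 else 0 := by
  have h := pd_mul (differentiableAt_coord 0 x) (differentiableAt_coord 0 x) j
  simp only [pd_coord] at h
  have e : (fun s => invVars s 1) = fun s : Fin 4 → ℂ => s 0 * s 0 :=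
    funext fun s => (invVars_one s).trans (sq _)
  rw [e, h]
  by_cases hj : j = 0
  · subst hj; simp; ring
  · simp [hj, Ne.symm hj]

/-- `h₂, h₆, h₁₀` do not involve `x₁`, which makes their gradients orthogonal to that of `x₁²`. -/
theorem pd_zero_invVars (x : Fin 4 → ℂ) (a : Fin 3) :
    pd 0 (fun s => invVars s (icoVar a)) x = 0 := by
  simp only [← icoSP_den]
  rw [pd_den _ (rootVars_differentiableAt x)]
  refine Finset.sum_eq_zero fun i _ => mul_eq_zero_of_right _ ?_
  refine Fin.cases (pd_const 0 _ x) (fun a => ?_) i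
  rw [pd_rootVars_succ]
  refine Finset.sum_eq_zero fun i _ => mul_eq_zero_of_right _ ?_
  rw [pd_elemVars]
  fin_cases i <;> rfl

/-- The products of gradients are again polynomials in `h₂, h₆, h₁₀`. In terms of `√5`, `eps1`,
`eps2`, `eps3`, `delta` this is an identity modulo the two relations `√5² = 5` and `delta_sq`, which
are the only ones the combinations below use. -/
theorem euclProd_icoVar (x : Fin 4 → ℂ) (a b : Fin 3) :
    euclProd (fun s => invVars s (icoVar a)) (fun s => invVars s (icoVar b)) x
      = (gramHSP (![0, 2, 3] a) (![0, 2, 3] b)).den (invVars x) := by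
  simp only [← icoSP_den]
  rw [euclProd_den _ _ (rootVars_differentiableAt x)]
  have hr := sqrtFive_sq
  have hd := delta_sq (x 1) (x 2) (x 3)
  simp only [euclProd_rootVars]
  simp only [rootVars, invVars, SP.point]
  generalize h2_eq : h2 (x 1) (x 2) (x 3) = H₂
  generalize h6_eq : h6 (x 1) (x 2) (x 3) = H₆
  generalize h10_eq : h10 (x 1) (x 2) (x 3) = H₁₀
  rw [h2] at h2_eq
  rw [h6] at h6_eq
  rw [h10] at h10_eq
  generalize eps1 (x 1) (x 2) (x 3) = e₁ at *
  generalize eps2 (x 1) (x 2) (x 3) = e₂ at *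
  generalize eps3 (x 1) (x 2) (x 3) = e₃ at *
  generalize delta (x 1) (x 2) (x 3) = d at *
  generalize sqrtFive = r at *
  subst h2_eq h6_eq h10_eq
  fin_cases a <;> fin_cases b <;>
    simp only [Fin.zero_eta, Fin.mk_one, Fin.reduceFinMk, icoSP, gramHSP, zeroSP, SP.deriv, List.map,
      Mono.deriv, SP.den, listDen, Matrix.cons_val, Mono.den_vec, Fin.sum_univ_five, elemGram,
      Pi.zero_apply] <;> push_cast
  · ring
  · ring
  · ring
  · ring
  · linear_combination (108 * e₂ * e₃ - 12 * e₁ * e₂ ^ 2 - 36 * e₁ ^ 2 * e₃ + 4 * e₁ ^ 3 * e₂) * hr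
  · linear_combination (324 * e₂ ^ 2 * e₃ - 16 * e₁ * d ^ 2 - 36 * e₁ * e₂ ^ 3
      - 108 * e₁ ^ 2 * e₂ * e₃ + 12 * e₁ ^ 3 * e₂ ^ 2) * hr - 80 * e₁ * hd
  · ring
  · linear_combination (324 * e₂ ^ 2 * e₃ - 16 * e₁ * d ^ 2 - 36 * e₁ * e₂ ^ 3
      - 108 * e₁ ^ 2 * e₂ * e₃ + 12 * e₁ ^ 3 * e₂ ^ 2) * hr - 80 * e₁ * hd
  · linear_combination (1098 * e₃ * d ^ 2 + 972 * e₂ ^ 3 * e₃ + 18 * e₁ * e₂ * d ^ 2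
      - 108 * e₁ * e₂ ^ 4 - 324 * e₁ ^ 2 * e₂ ^ 2 * e₃ - 36 * e₁ ^ 3 * d ^ 2 + 36 * e₁ ^ 3 * e₂ ^ 3
      - 30 * r * d ^ 3) * hr
      + (5490 * e₃ + 90 * e₁ * e₂ - 180 * e₁ ^ 3 - 150 * r * d) * hd

theorem euclProd_invVars (x : Fin 4 → ℂ) (a b : Fin 4) :
    euclProd (fun s => invVars s (hVar a)) (fun s => invVars s (hVar b)) x
      = (gramHSP a b).den (invVars x) := by
  have h11 : euclProd (fun s => invVars s 1) (fun s => invVars s 1) x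
      = (gramHSP 1 1).den (invVars x) := by
    simp only [euclProd, pd_invVars_one]
    simp [gramHSP, SP.den, listDen, Mono.den, invVars_one]
    ring
  have h1 : ∀ c : Fin 3, euclProd (fun s => invVars s 1) (fun s => invVars s (icoVar c)) x = 0 :=
    fun c => by simp [euclProd, pd_invVars_one, pd_zero_invVars]
  have h1' : ∀ c : Fin 3, euclProd (fun s => invVars s (icoVar c)) (fun s => invVars s 1) x = 0 :=
    fun c => by rw [euclProd_symm, h1]
  have hz : zeroSP.den (invVars x) = 0 := by simp [zeroSP, SP.den, listDen]
  have h := euclProd_icoVar x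
  fin_cases a <;> fin_cases b
  · exact h 0 0
  · exact (h1' 0).trans hz.symm
  · exact h 0 1
  · exact h 0 2
  · exact (h1 0).trans hz.symm
  · exact h11
  · exact (h1 1).trans hz.symm
  · exact (h1 2).trans hz.symm
  · exact h 1 0
  · exact (h1' 1).trans hz.symm
  · exact h 1 1
  · exact h 1 2
  · exact h 2 0
  · exact (h1' 2).trans hz.symm
  · exact h 2 1
  · exact h 2 2

end Icosahedral

end H47

/-! ### Gram matrix of the basic invariants for the standard form. -/

namespace H47

open SparsePoly

theorem Ex.den_sub_eq {v : Fin 5 → ℂ} {a b : Ex} (h : (Ex.sub a b).den v = 0) :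
    a.den v = b.den v := by
  rwa [Ex.den_sub, sub_eq_zero] at h

theorem pd_invVars_four (x : Fin 4 → ℂ) (j : Fin 4) : pd j (fun s => invVars s 4) x = 0 := by
  simp only [invVars_four]
  exact pd_const j 0 x

theorem euclProd_den_invVars (p q : SP) (x : Fin 4 → ℂ) :
    euclProd (fun s => p.den (invVars s)) (fun s => q.den (invVars s)) x
      = ∑ a, ∑ b, (p.deriv (hVar a)).den (invVars x) * (q.deriv (hVar b)).den (invVars x)
        * (gramHSP a b).den (invVars x) := by
  have h1 : ∀ f, euclProd (fun s => invVars s 4) f x = 0 := fun f => by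
    simp [euclProd, pd_invVars_four]
  have h2 : ∀ f, euclProd f (fun s => invVars s 4) x = 0 := fun f => by rw [euclProd_symm, h1]
  have h3 : ∀ a : Fin 4, a.castSucc = hVar a := fun a => by fin_cases a <;> rfl
  rw [euclProd_den _ _ (invVars_differentiableAt x), Fin.sum_univ_castSucc]
  simp only [show Fin.last 4 = (4 : Fin 5) from rfl, h1, mul_zero, Finset.sum_const_zero, add_zero]
  refine Finset.sum_congr rfl fun a _ => ?_
  rw [Fin.sum_univ_castSucc]
  simp only [show Fin.last 4 = (4 : Fin 5) from rfl, h2, mul_zero, add_zero, h3, euclProd_invVars]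

noncomputable def invCoeff : Fin 3 → ℂ := ![1 / 15, 1 / 2, 1 / 2]

theorem basicInvariant_castSucc (x : Fin 4 → ℂ) (k : Fin 3) :
    basicInvariant x k.castSucc = invCoeff k * (invSP k).den (invVars x) := by
  fin_cases k
  · simp only [basicInvariant, invPoly1, invCoeff, invSP, invSP0, SP.den, listDen, invVars, SP.point,
      Mono.den_vec, Matrix.cons_val, Fin.zero_eta, Fin.castSucc_zero]
    push_cast
    ring
  · simp only [basicInvariant, invPoly2, invCoeff, invSP, invSP1, SP.den, listDen, invVars, SP.point,
      Mono.den_vec, Matrix.cons_val, Fin.mk_one, Fin.castSucc_one]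
    push_cast
    ring
  · simp only [basicInvariant, invPoly3, invCoeff, invSP, invSP2, SP.den, listDen, invVars, SP.point,
      Mono.den_vec, Matrix.cons_val, Fin.reduceFinMk, Fin.reduceCastSucc]
    push_cast
    ring

/-- `h₂ + x₁²`. -/
def normSP : SP := ⟨[⟨1, 1, 0, 0, 0, 0⟩, ⟨1, 0, 1, 0, 0, 0⟩], []⟩

theorem basicInvariant_three (x : Fin 4 → ℂ) : basicInvariant x 3 = normSP.den (invVars x) := by
  simp [basicInvariant, normSP, SP.den, listDen, invVars, SP.point, Mono.den_vec]
  ring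

theorem basicInvariant_three_eq (x : Fin 4 → ℂ) : basicInvariant x 3 = ∑ j, x j ^ 2 := by
  simp [basicInvariant, h2, eps1, Fin.sum_univ_four]
  ring

theorem euclProd_const_mul (c d : ℂ) (f g : (Fin 4 → ℂ) → ℂ) (x : Fin 4 → ℂ) :
    euclProd (fun s => c * f s) (fun s => d * g s) x = c * d * euclProd f g x := by
  simp only [euclProd, pd_const_mul, Finset.mul_sum]
  exact Finset.sum_congr rfl fun j _ => by ring

theorem gramHEx_den (v : Fin 5 → ℂ) (a b : Fin 4) :
    (gramHEx a b).den v = (gramHSP a b).den v := rfl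

theorem invFormEx_den (x : Fin 4 → ℂ) (k l : Fin 3) : (invFormEx k l).den (invVars x)
    = euclProd (fun s => (invSP k).den (invVars s)) (fun s => (invSP l).den (invVars s)) x := by
  rw [euclProd_den_invVars]
  simp only [invFormEx, sumEx_den, Ex.den, gramHEx_den, invDEx, Finset.mul_sum]
  exact Finset.sum_congr rfl fun a _ => Finset.sum_congr rfl fun b _ => by ring

theorem euclProd_basicInvariant (x : Fin 4 → ℂ) (k l : Fin 3) {c b : ℕ} {e : Ex} (hc : c ≠ 0)
    (h : (Ex.sub (.mul (.nat c) (invFormEx k l)) e).vanishes hWeights zeroSP b = true) :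
    euclProd (fun s => basicInvariant s k.castSucc) (fun s => basicInvariant s l.castSucc) x
      = invCoeff k * invCoeff l / c * e.den (invVars x) := by
  have h1 := Ex.den_sub_eq (Ex.den_eq_zero h
    ![h2 (x 1) (x 2) (x 3), x 0 ^ 2, h6 (x 1) (x 2) (x 3), h10 (x 1) (x 2) (x 3)])
  change _ = Ex.den (invVars x) e at h1
  rw [← h1]
  change _ = _ * ((Ex.nat c).den (invVars x) * (invFormEx k l).den (invVars x))
  rw [nat_den, invFormEx_den]
  simp only [basicInvariant_castSucc, euclProd_const_mul]
  have : (c : ℂ) ≠ 0 := Nat.cast_ne_zero.mpr hc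
  field_simp

theorem pd_basicInvariant_three (x : Fin 4 → ℂ) (j : Fin 4) :
    pd j (fun s => basicInvariant s 3) x = 2 * x j := by
  have h : HasFDerivAt (fun s : Fin 4 → ℂ => basicInvariant s 3)
      (∑ i, (2 * x i) • (ContinuousLinearMap.proj i : (Fin 4 → ℂ) →L[ℂ] ℂ)) x := by
    simp only [basicInvariant_three_eq]
    refine HasFDerivAt.fun_sum fun i _ => ?_
    have := (hasFDerivAt_apply (𝕜 := ℂ) i x).pow 2
    simpa using this
  rw [pd, h.fderiv]
  simp [Pi.single_apply]

theorem euclProd_basicInvariant_three_three (x : Fin 4 → ℂ) :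
    euclProd (fun s => basicInvariant s 3) (fun s => basicInvariant s 3) x
      = 4 * basicInvariant x 3 := by
  simp only [euclProd, pd_basicInvariant_three]
  simp only [basicInvariant_three_eq, Finset.mul_sum]
  exact Finset.sum_congr rfl fun j _ => by ring

/-- Half of the degrees of the invariants. -/
def halfDeg : Fin 4 → ℕ := ![15, 10, 6, 1]

/-- The gradient of `y_4` is `2x`, so this product is twice the radial derivative, to which Euler's
relation applies. It is carried out in the variables `h₂, x₁², h₆, h₁₀` with their weights. -/
theorem euclProd_basicInvariant_three_left (x : Fin 4 → ℂ) (l : Fin 3) :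
    euclProd (fun s => basicInvariant s 3) (fun s => basicInvariant s l.castSucc) x
      = 4 * invWt l * basicInvariant x l.castSucc := by
  have h1 := Ex.den_sub_eq (Ex.den_eq_zero (eulerInvSP_check l)
    ![h2 (x 1) (x 2) (x 3), x 0 ^ 2, h6 (x 1) (x 2) (x 3), h10 (x 1) (x 2) (x 3)])
  change Ex.den (invVars x) _ = Ex.den (invVars x) _ at h1
  simp only [sumEx_den, Ex.den, nat_den, invDEx, invEx] at h1
  have h2 := euclProd_const_mul 1 (invCoeff l) (fun s => normSP.den (invVars s))
    (fun s => (invSP l).den (invVars s)) x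
  simp only [one_mul, ← basicInvariant_castSucc, ← basicInvariant_three] at h2
  rw [h2]
  simp only [basicInvariant_three]
  rw [basicInvariant_castSucc, euclProd_den_invVars, Finset.sum_comm]
  have h3 : ∀ b, ∑ a, (normSP.deriv (hVar a)).den (invVars x) * ((invSP l).deriv (hVar b)).den
      (invVars x) * (gramHSP a b).den (invVars x)
      = 4 * ((hWt b : ℂ) * ((hEx b).den (invVars x) * ((invSP l).deriv (hVar b)).den
      (invVars x))) := fun b => by
    have : (normSP.deriv (hVar 0)).den (invVars x) = 1 := by
      simp [normSP, hVar, SP.deriv, Mono.deriv, SP.den, listDen, Mono.den]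
    have : (normSP.deriv (hVar 1)).den (invVars x) = 1 := by
      simp [normSP, hVar, SP.deriv, Mono.deriv, SP.den, listDen, Mono.den]
    have : (normSP.deriv (hVar 2)).den (invVars x) = 0 := by
      simp [normSP, hVar, SP.deriv, Mono.deriv, SP.den, listDen, Mono.den]
    have : (normSP.deriv (hVar 3)).den (invVars x) = 0 := by
      simp [normSP, hVar, SP.deriv, Mono.deriv, SP.den, listDen, Mono.den]
    have : (gramHSP 0 b).den (invVars x) + (gramHSP 1 b).den (invVars x)
        = 4 * (hWt b * (hEx b).den (invVars x)) := by
      fin_cases b <;>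
        simp [gramHSP, zeroSP, SP.den, listDen, Mono.den, hWt, hEx, Ex.den] <;> ring
    simp only [Fin.sum_univ_four, *]
    linear_combination ((invSP l).deriv (hVar b)).den (invVars x) * this
  simp only [h3, ← Finset.mul_sum, h1]
  ring

theorem invEx_den (x : Fin 4 → ℂ) (k : Fin 3) :
    (invEx k).den (invVars x) = (invCoeff k)⁻¹ * basicInvariant x k.castSucc := by
  have h : invCoeff k ≠ 0 := by fin_cases k <;> simp [invCoeff]
  rw [basicInvariant_castSucc, inv_mul_cancel_left₀ h]
  rfl

theorem y4Ex_den (x : Fin 4 → ℂ) (c k : ℕ) :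
    (y4Ex c k).den (invVars x) = c * basicInvariant x 3 ^ k := by
  induction k with
  | zero => simp [y4Ex, nat_den]
  | succ k ih =>
    rw [y4Ex, Ex.den, ih, basicInvariant_three]
    change normSP.den (invVars x) * _ = _
    ring

/-- Second half of the comparison of metrics, with the same matrix as `gradProd_relY_eq_gramMatrix`.
-/
theorem euclProd_basicInvariant_eq_gramMatrix (x : Fin 4 → ℂ) (k l : Fin 4) :
    euclProd (fun s => basicInvariant s k) (fun s => basicInvariant s l) x
      = gramMatrix (basicInvariant x) k l := by
  have h00 := euclProd_basicInvariant x 0 0 one_ne_zero invForm_check00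
  have h01 := euclProd_basicInvariant x 0 1 one_ne_zero invForm_check01
  have h02 := euclProd_basicInvariant x 0 2 one_ne_zero invForm_check02
  have h11 := euclProd_basicInvariant x 1 1 three_ne_zero invForm_check11
  have h12 := euclProd_basicInvariant x 1 2 one_ne_zero invForm_check12
  have h22 := euclProd_basicInvariant x 2 2 one_ne_zero invForm_check22
  have h33 : euclProd (fun s => basicInvariant s 3) (fun s => basicInvariant s 3) x
      = 4 * basicInvariant x 3 := euclProd_basicInvariant_three_three x
  have h30 := euclProd_basicInvariant_three_left x 0
  have h31 := euclProd_basicInvariant_three_left x 1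
  have h32 := euclProd_basicInvariant_three_left x 2
  simp only [invGramEx00, invGramEx01, invGramEx02, invGramEx11, invGramEx12, invGramEx22, Ex.den,
    Ex.den_sub, Ex.den_neg, invEx_den, y4Ex_den, invCoeff, invWt, Matrix.cons_val,
    show (0 : Fin 3).castSucc = 0 from rfl, show (1 : Fin 3).castSucc = 1 from rfl,
    show (2 : Fin 3).castSucc = 2 from rfl] at h00 h01 h02 h11 h12 h22 h30 h31 h32
  have hsymm := fun k l => euclProd_symm (fun s => basicInvariant s k)
    (fun s => basicInvariant s l) x
  generalize basicInvariant x = y at h00 h01 h02 h11 h12 h22 h30 h31 h32 h33 ⊢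
  fin_cases k <;> fin_cases l <;> simp only [gramMatrix, Matrix.of_apply, Matrix.cons_val,
    Fin.zero_eta, Fin.mk_one, Fin.reduceFinMk]
  · rw [h00]; push_cast; ring
  · rw [h01]; push_cast; ring
  · rw [h02]; push_cast; ring
  · rw [hsymm, h30]; push_cast; ring
  · rw [hsymm, h01]; push_cast; ring
  · rw [h11]; push_cast; ring
  · rw [h12]; push_cast; ring
  · rw [hsymm, h31]; push_cast; ring
  · rw [hsymm, h02]; push_cast; ring
  · rw [hsymm, h12]; push_cast; ring
  · rw [h22]; push_cast; ring
  · rw [hsymm, h32]; push_cast; ring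
  · rw [h30]; push_cast; ring
  · rw [h31]; push_cast; ring
  · rw [h32]; push_cast; ring
  · exact h33

theorem euler_basicInvariant (x : Fin 4 → ℂ) (k : Fin 4) :
    ∑ j, x j * pd j (fun s => basicInvariant s k) x = 2 * halfDeg k * basicInvariant x k := by
  have h : euclProd (fun s => basicInvariant s 3) (fun s => basicInvariant s k) x
      = 4 * halfDeg k * basicInvariant x k := by
    refine Fin.lastCases ?_ (fun k => ?_) k
    · change euclProd (fun s => basicInvariant s 3) (fun s => basicInvariant s 3) x
        = 4 * ((1 : ℕ) : ℂ) * basicInvariant x 3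
      rw [euclProd_basicInvariant_three_three, Nat.cast_one, mul_one]
    · rw [euclProd_basicInvariant_three_left]
      fin_cases k <;> rfl
  simp only [euclProd, pd_basicInvariant_three, mul_assoc, ← Finset.mul_sum] at h
  linear_combination h / 2

theorem invVars_analyticAt (x : Fin 4 → ℂ) (i : Fin 5) :
    AnalyticAt ℂ (fun s => invVars s i) x := by
  refine ContDiffAt.analyticAt (𝕜 := ℂ) ?_
  fin_cases i
  · change ContDiffAt ℂ _ (fun s : Fin 4 → ℂ => h2 (s 1) (s 2) (s 3)) x
    simp only [h2, eps1]
    fun_prop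
  · change ContDiffAt ℂ _ (fun s : Fin 4 → ℂ => s 0 ^ 2) x
    fun_prop
  · change ContDiffAt ℂ _ (fun s : Fin 4 → ℂ => h6 (s 1) (s 2) (s 3)) x
    simp only [h6, eps1, eps2, eps3, delta]
    fun_prop
  · change ContDiffAt ℂ _ (fun s : Fin 4 → ℂ => h10 (s 1) (s 2) (s 3)) x
    simp only [h10, eps1, eps2, eps3, delta]
    fun_prop
  · exact contDiffAt_const.congr_of_eventuallyEq (.of_forall fun s => invVars_four s)

theorem basicInvariant_analyticAt (x : Fin 4 → ℂ) : AnalyticAt ℂ basicInvariant x := by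
  refine analyticAt_pi_iff.mpr fun k => Fin.lastCases ?_ (fun k => ?_) k
  · exact (normSP.analyticAt (invVars_analyticAt x)).congr
      (.of_forall fun s => (basicInvariant_three s).symm)
  · exact (analyticAt_const.mul ((invSP k).analyticAt (invVars_analyticAt x))).congr
      (.of_forall fun s => (basicInvariant_castSucc s k).symm)

end H47

/-! ### The orbit map: nullcone, properness, and image off the discriminant. -/

namespace H47

open Filter Topology

section Nullcone

theorem invPoly_eq_zero {x a b c : ℂ} (h₁ : invPoly1 x a b c = 0) (h₂ : invPoly2 x a b c = 0)
    (h₃ : invPoly3 x a b c = 0) (h₄ : x ^ 2 + a = 0) : x = 0 ∧ a = 0 ∧ b = 0 ∧ c = 0 := by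
  obtain rfl : a = -x ^ 2 := by linear_combination h₄
  by_cases hx : x = 0
  · subst hx
    have hb : b = 0 := by
      have : b ^ 2 = 0 := by
        simp only [invPoly3] at h₃
        linear_combination 2 / 3 * h₃
      simpa using this
    have hc : c = 0 := by
      have : c ^ 2 = 0 := by
        simp only [invPoly2, hb] at h₂
        linear_combination h₂
      simpa using this
    simp [hb, hc]
  · exfalso
    -- By homogeneity `x` can be scaled out. The third equation is linear in `q`, and what remains
    -- is a quartic and a sextic in `p`.
    obtain ⟨p, rfl⟩ : ∃ p, b = p * x ^ 6 := ⟨b / x ^ 6, by field_simp⟩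
    obtain ⟨q, rfl⟩ : ∃ q, c = q * x ^ 10 := ⟨c / x ^ 10, by field_simp⟩
    have hq : q = -5 / 2 - 11 / 2 * p - p ^ 2 / 8 := by
      refine mul_left_cancel₀ (pow_ne_zero 12 hx) ?_
      simp only [invPoly3] at h₃
      linear_combination h₃ / 12
    subst hq
    have e₂ : -9455 / 4 - 12875 / 2 * p + 10555 / 8 * p ^ 2 + 365 / 8 * p ^ 3 + p ^ 4 / 64 = 0 := by
      refine mul_left_cancel₀ (pow_ne_zero 20 hx) ?_
      simp only [invPoly2] at h₂
      linear_combination h₂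
    have e₁ : -517625 / 6 + 187075 / 2 * p + 5628075 / 8 * p ^ 2 + 82295 / 12 * p ^ 3
        + 137715 / 32 * p ^ 4 + 2783 / 160 * p ^ 5 - p ^ 6 / 384 = 0 := by
      refine mul_left_cancel₀ (pow_ne_zero 30 hx) ?_
      simp only [invPoly1] at h₁
      linear_combination h₁
    -- A Bézout certificate: the quartic and the sextic are coprime.
    have : (1 : ℂ) = 0 := by
      linear_combination (3406803018637 / 6333186975989760 - 2270918942965 / 844424930131968 * p
        - 263061784423 / 12666373951979520 * p ^ 2 - 139052604001 / 8444249301319680 * p ^ 3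
        - 33767736203 / 506654958079180800 * p ^ 4 + 2022161 / 202661983231672320 * p ^ 5) * e₂
        + (-22233883775 / 844424930131968 + 8438776879 / 1688849860263936 * p
        + 196801113 / 1125899906842624 * p ^ 2 + 2022161 / 33776997205278720 * p ^ 3) * e₁
    exact one_ne_zero this

/-- With `e₁ = 0` one has `h₁₀ - 3 e₂ h₆ = 128 e₂ e₃`, so `e₂` or `e₃` vanishes. Eliminating `delta`
between `h₆ = 0` and `delta_sq` gives a relation between `e₃²` and `e₂³` that kills the other. -/
theorem eps_eq_zero {a b c : ℂ} (h₂ : h2 a b c = 0) (h₆ : h6 a b c = 0) (h₁₀ : h10 a b c = 0) :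
    eps1 a b c = 0 ∧ eps2 a b c = 0 ∧ eps3 a b c = 0 := by
  have hd := delta_sq a b c
  have hr := sqrtFive_sq
  simp only [h6, h10, h2] at *
  generalize eps1 a b c = e₁ at *
  generalize eps2 a b c = e₂ at *
  generalize eps3 a b c = e₃ at *
  generalize delta a b c = d at *
  subst h₂
  have h23 : e₂ * e₃ = 0 := by linear_combination (h₁₀ - 3 * e₂ * h₆) / 128
  have h : 256 * e₃ ^ 2 + 20 * e₂ ^ 3 = 0 := by
    linear_combination -(sqrtFive * d + 11 * e₃) * h₆ + d ^ 2 * hr + 5 * hd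
  refine ⟨rfl, ?_⟩
  rcases mul_eq_zero.mp h23 with rfl | rfl
  · exact ⟨rfl, by simpa using h⟩
  · exact ⟨by simpa using h, rfl⟩

/-- The squares are the roots of the cubic whose coefficients are `eps1`, `eps2`, `eps3`, which has
become `T³`. -/
theorem eq_zero_of_eps {a b c : ℂ} (h₁ : eps1 a b c = 0) (h₂ : eps2 a b c = 0)
    (h₃ : eps3 a b c = 0) : a = 0 ∧ b = 0 ∧ c = 0 := by
  simp only [eps1, eps2, eps3] at *
  refine ⟨pow_eq_zero_iff (n := 6) (by norm_num) |>.mp ?_,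
    pow_eq_zero_iff (n := 6) (by norm_num) |>.mp ?_,
    pow_eq_zero_iff (n := 6) (by norm_num) |>.mp ?_⟩
  · linear_combination a ^ 4 * h₁ - a ^ 2 * h₂ + h₃
  · linear_combination b ^ 4 * h₁ - b ^ 2 * h₂ + h₃
  · linear_combination c ^ 4 * h₁ - c ^ 2 * h₂ + h₃

theorem eq_zero_of_basicInvariant {x : Fin 4 → ℂ} (h : basicInvariant x = 0) : x = 0 := by
  obtain ⟨h0, h2, h6, h10⟩ := invPoly_eq_zero (congrFun h 0) (congrFun h 1) (congrFun h 2)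
    (congrFun h 3)
  obtain ⟨e1, e2, e3⟩ := eps_eq_zero h2 h6 h10
  obtain ⟨h1, h2, h3⟩ := eq_zero_of_eps e1 e2 e3
  funext i
  fin_cases i
  · exact h0
  · exact h1
  · exact h2
  · exact h3

end Nullcone

section Proper

theorem basicInvariant_smul (c : ℂ) (x : Fin 4 → ℂ) (k : Fin 4) :
    basicInvariant (c • x) k = c ^ (2 * halfDeg k) * basicInvariant x k := by
  have h2' : h2 (c * x 1) (c * x 2) (c * x 3) = c ^ 2 * h2 (x 1) (x 2) (x 3) := by
    simp only [h2, eps1]; ring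
  have h6' : h6 (c * x 1) (c * x 2) (c * x 3) = c ^ 6 * h6 (x 1) (x 2) (x 3) := by
    simp only [h6, eps1, eps2, eps3, delta]; ring
  have h10' : h10 (c * x 1) (c * x 2) (c * x 3) = c ^ 10 * h10 (x 1) (x 2) (x 3) := by
    simp only [h10, eps1, eps2, eps3, delta]; ring
  simp only [basicInvariant, Pi.smul_apply, smul_eq_mul, h2', h6', h10']
  fin_cases k <;> simp only [halfDeg, Fin.zero_eta, Fin.mk_one, Fin.reduceFinMk, Matrix.cons_val,
    invPoly1, invPoly2, invPoly3] <;> ring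

theorem basicInvariant_continuous : Continuous basicInvariant :=
  continuous_iff_continuousAt.mpr fun x => (basicInvariant_analyticAt x).continuousAt

/-- The constant is the minimum of the norm on the unit sphere, positive because the nullcone is
trivial. Outside the unit ball each coordinate grows at least linearly, as every degree is positive.
-/
theorem exists_norm_le_norm_basicInvariant :
    ∃ m > 0, ∀ x : Fin 4 → ℂ, 1 ≤ ‖x‖ → m * ‖x‖ ≤ ‖basicInvariant x‖ := by
  obtain ⟨u, hu, hmin⟩ := (isCompact_sphere (0 : Fin 4 → ℂ) 1).exists_isMinOn
    (NormedSpace.sphere_nonempty.mpr zero_le_one)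
    basicInvariant_continuous.norm.continuousOn
  have hu1 : ‖u‖ = 1 := by simpa using hu
  refine ⟨‖basicInvariant u‖, norm_pos_iff.mpr fun h => ?_, fun x hx => ?_⟩
  · rw [eq_zero_of_basicInvariant h, norm_zero] at hu1
    exact zero_ne_one hu1
  · have hx0 : ‖x‖ ≠ 0 := (zero_lt_one.trans_le hx).ne'
    set v : Fin 4 → ℂ := ((‖x‖⁻¹ : ℝ) : ℂ) • x with hv
    have hv1 : v ∈ Metric.sphere (0 : Fin 4 → ℂ) 1 := by
      simp [hv, norm_smul, hx0]
    have hxv : x = (‖x‖ : ℂ) • v := by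
      rw [hv, smul_smul, ← Complex.ofReal_mul, mul_inv_cancel₀ hx0, Complex.ofReal_one, one_smul]
    have h1 : ‖basicInvariant u‖ ≤ ‖basicInvariant v‖ := hmin hv1
    refine (mul_le_mul_of_nonneg_right h1 (norm_nonneg x)).trans ?_
    rw [mul_comm, ← abs_of_nonneg (norm_nonneg x), ← Real.norm_eq_abs, ← norm_smul]
    refine (pi_norm_le_iff_of_nonneg (norm_nonneg _)).mpr fun k => ?_
    refine le_trans ?_ (norm_le_pi_norm (basicInvariant x) k)
    conv_rhs => rw [hxv, basicInvariant_smul]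
    rw [Pi.smul_apply, norm_smul, norm_mul, norm_pow, Complex.norm_real]
    refine mul_le_mul_of_nonneg_right ?_ (norm_nonneg _)
    rw [norm_norm]
    exact le_self_pow₀ hx (by fin_cases k <;> simp [halfDeg])

theorem isClosed_range_basicInvariant : IsClosed (Set.range basicInvariant) := by
  refine (isProperMap_iff_tendsto_cocompact.mpr
    ⟨basicInvariant_continuous, ?_⟩).isClosedMap.isClosed_range
  rw [← Metric.cobounded_eq_cocompact, ← tendsto_norm_atTop_iff_cobounded]
  obtain ⟨m, hm, h⟩ := exists_norm_le_norm_basicInvariant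
  have hn : Tendsto (fun x : Fin 4 → ℂ => ‖x‖) (Bornology.cobounded _) atTop :=
    tendsto_norm_cobounded_atTop
  exact tendsto_atTop_mono' _ ((hn.eventually_ge_atTop 1).mono h) (hn.const_mul_atTop hm)

end Proper

section Jacobian

/-- The Jacobian matrix. -/
noncomputable def jac (f : (Fin 4 → ℂ) → Fin 4 → ℂ) (x : Fin 4 → ℂ) : Matrix (Fin 4) (Fin 4) ℂ :=
  Matrix.of fun k j => pd j (fun s => f s k) x

theorem fderiv_eq_jac {f : (Fin 4 → ℂ) → Fin 4 → ℂ} {x : Fin 4 → ℂ}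
    (hf : DifferentiableAt ℂ f x) : fderiv ℂ f x = (Matrix.toLin' (jac f x)).toContinuousLinearMap := by
  refine ContinuousLinearMap.coe_injective (LinearMap.pi_ext' fun j => LinearMap.ext_ring ?_)
  funext k
  have h : HasFDerivAt (fun s => f s k)
      ((ContinuousLinearMap.proj k : (Fin 4 → ℂ) →L[ℂ] ℂ).comp (fderiv ℂ f x)) x :=
    (hasFDerivAt_apply (𝕜 := ℂ) k (f x)).comp x hf.hasFDerivAt
  simp [jac, pd, h.fderiv]

theorem exists_equiv_of_jac_det_ne_zero {f : (Fin 4 → ℂ) → Fin 4 → ℂ} {x : Fin 4 → ℂ}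
    (hf : DifferentiableAt ℂ f x) (h : (jac f x).det ≠ 0) :
    ∃ e : (Fin 4 → ℂ) ≃L[ℂ] (Fin 4 → ℂ), (e : (Fin 4 → ℂ) →L[ℂ] (Fin 4 → ℂ)) = fderiv ℂ f x := by
  refine ⟨(Matrix.toLinearEquiv' (jac f x)
    (Matrix.invertibleOfIsUnitDet _ h.isUnit)).toContinuousLinearEquiv, ?_⟩
  rw [fderiv_eq_jac hf]
  ext v
  rfl

theorem jac_basicInvariant (x : Fin 4 → ℂ) :
    jac basicInvariant x * (jac basicInvariant x).transpose = gramMatrix (basicInvariant x) := by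
  ext k l
  rw [← euclProd_basicInvariant_eq_gramMatrix]
  rfl

theorem jac_basicInvariant_det_ne_zero {x : Fin 4 → ℂ}
    (h : (gramMatrix (basicInvariant x)).det ≠ 0) : (jac basicInvariant x).det ≠ 0 := by
  rw [← jac_basicInvariant, Matrix.det_mul] at h
  exact left_ne_zero_of_mul h

theorem range_basicInvariant_mem_nhds {x : Fin 4 → ℂ}
    (h : (gramMatrix (basicInvariant x)).det ≠ 0) :
    Set.range basicInvariant ∈ 𝓝 (basicInvariant x) := by
  have ha := basicInvariant_analyticAt x
  obtain ⟨e, he⟩ := exists_equiv_of_jac_det_ne_zero ha.differentiableAt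
    (jac_basicInvariant_det_ne_zero h)
  have hs := ha.hasStrictFDerivAt
  rw [← he] at hs
  rw [← hs.map_nhds_eq_of_equiv]
  exact range_mem_map

end Jacobian

section Discriminant

/-- At `y_4 = 0` the diagonal of the Gram matrix vanishes, and the determinant of a symmetric matrix
of size four with zero diagonal depends only on the three products of opposite entries. All tests of
regularity are therefore made on `y_4 = 0`. -/
theorem gramMatrix_det_of_three_eq_zero {y : Fin 4 → ℂ} (h : y 3 = 0) :
    (gramMatrix y).det = (32 * 24 * y 2 ^ 5) ^ 2 + (80 * 40 * y 1 ^ 3) ^ 2 + (1800 * y 0 ^ 2) ^ 2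
      - 2 * (32 * 24 * y 2 ^ 5) * (80 * 40 * y 1 ^ 3)
      - 2 * (1800 * y 0 ^ 2) * (32 * 24 * y 2 ^ 5 + 80 * 40 * y 1 ^ 3) := by
  simp [gramMatrix, h, Matrix.det_succ_row_zero, Fin.sum_univ_succ, Fin.succAbove]
  ring

/-- A point outside of the mirrors. -/
noncomputable def regularPoint : Fin 4 → ℂ := ![3 * Complex.I, 2, 2, 1]

/-- The point is isotropic, as `-9 + 4 + 4 + 1 = 0`, so `y_4` vanishes; its two equal coordinates
kill `delta` and with it `√5`, so all values are rational. -/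
theorem basicInvariant_regularPoint :
    basicInvariant regularPoint = ![764214457557600000, 606761244180, 13580430, 0] := by
  have hI : (3 * Complex.I) ^ 2 = -9 := by
    rw [mul_pow, Complex.I_sq]
    norm_num
  have h2' : h2 2 2 1 = 9 := by norm_num [h2, eps1]
  have h6' : h6 2 2 1 = 40 := by norm_num [h6, eps1, eps2, eps3, delta]
  have h10' : h10 2 2 1 = 4080 := by norm_num [h10, eps1, eps2, eps3, delta]
  have hp : ∀ n, (3 * Complex.I) ^ (2 * n) = (-9) ^ n := fun n => by rw [pow_mul, hI]
  simp only [basicInvariant, regularPoint, Matrix.cons_val, h2', h6', h10', invPoly1, invPoly2,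
    invPoly3]
  norm_num [hp 1, hp 2, hp 3, hp 4, hp 5, hp 6, hp 7, hp 8, hp 9, hp 10, hp 11, hp 12]

theorem gramMatrix_regularPoint_det_ne_zero :
    (gramMatrix (basicInvariant regularPoint)).det ≠ 0 := by
  rw [basicInvariant_regularPoint, gramMatrix_det_of_three_eq_zero rfl]
  simp only [Matrix.cons_val]
  norm_num

theorem gramMatrix_det_analyticAt (y : Fin 4 → ℂ) :
    AnalyticAt ℂ (fun y => (gramMatrix y).det) y := by
  have h : ∀ i j, AnalyticAt ℂ (fun y => gramMatrix y i j) y := fun i j => by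
    refine ContDiffAt.analyticAt (𝕜 := ℂ) ?_
    fin_cases i <;> fin_cases j <;>
      simp only [gramMatrix, Matrix.of_apply, Matrix.cons_val, Fin.zero_eta, Fin.mk_one,
        Fin.reduceFinMk] <;> fun_prop
  simp only [Matrix.det_apply']
  exact Finset.analyticAt_fun_sum _ fun σ _ => analyticAt_const.mul
    (Finset.analyticAt_fun_prod _ fun i _ => h _ _)

/-- A connectedness argument along the complex line from a known regular value to `y`. Off the
discriminant the image of the orbit map is both open and closed. -/
theorem mem_range_basicInvariant {y : Fin 4 → ℂ} (hy : (gramMatrix y).det ≠ 0) :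
    y ∈ Set.range basicInvariant := by
  set L : ℂ → Fin 4 → ℂ := fun z =>
    basicInvariant regularPoint + z • (y - basicInvariant regularPoint) with hL
  have hLa : ∀ z, AnalyticAt ℂ L z := fun z =>
    analyticAt_const.add (analyticAt_id.smul analyticAt_const)
  have hg : AnalyticOnNhd ℂ (fun z => (gramMatrix (L z)).det) Set.univ := fun z _ =>
    (gramMatrix_det_analyticAt (L z)).comp (hLa z)
  have h1 : (gramMatrix (L 1)).det ≠ 0 := by simpa [hL] using hy
  obtain ⟨hc, hd⟩ := mem_codiscrete'.mp (hg.preimage_zero_mem_codiscrete h1)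
  -- The zeros on the line are discrete, hence countable, and a countable set does not disconnect
  -- the plane.
  have hcount : ((fun z => (gramMatrix (L z)).det) ⁻¹' {0}ᶜ)ᶜ.Countable :=
    (HereditarilyLindelofSpace.isLindelof _).countable_of_isDiscrete hd
  have hconn := (hcount.isConnected_compl_of_one_lt_rank
    (by rw [Complex.rank_real_complex]; norm_num)).isPreconnected
  rw [compl_compl] at hconn
  set A := (fun z => (gramMatrix (L z)).det) ⁻¹' {0}ᶜ with hA
  have hpre : IsPreconnected (L '' A) := hconn.image L fun z _ =>
    (hLa z).continuousAt.continuousWithinAt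
  have hsub : L '' A ⊆ interior (Set.range basicInvariant) := by
    refine hpre.subset_left_of_subset_union isOpen_interior
      isClosed_range_basicInvariant.isOpen_compl
      (disjoint_compl_right.mono_left interior_subset) ?_ ?_
    · rintro _ ⟨z, hz, rfl⟩
      by_cases h : L z ∈ Set.range basicInvariant
      · left
        obtain ⟨x, hx⟩ := h
        have hz' : (gramMatrix (L z)).det ≠ 0 := hz
        rw [← hx] at hz' ⊢
        exact mem_interior_iff_mem_nhds.mpr (range_basicInvariant_mem_nhds hz')
      · exact Or.inr h
    · refine ⟨basicInvariant regularPoint, ⟨0, ?_, by simp [hL]⟩,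
        mem_interior_iff_mem_nhds.mpr
          (range_basicInvariant_mem_nhds gramMatrix_regularPoint_det_ne_zero)⟩
      simpa [hA, hL] using gramMatrix_regularPoint_det_ne_zero
  exact interior_subset (hsub ⟨1, h1, by simp [hL]⟩)

end Discriminant

end H47

/-! ### Density of the regular points. -/

namespace H47

open SparsePoly Filter Topology

section Branch

variable {U : Set (Fin 4 → ℂ)} {Z : (Fin 4 → ℂ) → ℂ}

theorem relY_analyticAt (hZ : IsBranch U Z) {t : Fin 4 → ℂ} (ht : t ∈ U) :
    AnalyticAt ℂ (fun s => relY s (Z s)) t := by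
  refine analyticAt_pi_iff.mpr fun k => Fin.lastCases ?_ (fun k => ?_) k
  · exact analyticAt_const.mul
      ((ContinuousLinearMap.proj (R := ℂ) (φ := fun _ : Fin 4 => ℂ) 3).analyticAt t)
  · exact (analyticAt_const.mul (den_vars_analyticAt hZ (relSP k) ht)).congr
      (.of_forall fun s => (relY_castSucc s k).symm)

/-- The coordinates `Z, t₁, t₃, t₄ / 5`. -/
noncomputable def branchCoords (Z : (Fin 4 → ℂ) → ℂ) (t : Fin 4 → ℂ) : Fin 4 → ℂ :=
  ![Z t, t 0, t 2, t 3 / 5]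

theorem branchCoords_analyticAt (hZ : IsBranch U Z) {t : Fin 4 → ℂ} (ht : t ∈ U) :
    AnalyticAt ℂ (branchCoords Z) t := by
  refine analyticAt_pi_iff.mpr fun i => ?_
  have h := vars_analyticAt hZ ht i.castSucc
  fin_cases i <;> exact h

/-- `Z` may replace `t₂` as a coordinate because `∂Z/∂t₂ ≠ 0`; up to a constant that derivative is
the determinant. -/
theorem branchCoords_jac_det_ne_zero (hZ : IsBranch U Z) {t : Fin 4 → ℂ} (ht : t ∈ U) :
    (jac (branchCoords Z) t).det ≠ 0 := by
  have h : jac (branchCoords Z) t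
      = !![pd 0 Z t, pd 1 Z t, pd 2 Z t, pd 3 Z t; 1, 0, 0, 0; 0, 0, 1, 0; 0, 0, 0, 1 / 5] := by
    have h3 : ∀ j, pd j (fun s => branchCoords Z s 3) t
        = 1 / 5 * if (3 : Fin 4) = j then 1 else 0 := fun j => by
      rw [← pd_coord 3 j t, ← pd_const_mul]
      congr 1
      funext s
      simp [branchCoords]
      ring
    ext i j
    fin_cases i
    · change pd j Z t = _
      fin_cases j <;> rfl
    · refine (pd_coord 0 j t).trans ?_
      fin_cases j <;> rfl
    · refine (pd_coord 2 j t).trans ?_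
      fin_cases j <;> rfl
    · refine (h3 j).trans ?_
      fin_cases j <;> simp
  have hd : (jac (branchCoords Z) t).det = -(1 / 5) * pd 1 Z t := by
    rw [h]
    simp [Matrix.det_succ_row_zero, Fin.sum_univ_succ, Fin.succAbove]
    try ring
  rw [hd]
  exact mul_ne_zero (by norm_num) (pd_Z_one_ne_zero hZ ht)

theorem map_branchCoords (hZ : IsBranch U Z) {t : Fin 4 → ℂ} (ht : t ∈ U) :
    map (branchCoords Z) (𝓝 t) = 𝓝 (branchCoords Z t) := by
  have ha := branchCoords_analyticAt hZ ht
  obtain ⟨e, he⟩ := exists_equiv_of_jac_det_ne_zero ha.differentiableAt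
    (branchCoords_jac_det_ne_zero hZ ht)
  have hs := ha.hasStrictFDerivAt
  rw [← he] at hs
  exact hs.map_nhds_eq_of_equiv

/-- The right-hand sides of the relations as functions of `Z, t₁, t₃, t₄ / 5`. -/
noncomputable def relPoint (p : Fin 4 → ℂ) : Fin 4 → ℂ :=
  Fin.snoc (α := fun _ => ℂ) (fun k : Fin 3 => relCoeff k * (relSP k).den (rootSP.point p))
    (200 / 3 * p 3)

theorem relPoint_castSucc (p : Fin 4 → ℂ) (k : Fin 3) :
    relPoint p k.castSucc = relCoeff k * (relSP k).den (rootSP.point p) :=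
  Fin.snoc_castSucc (α := fun _ => ℂ) _ _ k

theorem relPoint_three (p : Fin 4 → ℂ) : relPoint p 3 = 200 / 3 * p 3 :=
  Fin.snoc_last (α := fun _ => ℂ) _ _

theorem relPoint_branchCoords (hZ : IsBranch U Z) {t : Fin 4 → ℂ} (ht : t ∈ U) :
    relPoint (branchCoords Z t) = relY t (Z t) := by
  funext k
  refine Fin.lastCases ?_ (fun k => ?_) k
  · refine (relPoint_three _).trans ?_
    change 200 / 3 * (t 3 / 5) = 40 / 3 * t 3
    ring
  · rw [relPoint_castSucc, relY_castSucc, vars_eq_point hZ ht]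
    rfl

theorem relPoint_analyticAt (p : Fin 4 → ℂ) : AnalyticAt ℂ relPoint p := by
  have hp : ∀ i, AnalyticAt ℂ (fun s : Fin 4 → ℂ => s i) p := fun i =>
    (ContinuousLinearMap.proj (R := ℂ) (φ := fun _ : Fin 4 => ℂ) i).analyticAt p
  have h4 : AnalyticAt ℂ (fun s : Fin 4 → ℂ => rootSP.den ![s 0, s 1, s 2, s 3, 0]) p := by
    refine SP.analyticAt (v := fun s : Fin 4 → ℂ => ![s 0, s 1, s 2, s 3, 0]) _ fun i => ?_
    fin_cases i
    · exact hp 0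
    · exact hp 1
    · exact hp 2
    · exact hp 3
    · exact analyticAt_const
  have h : ∀ i, AnalyticAt ℂ (fun s : Fin 4 → ℂ => rootSP.point s i) p := by
    intro i
    simp only [SP.point]
    fin_cases i
    · exact hp 0
    · exact hp 1
    · exact hp 2
    · exact hp 3
    · exact h4
  refine analyticAt_pi_iff.mpr fun k => Fin.lastCases ?_ (fun k => ?_) k
  · exact (analyticAt_const.mul (hp 3)).congr
      (.of_forall fun s => (relPoint_three s).symm)
  · exact (analyticAt_const.mul ((relSP k).analyticAt h)).congr
      (.of_forall fun s => (relPoint_castSucc s k).symm)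

/-- At `Z = 1`, `t₁ = t₃ = t₄ = 0` one has `t₂ = 1`, and only the monomials in `Z` and `t₂` alone
survive. Here `y_4 = 0`, so the short formula for the determinant applies. -/
theorem relSP_den_point (k : Fin 3) : (relSP k).den (rootSP.point ![(1 : ℤ), 0, 0, 0])
    = ![12817, -42, 52] k := by
  revert k
  decide +kernel

theorem relPoint_eq : relPoint ![1, 0, 0, 0]
    = ![relCoeff 0 * 12817, relCoeff 1 * -42, relCoeff 2 * 52, 0] := by
  have h : ∀ k, (relSP k).den (rootSP.point ![(1 : ℂ), 0, 0, 0])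
      = ((![12817, -42, 52] k : ℤ) : ℂ) := fun k => by
    rw [← relSP_den_point, ← eq_intCast (Int.castRingHom ℂ), SP.den_map, SP.point_map]
    congr 2
    funext i
    fin_cases i <;> simp
  funext k
  refine Fin.lastCases ?_ (fun k => ?_) k
  · refine (relPoint_three _).trans ?_
    simp
  · rw [relPoint_castSucc, h]
    fin_cases k <;> simp

theorem gramMatrix_relPoint_det_ne_zero :
    (gramMatrix (relPoint ![1, 0, 0, 0])).det ≠ 0 := by
  rw [relPoint_eq, gramMatrix_det_of_three_eq_zero rfl]
  simp only [Matrix.cons_val, relCoeff]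
  norm_num

/-- The points of the domain of the branch outside of the discriminant. -/
def regularSet (U : Set (Fin 4 → ℂ)) (Z : (Fin 4 → ℂ) → ℂ) : Set (Fin 4 → ℂ) :=
  {t ∈ U | (gramMatrix (relY t (Z t))).det ≠ 0}

theorem isOpen_regularSet (hZ : IsBranch U Z) : IsOpen (regularSet U Z) := by
  refine isOpen_iff_mem_nhds.mpr fun t ht => ?_
  have h : ContinuousAt (fun t => (gramMatrix (relY t (Z t))).det) t :=
    ((gramMatrix_det_analyticAt _).comp (relY_analyticAt hZ ht.1)).continuousAt
  exact inter_mem (hZ.1.mem_nhds ht.1) (h.eventually_ne ht.2)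

/-- The hypersurface is globally parametrised by `ℂ⁴`, and on it the discriminant is one analytic
function, the same for all branches. Were it zero near a point of `U`, it would vanish identically,
against its value at `(1, 0, 0, 0)`. The test point need not lie on the given branch. -/
theorem subset_closure_regularSet (hZ : IsBranch U Z) : U ⊆ closure (regularSet U Z) := by
  intro t ht
  by_contra hc
  rw [mem_closure_iff_frequently, not_frequently] at hc
  have h0 : ∀ᶠ s in 𝓝 t, (gramMatrix (relPoint (branchCoords Z s))).det = 0 := by
    filter_upwards [hc, hZ.1.mem_nhds ht] with s hs hsU
    rw [relPoint_branchCoords hZ hsU]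
    by_contra h
    exact hs ⟨hsU, h⟩
  have h1 : ∀ᶠ p in 𝓝 (branchCoords Z t), (gramMatrix (relPoint p)).det = 0 := by
    rw [← map_branchCoords hZ ht]
    exact eventually_map.mpr h0
  have ha : AnalyticOnNhd ℂ (fun p => (gramMatrix (relPoint p)).det) Set.univ := fun p _ =>
    (gramMatrix_det_analyticAt _).comp (relPoint_analyticAt p)
  have h2 := ha.eqOn_zero_of_preconnected_of_eventuallyEq_zero isPreconnected_univ
    (Set.mem_univ _) h1
  exact gramMatrix_relPoint_det_ne_zero (h2 (Set.mem_univ (![1, 0, 0, 0] : Fin 4 → ℂ)))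

end Branch

end H47

/-! ### Existence: lifting the relations to flat coordinates. -/

namespace H47

open Filter Topology Matrix

theorem jac_congr {f g : (Fin 4 → ℂ) → Fin 4 → ℂ} {t : Fin 4 → ℂ} (h : f =ᶠ[𝓝 t] g) :
    jac f t = jac g t := by
  ext k j
  have : (fun s => f s k) =ᶠ[𝓝 t] fun s => g s k := h.mono fun s hs => congrFun hs k
  simp only [jac, of_apply, pd, this.fderiv_eq]

theorem jac_comp {f x : (Fin 4 → ℂ) → Fin 4 → ℂ} {t : Fin 4 → ℂ}
    (hf : DifferentiableAt ℂ f (x t)) (hx : DifferentiableAt ℂ x t) :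
    jac (fun s => f (x s)) t = jac f (x t) * jac x t := by
  have h := fderiv_comp t hf hx
  rw [fderiv_eq_jac (hf.comp t hx), fderiv_eq_jac hf, fderiv_eq_jac hx] at h
  refine Matrix.toLin'.injective (LinearMap.ext fun v => ?_)
  rw [Matrix.toLin'_mul]
  exact congrArg (fun L : (Fin 4 → ℂ) →L[ℂ] Fin 4 → ℂ => L v) h

/-- A local inverse of an analytic map with invertible Jacobian matrix. -/
theorem exists_local_inverse {f : (Fin 4 → ℂ) → Fin 4 → ℂ} {a : Fin 4 → ℂ}
    (hf : AnalyticAt ℂ f a) (h : (jac f a).det ≠ 0) :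
    ∃ g : (Fin 4 → ℂ) → Fin 4 → ℂ, AnalyticAt ℂ g (f a) ∧ g (f a) = a ∧
      (∀ᶠ p in 𝓝 (f a), f (g p) = p) ∧ ∀ᶠ s in 𝓝 a, g (f s) = s := by
  obtain ⟨e, he⟩ := exists_equiv_of_jac_det_ne_zero hf.differentiableAt h
  have hc : ContDiffAt ℂ (⊤ : WithTop ℕ∞) f a := hf.contDiffAt
  have hd : HasFDerivAt f (e : (Fin 4 → ℂ) →L[ℂ] (Fin 4 → ℂ)) a := by
    rw [he]
    exact hf.differentiableAt.hasFDerivAt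
  have hn : (⊤ : WithTop ℕ∞) ≠ 0 := by simp
  have hs := hc.hasStrictFDerivAt' hd hn
  exact ⟨hc.localInverse hd hn, (hc.to_localInverse hd hn).analyticAt,
    hc.localInverse_apply_image hd hn, hs.eventually_right_inverse, hs.eventually_left_inverse⟩

section Branch

variable {U : Set (Fin 4 → ℂ)} {Z : (Fin 4 → ℂ) → ℂ}

theorem sum_eq_jac_mul (g : Matrix (Fin 4) (Fin 4) ℂ) (f : (Fin 4 → ℂ) → Fin 4 → ℂ)
    (t : Fin 4 → ℂ) (i j : Fin 4) :
    ∑ a, ∑ b, g a b * pd a (fun s => f s i) t * pd b (fun s => f s j) t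
      = (jac f t * g * (jac f t)ᵀ) i j := by
  simp only [mul_apply, jac, of_apply, transpose_apply, Finset.sum_mul]
  rw [Finset.sum_comm]
  exact Finset.sum_congr rfl fun b _ => Finset.sum_congr rfl fun a _ => by ring

theorem jac_relY (hZ : IsBranch U Z) {t : Fin 4 → ℂ} (ht : t ∈ U) :
    jac (fun s => relY s (Z s)) t * intersectionForm (F Z) E t
      * (jac (fun s => relY s (Z s)) t)ᵀ = gramMatrix (relY t (Z t)) := by
  ext k l
  rw [← gradProd_relY_eq_gramMatrix hZ ht, gradProd, sum_eq_jac_mul]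

theorem jac_relY_mulVec_E (hZ : IsBranch U Z) {t : Fin 4 → ℂ} (ht : t ∈ U) (k : Fin 4) :
    (jac (fun s => relY s (Z s)) t *ᵥ E t) k = 3 / 10 * halfDeg k * relY t (Z t) k := by
  have h : (jac (fun s => relY s (Z s)) t *ᵥ E t) k
      = ∑ b, E t b * pd b (fun s => relY s (Z s) k) t := by
    simp only [mulVec, dotProduct, jac, of_apply, mul_comm]
  rw [h]
  refine Fin.lastCases ?_ (fun k => ?_) k
  · change ∑ b, E t b * pd b (fun s => relY s (Z s) 3) t = 3 / 10 * ((1 : ℕ) : ℂ) * relY t (Z t) 3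
    simp only [pd_relY_three, mul_ite, mul_zero, Finset.sum_ite_eq', Finset.mem_univ, if_true]
    simp [E, relY_three]
    ring
  · rw [euler_relY hZ ht]
    congr 1
    fin_cases k <;> norm_num [relWt, halfDeg]

theorem jac_basicInvariant_mulVec (x : Fin 4 → ℂ) (k : Fin 4) :
    (jac basicInvariant x *ᵥ x) k = 2 * halfDeg k * basicInvariant x k := by
  rw [← euler_basicInvariant]
  simp only [mulVec, dotProduct, jac, of_apply, mul_comm]

/-- Lifts of the relations to the orbit map of the basic invariants are flat coordinates. -/
theorem isFlatCoords_of_basicInvariant_eq (hZ : IsBranch U Z) {W : Set (Fin 4 → ℂ)}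
    (hW : IsOpen W) (hWU : W ⊆ regularSet U Z) {x : (Fin 4 → ℂ) → Fin 4 → ℂ}
    (hx : AnalyticOnNhd ℂ x W) (hy : ∀ t ∈ W, basicInvariant (x t) = relY t (Z t)) :
    IsFlatCoords (F Z) E charge W x := by
  have key : ∀ t ∈ W, IsUnit (jac basicInvariant (x t)).det ∧
      jac (fun s => relY s (Z s)) t = jac basicInvariant (x t) * jac x t := by
    intro t ht
    constructor
    · refine (jac_basicInvariant_det_ne_zero ?_).isUnit
      rw [hy t ht]
      exact (hWU ht).2
    · rw [← jac_comp (basicInvariant_analyticAt _).differentiableAt (hx t ht).differentiableAt]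
      exact jac_congr (mem_of_superset (hW.mem_nhds ht) fun s hs => (hy s hs).symm)
  refine ⟨hx, fun t ht i j => ?_, fun t ht i => ?_⟩
  · obtain ⟨hu, hj⟩ := key t ht
    have h1 := jac_relY hZ (hWU ht).1
    -- Both metrics have the Gram matrix at this point, so `J_y (J_x g J_xᵀ) J_yᵀ = J_y J_yᵀ` and
    -- `J_y` cancels.
    have h2 := jac_basicInvariant (x t)
    rw [hy t ht, ← h1, hj, transpose_mul] at h2
    have h3 : jac x t * intersectionForm (F Z) E t * (jac x t)ᵀ = 1 := by
      have hu' := (isUnit_iff_isUnit_det _).mpr hu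
      have hut : IsUnit (jac basicInvariant (x t))ᵀ := (isUnit_transpose _).mpr hu'
      have h4 : jac basicInvariant (x t) * ((jac x t * intersectionForm (F Z) E t * (jac x t)ᵀ)
          * (jac basicInvariant (x t))ᵀ)
          = jac basicInvariant (x t) * (1 * (jac basicInvariant (x t))ᵀ) := by
        rw [one_mul, h2]
        simp only [Matrix.mul_assoc]
      exact hut.mul_right_cancel (hu'.mul_left_cancel h4)
    rw [sum_eq_jac_mul, h3, one_apply]
  · obtain ⟨hu, hj⟩ := key t ht
    -- In each coordinate `E` acts by `3 / 10` of half the degree, the radial field by the full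
    -- degree. The ratio `3 / 20` does not depend on `k`, which allows cancelling `J_y`.
    have h1 : jac basicInvariant (x t) *ᵥ (jac x t *ᵥ E t)
        = jac basicInvariant (x t) *ᵥ ((3 / 20 : ℂ) • x t) := by
      funext k
      rw [mulVec_mulVec, ← hj, jac_relY_mulVec_E hZ (hWU ht).1, mulVec_smul, Pi.smul_apply,
        jac_basicInvariant_mulVec, hy t ht, smul_eq_mul]
      ring
    have h2 := congrFun (mulVec_injective_of_det_ne_zero hu.ne_zero h1) i
    simp only [mulVec, dotProduct, jac, of_apply, Pi.smul_apply, smul_eq_mul] at h2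
    simp only [mul_comm (E t _), h2, charge]
    norm_num

/-- The value of the right-hand sides at `t₀` is attained by the orbit map at some `x₀`, where that
map is a local isomorphism. Its local inverse composed with the right-hand sides is the lift. -/
theorem exists_flatCoords (hZ : IsBranch U Z) {V : Set (Fin 4 → ℂ)} (hV : IsOpen V)
    (hVU : V ⊆ regularSet U Z) {t₀ : Fin 4 → ℂ} (h₀ : t₀ ∈ V) :
    ∃ (W : Set (Fin 4 → ℂ)) (x : (Fin 4 → ℂ) → Fin 4 → ℂ),
      IsOpen W ∧ t₀ ∈ W ∧ W ⊆ V ∧ Set.InjOn x W ∧ IsFlatCoords (F Z) E charge W x ∧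
      ∀ t ∈ W, basicInvariant (x t) = relY t (Z t) := by
  obtain ⟨x₀, hx₀⟩ := mem_range_basicInvariant (hVU h₀).2
  have hd₀ : (jac basicInvariant x₀).det ≠ 0 := by
    refine jac_basicInvariant_det_ne_zero ?_
    rw [hx₀]
    exact (hVU h₀).2
  obtain ⟨g, hga, -, hgr, -⟩ := exists_local_inverse (basicInvariant_analyticAt x₀) hd₀
  rw [hx₀] at hga hgr
  have hY := relY_analyticAt hZ (hVU h₀).1
  set x : (Fin 4 → ℂ) → Fin 4 → ℂ := fun t => g (relY t (Z t)) with hx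
  have hxa : AnalyticAt ℂ x t₀ := hga.comp (f := fun t => relY t (Z t)) hY
  have hev := hxa.eventually_analyticAt.and ((hY.continuousAt.eventually hgr).and (hV.mem_nhds h₀))
  obtain ⟨W, hWsub, hW, hWt⟩ := mem_nhds_iff.mp hev
  have hflat : IsFlatCoords (F Z) E charge W x := isFlatCoords_of_basicInvariant_eq hZ hW
    (fun t ht => hVU (hWsub ht).2.2) (fun t ht => (hWsub ht).1) fun t ht => (hWsub ht).2.1
  -- `J g Jᵀ = 1` forces `J` to be invertible, so `x` is injective after shrinking.
  have hdx : (jac x t₀).det ≠ 0 := by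
    have h : jac x t₀ * intersectionForm (F Z) E t₀ * (jac x t₀)ᵀ = 1 := by
      ext i j
      rw [← sum_eq_jac_mul, hflat.2.1 t₀ hWt, one_apply]
    intro h0
    have := congrArg det h
    simp [h0] at this
  obtain ⟨f, -, -, -, hf⟩ := exists_local_inverse hxa hdx
  obtain ⟨W', hWsub', hW', hWt'⟩ := mem_nhds_iff.mp hf
  refine ⟨W ∩ W', x, hW.inter hW', ⟨hWt, hWt'⟩, fun t ht => (hWsub ht.1).2.2,
    fun s hs t ht hst => ?_, ⟨fun t ht => hflat.1 t ht.1, fun t ht => hflat.2.1 t ht.1,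
      fun t ht => hflat.2.2 t ht.1⟩, fun t ht => (hWsub ht.1).2.1⟩
  rw [← show f (x s) = s from hWsub' hs.2, hst, show f (x t) = t from hWsub' ht.2]

end Branch

end H47

/-! ### Rigidity: uniqueness of flat coordinates up to orthogonal matrices. -/

namespace H47

open Filter Topology Matrix SparsePoly

section Rigidity

theorem pd_analyticAt {f : (Fin 4 → ℂ) → ℂ} {t : Fin 4 → ℂ} (hf : AnalyticAt ℂ f t) (j : Fin 4) :
    AnalyticAt ℂ (pd j f) t :=
  ((ContinuousLinearMap.apply ℂ ℂ (Pi.single j 1 : Fin 4 → ℂ)).analyticAt _).comp hf.fderiv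

theorem pd_comm {f : (Fin 4 → ℂ) → ℂ} {t : Fin 4 → ℂ} (hf : AnalyticAt ℂ f t) (i j : Fin 4) :
    pd i (pd j f) t = pd j (pd i f) t := by
  have h : ∀ i j, pd i (pd j f) t
      = fderiv ℂ (fderiv ℂ f) t (Pi.single i 1) (Pi.single j 1) := fun i j => by
    have h1 := (ContinuousLinearMap.apply ℂ ℂ (Pi.single j 1 : Fin 4 → ℂ)).hasFDerivAt.comp t
      hf.fderiv.differentiableAt.hasFDerivAt
    exact congrArg (fun L : (Fin 4 → ℂ) →L[ℂ] ℂ => L (Pi.single i 1)) h1.fderiv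
  rw [h, h]
  exact (ContDiffAt.isSymmSndFDerivAt_of_omega hf.contDiffAt).eq _ _

theorem pd_sum {ι : Type*} (s : Finset ι) {f : ι → (Fin 4 → ℂ) → ℂ} {t : Fin 4 → ℂ} (j : Fin 4)
    (hf : ∀ i, DifferentiableAt ℂ (f i) t) :
    pd j (fun u => ∑ i ∈ s, f i u) t = ∑ i ∈ s, pd j (f i) t := by
  rw [pd, fderiv_fun_sum fun i _ => hf i, _root_.sum_apply]
  rfl

theorem pd_congr_nhds {f g : (Fin 4 → ℂ) → ℂ} {t : Fin 4 → ℂ} (h : f =ᶠ[𝓝 t] g) (j : Fin 4) :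
    pd j f t = pd j g t := by
  rw [pd, pd, h.fderiv_eq]

/-- The derivative of a matrix of functions. -/
noncomputable def pdMatrix (j : Fin 4) (A : (Fin 4 → ℂ) → Matrix (Fin 4) (Fin 4) ℂ)
    (t : Fin 4 → ℂ) : Matrix (Fin 4) (Fin 4) ℂ :=
  Matrix.of fun a b => pd j (fun s => A s a b) t

theorem pdMatrix_mul {A B : (Fin 4 → ℂ) → Matrix (Fin 4) (Fin 4) ℂ} {t : Fin 4 → ℂ} (j : Fin 4)
    (hA : ∀ a b, DifferentiableAt ℂ (fun s => A s a b) t)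
    (hB : ∀ a b, DifferentiableAt ℂ (fun s => B s a b) t) :
    pdMatrix j (fun s => A s * B s) t = pdMatrix j A t * B t + A t * pdMatrix j B t := by
  ext a b
  simp only [pdMatrix, of_apply, Matrix.add_apply, mul_apply]
  rw [pd_sum _ _ fun i => (hA a i).fun_mul (hB i b), ← Finset.sum_add_distrib]
  refine Finset.sum_congr rfl fun i _ => ?_
  rw [pd_mul (hA a i) (hB i b)]
  ring

theorem jac_entry_analyticAt {x : (Fin 4 → ℂ) → Fin 4 → ℂ} {t : Fin 4 → ℂ}
    (hx : AnalyticAt ℂ x t) (a b : Fin 4) : AnalyticAt ℂ (fun s => jac x s a b) t :=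
  pd_analyticAt (analyticAt_pi_iff.mp hx a) b

/-- The Christoffel symbols of the first kind of the pullback of the standard form. -/
theorem jac_transpose_mul_pdMatrix {x : (Fin 4 → ℂ) → Fin 4 → ℂ} {t : Fin 4 → ℂ}
    (hx : AnalyticAt ℂ x t) (a b c : Fin 4) :
    2 * ((jac x t)ᵀ * pdMatrix a (jac x) t) c b
      = pd a (fun s => ((jac x s)ᵀ * jac x s) b c) t + pd b (fun s => ((jac x s)ᵀ * jac x s) a c) t
        - pd c (fun s => ((jac x s)ᵀ * jac x s) a b) t := by
  have hd : ∀ i j, DifferentiableAt ℂ (pd j fun s => x s i) t := fun i j =>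
    (pd_analyticAt (analyticAt_pi_iff.mp hx i) j).differentiableAt
  have h : ∀ a b c, pd a (fun s => ((jac x s)ᵀ * jac x s) b c) t
      = ∑ i, (pd a (pd b fun s => x s i) t * pd c (fun s => x s i) t
        + pd b (fun s => x s i) t * pd a (pd c fun s => x s i) t) := fun a b c => by
    simp only [mul_apply, transpose_apply, jac, of_apply]
    rw [pd_sum _ _ fun i => (hd i b).fun_mul (hd i c)]
    refine Finset.sum_congr rfl fun i _ => ?_
    rw [pd_mul (hd i b) (hd i c)]
    ring
  rw [h, h, h, ← Finset.sum_add_distrib, ← Finset.sum_sub_distrib, mul_apply, Finset.mul_sum]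
  refine Finset.sum_congr rfl fun i _ => ?_
  -- Symmetry of second derivatives cancels all terms of the alternating sum except two equal ones.
  have hc := pd_comm (analyticAt_pi_iff.mp hx i)
  simp only [transpose_apply, pdMatrix, jac, of_apply]
  rw [hc b a, hc c a, hc c b]
  ring

/-- Coordinates which pull the standard form back to the same metric differ by a constant matrix,
up to translations. -/
theorem pdMatrix_eq_zero {x y : (Fin 4 → ℂ) → Fin 4 → ℂ}
    {A : (Fin 4 → ℂ) → Matrix (Fin 4) (Fin 4) ℂ} {t : Fin 4 → ℂ}
    (hx : AnalyticAt ℂ x t) (hy : AnalyticAt ℂ y t)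
    (hA : ∀ a b, DifferentiableAt ℂ (fun s => A s a b) t)
    (hAx : ∀ᶠ s in 𝓝 t, jac y s = A s * jac x s)
    (hxy : ∀ᶠ s in 𝓝 t, (jac y s)ᵀ * jac y s = (jac x s)ᵀ * jac x s)
    (hu : IsUnit (jac x t)) (huy : IsUnit (jac y t)) (j : Fin 4) : pdMatrix j A t = 0 := by
  -- Equal metrics have equal Christoffel symbols.
  have h1 : (jac y t)ᵀ * pdMatrix j (jac y) t = (jac x t)ᵀ * pdMatrix j (jac x) t := by
    ext c b
    refine mul_left_cancel₀ (two_ne_zero (α := ℂ)) ?_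
    rw [jac_transpose_mul_pdMatrix hx, jac_transpose_mul_pdMatrix hy]
    have h : ∀ a b c, pd a (fun s => ((jac y s)ᵀ * jac y s) b c) t
        = pd a (fun s => ((jac x s)ᵀ * jac x s) b c) t := fun a b c =>
      pd_congr_nhds (hxy.mono fun s hs => congrFun (congrFun hs b) c) a
    rw [h, h, h]
  have h2 : pdMatrix j (jac y) t = pdMatrix j A t * jac x t + A t * pdMatrix j (jac x) t := by
    rw [← pdMatrix_mul j hA fun a b => (jac_entry_analyticAt hx a b).differentiableAt]
    ext a b
    exact pd_congr_nhds (hAx.mono fun s hs => congrFun (congrFun hs a) b) j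
  -- By this identity the term with `A t` in the product rule already accounts for the Christoffel
  -- symbols of `x`, leaving `J_yᵀ (∂A) J_x = 0`.
  have h3 : (jac y t)ᵀ * A t = (jac x t)ᵀ := by
    refine hu.mul_right_cancel ?_
    rw [Matrix.mul_assoc, ← hAx.self_of_nhds, hxy.self_of_nhds]
  rw [h2, Matrix.mul_add, ← Matrix.mul_assoc _ (A t), h3, add_eq_right] at h1
  have huy' := (isUnit_transpose _).mpr huy
  refine hu.mul_right_cancel (huy'.mul_left_cancel ?_)
  rw [h1, Matrix.zero_mul, Matrix.mul_zero]

theorem fderiv_eq_zero_of_pd {f : (Fin 4 → ℂ) → ℂ} {t : Fin 4 → ℂ} (h : ∀ j, pd j f t = 0) :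
    fderiv ℂ f t = 0 := by
  refine ContinuousLinearMap.coe_injective (LinearMap.pi_ext' fun j => LinearMap.ext_ring ?_)
  exact h j

end Rigidity

section Branch

variable {U : Set (Fin 4 → ℂ)} {Z : (Fin 4 → ℂ) → ℂ}

theorem intersectionForm_analyticAt (hZ : IsBranch U Z) {t : Fin 4 → ℂ} (ht : t ∈ U)
    (i j : Fin 4) : AnalyticAt ℂ (fun s => intersectionForm (F Z) E s i j) t :=
  (analyticAt_const.mul (analyticAt_const.mul (den_vars_analyticAt hZ (hessSP i.rev j.rev) ht))).congr
    (mem_of_superset (hZ.1.mem_nhds ht) fun _ hs => (intersectionForm_eq hZ hs i j).symm)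

theorem IsFlatCoords.jac_mul {W : Set (Fin 4 → ℂ)} {x : (Fin 4 → ℂ) → Fin 4 → ℂ}
    (hx : IsFlatCoords (F Z) E charge W x) {t : Fin 4 → ℂ} (ht : t ∈ W) :
    jac x t * intersectionForm (F Z) E t * (jac x t)ᵀ = 1 := by
  ext i j
  rw [← sum_eq_jac_mul, hx.2.1 t ht, one_apply]

theorem IsFlatCoords.isUnit_jac {W : Set (Fin 4 → ℂ)} {x : (Fin 4 → ℂ) → Fin 4 → ℂ}
    (hx : IsFlatCoords (F Z) E charge W x) {t : Fin 4 → ℂ} (ht : t ∈ W) : IsUnit (jac x t) := by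
  have h := hx.jac_mul ht
  rw [Matrix.mul_assoc] at h
  exact IsUnit.of_mul_eq_one _ h

theorem IsFlatCoords.mul_transpose_mul {W : Set (Fin 4 → ℂ)} {x : (Fin 4 → ℂ) → Fin 4 → ℂ}
    (hx : IsFlatCoords (F Z) E charge W x) {t : Fin 4 → ℂ} (ht : t ∈ W) :
    intersectionForm (F Z) E t * ((jac x t)ᵀ * jac x t) = 1 := by
  have h := hx.jac_mul ht
  rw [Matrix.mul_assoc] at h
  rw [← Matrix.mul_assoc]
  exact mul_eq_one_comm.mp h

theorem IsFlatCoords.mono {W W' : Set (Fin 4 → ℂ)} {x : (Fin 4 → ℂ) → Fin 4 → ℂ}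
    (hx : IsFlatCoords (F Z) E charge W x) (h : W' ⊆ W) : IsFlatCoords (F Z) E charge W' x :=
  ⟨fun t ht => hx.1 t (h ht), fun t ht => hx.2.1 t (h ht), fun t ht => hx.2.2 t (h ht)⟩

theorem IsFlatCoords.jac_mulVec_E {W : Set (Fin 4 → ℂ)} {x : (Fin 4 → ℂ) → Fin 4 → ℂ}
    (hx : IsFlatCoords (F Z) E charge W x) {t : Fin 4 → ℂ} (ht : t ∈ W) :
    jac x t *ᵥ E t = ((1 - charge) / 2) • x t := by
  funext i
  rw [Pi.smul_apply, smul_eq_mul, ← hx.2.2 t ht i]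
  simp only [mulVec, dotProduct, jac, of_apply, mul_comm]

/-- The transition matrix is locally constant, as the Christoffel symbols agree. No integration is
needed to pass from the Jacobians to the coordinates: `J_x E` is a nonzero multiple of `x`, and
likewise for `y`, which also rules out a translation. -/
theorem IsFlatCoords.exists_orthogonal (hZ : IsBranch U Z) {W : Set (Fin 4 → ℂ)} (hWU : W ⊆ U)
    (hW : IsOpen W) {x y : (Fin 4 → ℂ) → Fin 4 → ℂ} (hx : IsFlatCoords (F Z) E charge W x)
    (hy : IsFlatCoords (F Z) E charge W y) {t₀ : Fin 4 → ℂ} (h₀ : t₀ ∈ W) :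
    ∃ A : Matrix (Fin 4) (Fin 4) ℂ, Aᵀ * A = 1 ∧ ∀ᶠ t in 𝓝 t₀, y t = A *ᵥ x t := by
  -- Since `g` is inverse to `J_xᵀ J_x`, this is `J_y J_x⁻¹`, written without inverses so that
  -- analyticity is evident.
  set A : (Fin 4 → ℂ) → Matrix (Fin 4) (Fin 4) ℂ :=
    fun t => jac y t * (intersectionForm (F Z) E t * (jac x t)ᵀ) with hA
  have hAx : ∀ t ∈ W, jac y t = A t * jac x t := fun t ht => by
    rw [hA, Matrix.mul_assoc, Matrix.mul_assoc, hx.mul_transpose_mul ht, Matrix.mul_one]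
  have hxy : ∀ t ∈ W, (jac y t)ᵀ * jac y t = (jac x t)ᵀ * jac x t := fun t ht => by
    have h := mul_eq_one_comm.mp (hx.mul_transpose_mul ht)
    rw [← Matrix.one_mul ((jac y t)ᵀ * jac y t), ← h, Matrix.mul_assoc, hy.mul_transpose_mul ht,
      Matrix.mul_one]
  have hAa : ∀ t ∈ W, ∀ a b, AnalyticAt ℂ (fun s => A s a b) t := fun t ht a b => by
    simp only [hA, mul_apply, transpose_apply]
    exact Finset.analyticAt_fun_sum _ fun i _ => (jac_entry_analyticAt (hy.1 t ht) a i).mul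
      (Finset.analyticAt_fun_sum _ fun k _ => (intersectionForm_analyticAt hZ (hWU ht) i k).mul
        (jac_entry_analyticAt (hx.1 t ht) b k))
  have hd : ∀ t ∈ W, ∀ j, pdMatrix j A t = 0 := fun t ht j =>
    pdMatrix_eq_zero (hx.1 t ht) (hy.1 t ht) (fun a b => (hAa t ht a b).differentiableAt)
      (mem_of_superset (hW.mem_nhds ht) hAx) (mem_of_superset (hW.mem_nhds ht) hxy)
      (hx.isUnit_jac ht) (hy.isUnit_jac ht) j
  obtain ⟨r, hr, hball⟩ := Metric.isOpen_iff.mp hW t₀ h₀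
  have hconst : ∀ t ∈ Metric.ball t₀ r, A t = A t₀ := fun t ht => by
    ext a b
    refine Metric.isOpen_ball.is_const_of_fderiv_eq_zero (𝕜 := ℂ) (f := fun s => A s a b)
      (convex_ball t₀ r).isPreconnected
      (fun s hs => (hAa s (hball hs) a b).differentiableAt.differentiableWithinAt)
      (fun s hs => fderiv_eq_zero_of_pd fun j => congrFun (congrFun (hd s (hball hs) j) a) b)
      ht (Metric.mem_ball_self hr)
  refine ⟨A t₀, ?_, ?_⟩
  · have h1 := hxy t₀ h₀
    rw [hAx t₀ h₀, transpose_mul, Matrix.mul_assoc] at h1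
    have hu := hx.isUnit_jac h₀
    have hut := (isUnit_transpose _).mpr hu
    have h2 := hut.mul_left_cancel h1
    rw [← Matrix.mul_assoc] at h2
    exact hu.mul_right_cancel (h2.trans (Matrix.one_mul _).symm)
  · refine mem_of_superset (Metric.ball_mem_nhds t₀ hr) fun t ht => ?_
    have h1 := hy.jac_mulVec_E (hball ht)
    rw [hAx t (hball ht), hconst t ht, ← mulVec_mulVec, hx.jac_mulVec_E (hball ht),
      mulVec_smul] at h1
    have hc : (1 - charge) / 2 ≠ 0 := by norm_num [charge]
    exact (smul_right_injective (Fin 4 → ℂ) hc h1).symm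

end Branch

end H47

/-! ### The theorem. -/

theorem mainTheorem9 (U : Set (Fin 4 → ℂ)) (Z : (Fin 4 → ℂ) → ℂ) (hZ : H47.IsBranch U Z) :
    (∃ V ⊆ U, IsOpen V ∧ U ⊆ closure V ∧
      ∀ t₀ ∈ V, ∃ (W : Set (Fin 4 → ℂ)) (x : (Fin 4 → ℂ) → Fin 4 → ℂ),
        IsOpen W ∧ t₀ ∈ W ∧ W ⊆ V ∧ Set.InjOn x W ∧
        H47.IsFlatCoords (H47.F Z) H47.E H47.charge W x ∧
        ∀ t ∈ W, ∀ k : Fin 4, H47.basicInvariant (x t) k = H47.relY t (Z t) k) ∧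
    (∀ W ⊆ U, IsOpen W → IsPreconnected W →
      ∀ x : (Fin 4 → ℂ) → Fin 4 → ℂ, H47.IsFlatCoords (H47.F Z) H47.E H47.charge W x →
        ∃ A : Matrix (Fin 4) (Fin 4) ℂ, A.transpose * A = 1 ∧
          ∀ t ∈ W, ∀ k : Fin 4,
            H47.basicInvariant (A.mulVec (x t)) k = H47.relY t (Z t) k) := by
  refine ⟨⟨H47.regularSet U Z, fun t ht => ht.1, H47.isOpen_regularSet hZ,
    H47.subset_closure_regularSet hZ, fun t₀ ht₀ => ?_⟩, fun W hWU hW hWc x hx => ?_⟩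
  · obtain ⟨W, x, h1, h2, h3, h4, h5, h6⟩ :=
      H47.exists_flatCoords hZ (H47.isOpen_regularSet hZ) subset_rfl ht₀
    exact ⟨W, x, h1, h2, h3, h4, h5, fun t ht k => congrFun (h6 t ht) k⟩
  · rcases W.eq_empty_or_nonempty with rfl | ⟨s, hs⟩
    -- `IsPreconnected` admits the empty set, where any orthogonal matrix will do.
    · exact ⟨1, by simp, by simp⟩
    -- The given coordinates may live over the discriminant, so the comparison is made at a regular
    -- point of `W`, supplied by density.
    obtain ⟨t₀, ht₀W, ht₀V⟩ := mem_closure_iff.mp (H47.subset_closure_regularSet hZ (hWU hs)) W hW hs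
    obtain ⟨W', y, hW', ht₀', -, -, hy, hrel⟩ :=
      H47.exists_flatCoords hZ (H47.isOpen_regularSet hZ) subset_rfl ht₀V
    obtain ⟨A, hA, hev⟩ := H47.IsFlatCoords.exists_orthogonal hZ
      (Set.inter_subset_left.trans hWU) (hW.inter hW') (hx.mono Set.inter_subset_left)
      (hy.mono Set.inter_subset_right) ⟨ht₀W, ht₀'⟩
    refine ⟨A, hA, fun t ht k => congrFun ?_ k⟩
    have hl : AnalyticOnNhd ℂ (fun t => H47.basicInvariant (A.mulVec (x t))) W := fun t ht =>
      (H47.basicInvariant_analyticAt _).comp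
        (((Matrix.toLin' A).toContinuousLinearMap.analyticAt _).comp (hx.1 t ht))
    have hr : AnalyticOnNhd ℂ (fun t => H47.relY t (Z t)) W := fun t ht =>
      H47.relY_analyticAt hZ (hWU ht)
    -- Both sides are analytic on all of `W`, irregular points included, so agreement near `t₀`
    -- propagates.
    refine hl.eqOn_of_preconnected_of_eventuallyEq hr hWc ht₀W ?_ ht
    filter_upwards [hev, hW'.mem_nhds ht₀'] with t h1 h2
    rw [← h1, hrel t h2]
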